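/- Let $E$ be a complex Hilbert space with a Hilbert basis $(\Phi_i)_{i\in I}$, let $H_0=\sum_i E_i|\Phi_i\rangle\langle\Phi_i|$ ($E_i\in\mathbb R$) be a possibly unbounded self-adjoint diagonal operator on its maximal domain, let $E_0$ be the lowest eigenvalue of $H_0$, separated by a gap from the other eigenvalues, let $P$ be the orthogonal projection onto its (possibly degenerate) eigenspace, and let $V$ be a bounded operator. For $\epsilon>0$ put $H_{I\epsilon}(t)=e^{iH_0t}Ve^{-iH_0t}e^{-\epsilon|t|}$, $H_i=-iH_{I\epsilon}$, $A=(1-P)H_i$, $B=-PH_i$. All operator integrals below are strong integrals. A signed permutation $\bar\sigma\in B_n$ is a permutation of $1,\dots,n$ in one-line notation some of whose entries carry a bar. Put $$H_{\bar\sigma}=\langle\bar\sigma\rangle=\int_{t_n\le\dots\le t_1\le 0}X_1(t_{\sigma(1)})\cdots X_n(t_{\sigma(n)})\,dt_1\cdots dt_n,$$ where $X_i=B$ if $\bar\sigma(i)$ is barred and $X_i=A$ otherwise. It has a progression in position $i<n$ if $|\bar\sigma(i)|<|\bar\sigma(i+1)|$ and $\bar\sigma(i+1)$ is unbarred, or $|\bar\sigma(i)|>|\bar\sigma(i+1)|$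 and $\bar\sigma(i+1)$ is barred; otherwise it has a regression there. $R^n_\emptyset$ is the sum of all $\bar\sigma\in B_n$ without regressions. Replace $V$ by $\lambda V$ and expand in formal power series in the coupling constant $\lambda$, the order in $\lambda$ being the order of perturbation theory ($\bar\sigma\in B_n$ has order $n$). Put $H=H_0+\lambda V$, $$U_\epsilon(0)=\sum_n\lambda^n\int_{t_n\le\dots\le t_1\le 0}H_i(t_1)\cdots H_i(t_n)\,dt_1\cdots dt_n,\qquad U_{GL}(\epsilon)=U_\epsilon(0)P\,(PU_\epsilon(0)P)^{-1},$$ the inverse being taken within the image of $P$, and $$\mathrm{Pic}=\sum_n\lambda^n\langle R^n_\emptyset\rangle,\qquad \Omega_\epsilon=\log \mathrm{Pic}=\sum_{n\ge1}\lambda^n\Omega_{\epsilon,n}.$$ Since $PH_0=E_0P$, $PH$ is the bounded operator $E_0P+\lambda PV$. Write $H_I$ for $H$ in the interaction representation at $t=0$, so that $H_I=H$. Then: 1. For every $\epsilon>0$ there is $r>0$ such that for all $\lambda\in\mathbb C$ with $|\lambda|<r$ the equation $i\partial_tU(t)=\lambda H_{I\epsilon}(t)U(t)$ (on every vector), with $U(t)\to1$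 strongly as $t\to-\infty$, has a unique solution, $PU(0)P$ is invertible within the image of $P$, and the series $U_{GL}(\epsilon)$ converges in norm to $U(0)P(PU(0)P)^{-1}$. The coefficients of $U_{GL}(\epsilon)$ take values in the domain of $H_0$. 2. For every $\epsilon>0$, to all orders, $U_{GL}(\epsilon)=P+(1-P)\exp(\Omega_\epsilon)P$, hence $PHU_{GL}(\epsilon)=PH_I\,(P+(1-P)\exp(\Omega_\epsilon)P)$. 3. $\Omega_\epsilon$ has no constant term, and its terms of orders $1,2,3$ are $$\Omega_{\epsilon,1}=H_{(1)}+H_{(\bar1)},$$ $$\Omega_{\epsilon,2}=\tfrac12\big[H_{(12)}+H_{(\bar12)}+H_{(2\bar1)}+H_{(\bar2\bar1)}-H_{(1\bar2)}-H_{(\bar1\bar2)}-H_{(21)}-H_{(\bar21)}\big],$$ $$\begin{aligned}\Omega_{\epsilon,3}={}&\tfrac13\big[H_{(123)}+H_{(\bar123)}+H_{(13\bar2)}+H_{(\bar13\bar2)}+H_{(2\bar13)}+H_{(\bar2\bar13)}+H_{(23\bar1)}+H_{(\bar23\bar1)}\\&+H_{(3\bar2\bar1)}+H_{(\bar3\b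ar2\bar1)}+H_{(3\bar12)}+H_{(\bar3\bar12)}+H_{(321)}+H_{(\bar321)}+H_{(2\bar31)}+H_{(\bar2\bar31)}\\&+H_{(1\bar2\bar3)}+H_{(\bar1\bar2\bar3)}+H_{(1\bar32)}+H_{(\bar1\bar32)}+H_{(21\bar3)}+H_{(\bar21\bar3)}+H_{(31\bar2)}+H_{(\bar31\bar2)}\big]\\&-\tfrac16\big[H_{(132)}+H_{(\bar132)}+H_{(231)}+H_{(\bar231)}+H_{(213)}+H_{(\bar213)}+H_{(312)}+H_{(\bar312)}\\&+H_{(1\bar3\bar2)}+H_{(\bar1\bar3\bar2)}+H_{(1\bar23)}+H_{(\bar1\bar23)}+H_{(2\bar1\bar3)}+H_{(\bar2\bar1\bar3)}+H_{(3\bar1\bar2)}+H_{(\bar3\bar1\bar2)}\\&+H_{(2\bar3\bar1)}+H_{(\bar2\bar3\bar1)}+H_{(3\bar21)}+H_{(\bar3\bar21)}+H_{(12\bar3)}+H_{(\bar12\bar3)}+H_{(32\bar1)}+H_{(\bar32\bar1)}\big].\end{aligned}$$ 4. The effective Hamiltonian $\mathcal H=\lim_{\epsilon\to0^+}PHU_{GL}(\epsilon)$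 exists (norm limit of the coefficient of each order in $\lambda$), and $$\mathcal H=\lim_{\epsilon\to0^+}PH_I\,(P+(1-P)\exp(\Omega_\epsilon)P)$$ to all orders, while $$\mathcal H=\lim_{\epsilon\to0^+}PH_I\,\big(P+(1-P)\exp(\lambda\Omega_{\epsilon,1}+\lambda^2\Omega_{\epsilon,2}+\lambda^3\Omega_{\epsilon,3})P\big)$$ holds for the coefficients of $\lambda^n$ with $n\le4$, in particular up to the third order. -/

import Mathlib

open Filter Topology MeasureTheory
open scoped ENNReal

noncomputable section

namespace Hyperoctahedral

/-! ### Signed permutations and regressions -/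

/-- Signed permutations of size `n`: the underlying permutation `σ` together with the positions
that carry a bar (`true` means barred). Indices are `0`-based here; see `oneLine`. -/
abbrev SignedPerm (n : ℕ) : Type := Equiv.Perm (Fin n) × (Fin n → Bool)

/-- One-line notation with entries in `{±1, …, ±n}`: the barred integer `k̄` is written `-k`. -/
def oneLine {n : ℕ} (s : SignedPerm n) (i : Fin n) : ℤ :=
  if s.2 i then -((s.1 i : ℕ) + 1 : ℤ) else ((s.1 i : ℕ) + 1 : ℤ)

/-- For adjacent letters `a`, `c` of a one-line notation: either the absolute value increases and
`c` is unbarred, or it decreases and `c` is barred. -/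
def IsProgression (a c : ℤ) : Prop := (|a| < |c| ∧ 0 < c) ∨ (|c| < |a| ∧ c < 0)

/-- `Reg(s) = ∅`: there is a progression in every position. -/
def NoRegression {n : ℕ} (s : SignedPerm n) : Prop :=
  ∀ i j : Fin n, (i : ℕ) + 1 = j → IsProgression (oneLine s i) (oneLine s j)

instance {n : ℕ} (s : SignedPerm n) : Decidable (NoRegression s) := by
  unfold NoRegression IsProgression; infer_instance

/-! ### Formal power series with coefficients in a (noncommutative) complex algebra -/

section Formal

variable {R : Type*} [Ring R] [Algebra ℂ R]

/-- `exp F = ∑ Fᵏ / k!`, for `F` without constant term (then `Fᵏ` starts in degree `≥ k`). -/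
def formalExp (F : PowerSeries R) : PowerSeries R :=
  PowerSeries.mk fun n =>
    ∑ k ∈ Finset.range (n + 1), ((k.factorial : ℂ)⁻¹) • PowerSeries.coeff n (F ^ k)

/-- `log F = ∑ (-1)^(k-1) (F - 1)ᵏ / k`, for `F` with constant term `1`. -/
def formalLog (F : PowerSeries R) : PowerSeries R :=
  PowerSeries.mk fun n =>
    ∑ k ∈ Finset.Icc 1 n, ((-1 : ℂ) ^ (k - 1) / (k : ℂ)) • PowerSeries.coeff n ((F - 1) ^ k)

end Formal

/-- For an idempotent `p` and `s = p s p`: the inverse of `s` in the corner ring `p R p`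
("within the image of `p`"), extended by zero. -/
def cornerInverse {R : Type*} [Ring R] (p s : R) : R := Ring.inverse (s + (1 - p)) * p

theorem cornerInverse_eq {R : Type*} [Ring R] {p s t : R} (hp : p * p = p)
    (hs : p * s = s) (hs' : s * p = s) (ht : p * t = t) (ht' : t * p = t)
    (hst : s * t = p) (hts : t * s = p) : cornerInverse p s = t := by
  have h1 : (s + (1 - p)) * (t + (1 - p)) = 1 := by
    simp only [add_mul, mul_add, sub_mul, mul_sub, one_mul, mul_one, hst, hs', ht, hp]; abel
  have h2 : (t + (1 - p)) * (s + (1 - p)) = 1 := by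
    simp only [add_mul, mul_add, sub_mul, mul_sub, one_mul, mul_one, hts, ht', hs, hp]; abel
  have h3 : Ring.inverse (s + (1 - p)) = t + (1 - p) :=
    Ring.inverse_unit (⟨s + (1 - p), t + (1 - p), h1, h2⟩ : Rˣ)
  rw [cornerInverse, h3, add_mul, sub_mul, one_mul, hp, ht', sub_self, add_zero]

/-- `U P (P U P)⁻¹`, the inverse being taken within the image of `P`. It is used both for
operators and for formal power series of operators. -/
def gellMannLow {R : Type*} [Ring R] (p u : R) : R := u * p * cornerInverse p (p * u * p)

/-! ### Operators -/

section Operators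

variable {E : Type*} [NormedAddCommGroup E] [InnerProductSpace ℂ E]
variable {ι : Type*}

/-- The diagonal operator `∑ i, c i |Φ i⟩⟨Φ i|` for a Hilbert basis `Φ` and `|c i| ≤ 1`. -/
def diagOp (Φ : HilbertBasis ι ℂ E) (c : ι → ℂ) (hc : ∀ i, ‖c i‖ ≤ 1) : E →L[ℂ] E :=
  have hle : ∀ (x : lp (fun _ : ι => ℂ) 2) (i : ι), ‖c i * x i‖ ≤ ‖x i‖ := fun x i => by
    rw [norm_mul]; exact mul_le_of_le_one_left (norm_nonneg _) (hc i)
  have hmem : ∀ x : lp (fun _ : ι => ℂ) 2, Memℓp (fun i => c i * x i) 2 := fun x =>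
    (lp.memℓp x).norm.mono (hle x)
  let L : lp (fun _ : ι => ℂ) 2 →ₗ[ℂ] lp (fun _ : ι => ℂ) 2 :=
    { toFun := fun x => ⟨fun i => c i * x i, hmem x⟩
      map_add' := fun x y => by ext i; exact mul_add _ _ _
      map_smul' := fun a x => by ext i; exact mul_left_comm _ _ _ }
  (Φ.repr.symm.toContinuousLinearEquiv : lp (fun _ : ι => ℂ) 2 →L[ℂ] E) ∘L
    (L.mkContinuous 1 fun x => by
      rw [one_mul]; exact lp.norm_mono (by norm_num) (hle x)) ∘L
    (Φ.repr.toContinuousLinearEquiv : E →L[ℂ] lp (fun _ : ι => ℂ) 2)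

/-- The (strong) integral `∫ F dμ` of an operator-valued function, `(∫ F dμ) ψ = ∫ F ψ dμ`. -/
def strongIntegral {α : Type*} [MeasurableSpace α] (μ : Measure α) (F : α → E →L[ℂ] E) :
    E →L[ℂ] E :=
  open Classical in
  if h : ∃ T : E →L[ℂ] E, ∀ ψ, Integrable (fun x => F x ψ) μ ∧ T ψ = ∫ x, F x ψ ∂μ
  then h.choose else 0

end Operators

/-! ### The physical system -/

/-- An unperturbed Hamiltonian `H₀ = ∑ i, energy i |Φ i⟩⟨Φ i|` (possibly unbounded), an index
`ground` of one of its eigenvectors, and a bounded perturbation `V`. -/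
structure PerturbedSystem (ι E : Type*) [NormedAddCommGroup E] [InnerProductSpace ℂ E] where
  basis : HilbertBasis ι ℂ E
  energy : ι → ℝ
  ground : ι
  V : E →L[ℂ] E

namespace PerturbedSystem

variable {ι E : Type*} [NormedAddCommGroup E] [InnerProductSpace ℂ E]
variable (S : PerturbedSystem ι E)

/-- The energy of the distinguished eigenspace. -/
def E₀ : ℝ := S.energy S.ground

/-- `E₀` is the lowest eigenvalue of `H₀` and it is isolated: it is followed by a gap. This is
automatic when the eigenvalues can be listed as a sequence `E 0 ≤ E 1 ≤ …`. -/
def HasGap : Prop := ∃ δ > 0, ∀ i, S.energy i = S.E₀ ∨ S.E₀ + δ ≤ S.energy i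

/-- The self-adjoint operator `H₀`, on its maximal domain. -/
def H₀ : E →ₗ.[ℂ] E where
  domain :=
    { carrier := {ψ | Memℓp (fun i => (S.energy i : ℂ) * S.basis.repr ψ i) 2}
      add_mem' := fun {x y} hx hy => by
        have h := Memℓp.add hx hy
        have he : (fun i => (S.energy i : ℂ) * S.basis.repr (x + y) i) =
            (fun i => (S.energy i : ℂ) * S.basis.repr x i) +
              fun i => (S.energy i : ℂ) * S.basis.repr y i := by
          funext i; simp [mul_add]
        rw [Set.mem_ofPred_eq, he]; exact h
      zero_mem' := by
        have he : (fun i => (S.energy i : ℂ) * S.basis.repr 0 i) = 0 := by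
          funext i; simp
        rw [Set.mem_ofPred_eq, he]; exact zero_memℓp
      smul_mem' := fun a x hx => by
        have h := Memℓp.const_smul (𝕜 := ℂ) hx a
        have he : (fun i => (S.energy i : ℂ) * S.basis.repr (a • x) i) =
            a • fun i => (S.energy i : ℂ) * S.basis.repr x i := by
          funext i; simp [mul_left_comm]
        rw [Set.mem_ofPred_eq, he]; exact h }
  toFun :=
    { toFun := fun ψ => S.basis.repr.symm
        ⟨fun i => (S.energy i : ℂ) * S.basis.repr (ψ : E) i, ψ.2⟩
      map_add' := fun x y => by
        rw [← map_add]
        congr 1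
        ext i
        simp only [Submodule.coe_add, map_add, lp.coeFn_add, Pi.add_apply, mul_add]
      map_smul' := fun a x => by
        rw [← map_smul]
        congr 1
        ext i
        simp [mul_left_comm] }

/-- The orthogonal projection onto the eigenspace of `H₀` for the eigenvalue `E₀`. -/
def P : E →L[ℂ] E :=
  open Classical in
  diagOp S.basis (fun i => if S.energy i = S.E₀ then 1 else 0) fun _ => by
    split_ifs <;> simp

/-- `exp(i t H₀)`. -/
def freeEvolution (t : ℝ) : E →L[ℂ] E :=
  diagOp S.basis (fun i => Complex.exp ((t * S.energy i : ℝ) * Complex.I)) fun _ =>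
    (Complex.norm_exp_ofReal_mul_I _).le

/-- `H_{I ε}(t) = exp(i t H₀) V exp(-i t H₀) exp(-ε |t|)`. -/
def interaction (ε t : ℝ) : E →L[ℂ] E :=
  (Real.exp (-ε * |t|) : ℂ) • (S.freeEvolution t * S.V * S.freeEvolution (-t))

/-- The evolution operator in the interaction representation with coupling constant `lam`:
`i ∂U/∂t = lam H_{I ε}(t) U(t)` and `U(-∞) = 1`. -/
def IsEvolution (ε : ℝ) (lam : ℂ) (U : ℝ → E →L[ℂ] E) : Prop :=
  (∀ (ψ : E) (t : ℝ), HasDerivAt (fun s => U s ψ)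
    ((-Complex.I * lam) • S.interaction ε t (U t ψ)) t) ∧
  ∀ ψ : E, Tendsto (fun s => U s ψ) atBot (𝓝 ψ)

/-- `H_i(t) = -i H_{I ε}(t)`. -/
def Hi (ε t : ℝ) : E →L[ℂ] E := (-Complex.I) • S.interaction ε t

/-- The letters: `A(t) = (1 - P) H_i(t)` (unbarred) and `B(t) = -P H_i(t)` (barred). -/
def letter (ε : ℝ) (barred : Bool) (t : ℝ) : E →L[ℂ] E :=
  if barred then -(S.P * S.Hi ε t) else (1 - S.P) * S.Hi ε t

/-- The simplex `{ tₙ ≤ … ≤ t₁ ≤ 0 }`. -/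
def simplex (n : ℕ) : Set (Fin n → ℝ) := {t | Antitone t ∧ ∀ i, t i ≤ 0}

/-- The `n`-th term `∫ H_i(t₁) … H_i(tₙ)` over `tₙ ≤ … ≤ t₁ ≤ 0` of the Picard series. -/
def picardTerm (ε : ℝ) (n : ℕ) : E →L[ℂ] E :=
  strongIntegral (volume.restrict (simplex n)) fun t =>
    (List.ofFn fun i : Fin n => S.Hi ε (t i)).prod

/-- The iterated integral `⟨σ⟩ = ∫ X(t_{σ(1)}) … X(t_{σ(n)})` over `tₙ ≤ … ≤ t₁ ≤ 0` of a signed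
permutation, where the `i`-th factor is `B` if `σ(i)` is barred and `A` otherwise. -/
def iteratedIntegral (ε : ℝ) {n : ℕ} (s : SignedPerm n) : E →L[ℂ] E :=
  strongIntegral (volume.restrict (simplex n)) fun t =>
    (List.ofFn fun i : Fin n => S.letter ε (s.2 i) (t (s.1 i))).prod

/-- `H_{(w)}`: the iterated integral of the signed permutation whose one-line notation is `w`,
barred integers being written as negative integers. -/
def H (ε : ℝ) {n : ℕ} (w : Fin n → ℤ) : E →L[ℂ] E :=
  ∑ s : SignedPerm n, if oneLine s = w then S.iteratedIntegral ε s else 0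

/-! In what follows `V` is replaced by `X V`, and operators are expanded as formal power series in
the coupling constant `X`: the order in `X` is the order of perturbation theory. -/

/-- `U_ε(0)`, as its Picard series. -/
def formalEvolution (ε : ℝ) : PowerSeries (E →L[ℂ] E) := PowerSeries.mk (S.picardTerm ε)

/-- `P`, as a constant power series. -/
def formalP : PowerSeries (E →L[ℂ] E) := PowerSeries.C S.P

/-- `U_GL(ε) = U_ε(0) P (P U_ε(0) P)⁻¹`. -/
def formalUGL (ε : ℝ) : PowerSeries (E →L[ℂ] E) := gellMannLow S.formalP (S.formalEvolution ε)

/-- `Pic = ∑ n, ⟨R_∅ⁿ⟩`, where `R_∅ⁿ` is the sum of the signed permutations of size `n` without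
regression. -/
def Pic (ε : ℝ) : PowerSeries (E →L[ℂ] E) :=
  PowerSeries.mk fun n =>
    ∑ s ∈ (Finset.univ : Finset (SignedPerm n)).filter NoRegression, S.iteratedIntegral ε s

/-- The hyperoctahedral Magnus exponent `Ω_ε = log Pic`. -/
def Omega (ε : ℝ) : PowerSeries (E →L[ℂ] E) := formalLog (S.Pic ε)

/-- The truncation of `Ω_ε` at the third order. -/
def Omega₃ (ε : ℝ) : PowerSeries (E →L[ℂ] E) :=
  PowerSeries.mk fun n => if n ≤ 3 then PowerSeries.coeff n (S.Omega ε) else 0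

/-- `P + (1 - P) exp(F) P`. -/
def magnusForm (F : PowerSeries (E →L[ℂ] E)) : PowerSeries (E →L[ℂ] E) :=
  S.formalP + (1 - S.formalP) * formalExp F * S.formalP

/-- The operator `P H`, with `H = H₀ + X V`. As `P H₀ ψ = E₀ P ψ` on the domain of `H₀`
(see `P_H₀_apply`), it is the bounded operator `E₀ P + X P V`. -/
def PH : PowerSeries (E →L[ℂ] E) :=
  PowerSeries.C ((S.E₀ : ℂ) • S.P) + PowerSeries.X * PowerSeries.C (S.P * S.V)

theorem P_H₀_apply (ψ : S.H₀.domain) : S.P (S.H₀ ψ) = (S.E₀ : ℂ) • S.P (ψ : E) := by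
  apply S.basis.repr.injective
  ext i
  have h : ∀ φ : E, S.basis.repr (S.P φ) i =
      (open Classical in if S.energy i = S.E₀ then (1 : ℂ) else 0) * S.basis.repr φ i := by
    intro φ
    simp [P, diagOp]
  have h0 : S.basis.repr (S.H₀ ψ) i = (S.energy i : ℂ) * S.basis.repr (ψ : E) i := by
    change S.basis.repr (S.basis.repr.symm
      ⟨fun i => (S.energy i : ℂ) * S.basis.repr (ψ : E) i, ψ.2⟩) i = _
    rw [LinearIsometryEquiv.apply_symm_apply]
  rw [h, h0, map_smul]
  simp only [lp.coeFn_smul, Pi.smul_apply, smul_eq_mul, h]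
  split_ifs with hi
  · rw [hi, one_mul, one_mul]
  · simp

end PerturbedSystem

end Hyperoctahedral

end

/-! Everything rests on one factorization. Attach a time to each position of a word. For distinct
times exactly one permutation orders them, and a progression says that the next letter is A if its
time is earlier than the preceding one and B if it is later. Signed permutations with prescribed
progressions therefore sum to a chain of kernels: a letter forced to progress after time s
contributes A(u) for u < s and B(u) for s ≤ u ≤ 0, a free letter contributes A(u) + B(u)
(`sum_iteratedIntegral_eq_chainInt`).

Because A = H_i + B, the chain G_m(s) of m forced letters obeys, for s ≤ 0, the Volterra recursion
G_{m+1}(s) = c_{m+1} + ∫_{u ≤ s} H_i(u) G_m(u) du, where c_{m+1} is the part with leading letter B.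
With U(s) the Picard series, C = 1 + ∑ c_m and U = U(0), this gives G(s) = U(s) C
(`progTerm_eq_sum`). At s = 0 the leading letter is A, so P U C = P; the leading letter of each c_m
is B, so (1 - P) C = 1 - P. Hence P C P inverts P U P in the corner and U_GL = U C P. Moreover Pic =
U C + C - 1, so (1 - P) Pic P = U_GL - P, and exp(log Pic) = Pic gives the exponential form
(`formalUGL_eq_magnusForm`).

A free letter does not see its predecessor, so products of coefficients of Pic are again sums over
signed permutations (`flagSum_mul`); expanding the logarithm to order three leaves a finite count.

For the adiabatic limit, a time shift of the n-th Picard term is conjugation by the free evolution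
times exp(nεs). Integration turns this into a linear equation for U P, and the quotient by P U P
satisfies a Riccati equation: the n-th coefficient of U_GL is the resolvent -i(nε + i(H₀ - E₀))⁻¹
applied to a polynomial in lower coefficients. The gap keeps this resolvent bounded as ε → 0, so all
coefficients converge by induction; solving for H₀ instead gives the domain statement. Since P H =
E₀P + λPV and P U_GL = P, truncating Ω at order three affects nothing up to order four.

For fixed ε and small λ the Picard series converges geometrically, the coefficients of the corner
inverse are bounded by (2M)ⁿ with M the integral of the dominating function, and uniqueness is a
contraction argument on a half line. -/

noncomputable section

namespace Hyperoctahedral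

/-! ### Formal exponential and logarithm -/

section Formal

variable {R : Type*} [Ring R]

/-- Two power series agree up to order `n`. -/
def AgreeTo (n : ℕ) (F G : PowerSeries R) : Prop :=
  ∀ m ≤ n, PowerSeries.coeff m F = PowerSeries.coeff m G

theorem AgreeTo.mul {n : ℕ} {F G F' G' : PowerSeries R} (h : AgreeTo n F G)
    (h' : AgreeTo n F' G') : AgreeTo n (F * F') (G * G') := fun m hm => by
  rw [PowerSeries.coeff_mul, PowerSeries.coeff_mul]
  refine Finset.sum_congr rfl fun x hx => ?_
  have := Finset.HasAntidiagonal.mem_antidiagonal.1 hx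
  rw [h x.1 (by omega), h' x.2 (by omega)]

theorem AgreeTo.pow {n : ℕ} {F G : PowerSeries R} (h : AgreeTo n F G) (k : ℕ) :
    AgreeTo n (F ^ k) (G ^ k) := by
  induction k with
  | zero => intro m _; simp
  | succ k ih => rw [pow_succ, pow_succ]; exact ih.mul h

theorem coeff_pow_eq_zero_of_lt {F : PowerSeries R} (hF : PowerSeries.coeff 0 F = 0) {m k : ℕ}
    (h : m < k) : PowerSeries.coeff m (F ^ k) = 0 := by
  induction k generalizing m with
  | zero => omega
  | succ k ih =>
    rw [pow_succ, PowerSeries.coeff_mul]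
    refine Finset.sum_eq_zero fun x hx => ?_
    have := Finset.HasAntidiagonal.mem_antidiagonal.1 hx
    rcases Nat.eq_zero_or_pos x.2 with h0 | h0
    · rw [h0, hF, mul_zero]
    · rw [ih (by omega), zero_mul]

variable [Algebra ℂ R]

theorem AgreeTo.formalExp {n : ℕ} {F G : PowerSeries R} (h : AgreeTo n F G) :
    AgreeTo n (formalExp F) (formalExp G) := fun m hm => by
  simp only [Hyperoctahedral.formalExp, PowerSeries.coeff_mk]
  exact Finset.sum_congr rfl fun k _ => by rw [h.pow k m hm]

theorem coeff_zero_formalLog (F : PowerSeries R) :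
    PowerSeries.coeff 0 (formalLog F) = 0 := by
  simp [formalLog]

/-- Higher powers start beyond degree `m`, so one truncation `N` serves all orders at once and
comparisons of coefficients become comparisons of polynomials. -/
theorem coeff_formalExp {F : PowerSeries R} (hF : PowerSeries.coeff 0 F = 0) {m N : ℕ}
    (h : m ≤ N) : PowerSeries.coeff m (formalExp F) =
      ∑ k ∈ Finset.range (N + 1), ((k.factorial : ℂ)⁻¹) • PowerSeries.coeff m (F ^ k) := by
  simp only [formalExp, PowerSeries.coeff_mk]
  refine Finset.sum_subset (Finset.range_mono (by omega)) fun k _ hk => ?_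
  rw [coeff_pow_eq_zero_of_lt hF (by simpa using hk), smul_zero]

theorem coeff_formalLog {F : PowerSeries R} (hF : PowerSeries.coeff 0 F = 1) {m N : ℕ}
    (h : m ≤ N) : PowerSeries.coeff m (formalLog F) =
      ∑ k ∈ Finset.Icc 1 N, ((-1 : ℂ) ^ (k - 1) / (k : ℂ)) • PowerSeries.coeff m ((F - 1) ^ k) := by
  simp only [formalLog, PowerSeries.coeff_mk]
  refine Finset.sum_subset (Finset.Icc_subset_Icc_right h) fun k hk hk' => ?_
  have h1 : m < k := by simp at hk hk'; omega
  rw [coeff_pow_eq_zero_of_lt (by rw [map_sub, hF]; simp) h1, smul_zero]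

/-- The derivative of `formalExp F` over a commutative ring. -/
theorem derivative_formalExp (F : PowerSeries ℂ) (hF : PowerSeries.coeff 0 F = 0) :
    PowerSeries.derivative ℂ (formalExp F) = PowerSeries.derivative ℂ F * formalExp F := by
  ext n
  set S : ℕ → PowerSeries ℂ := fun N =>
    ∑ k ∈ Finset.range (N + 1), ((k.factorial : ℂ)⁻¹) • F ^ k with hS
  have hc : ∀ N m, m ≤ N →
      PowerSeries.coeff m (formalExp F) = PowerSeries.coeff m (S N) := fun N m h => by
    rw [coeff_formalExp hF h, hS]
    simp
  have hd : PowerSeries.derivative ℂ (S (n + 1)) = PowerSeries.derivative ℂ F * S n := by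
    rw [hS]
    simp only [map_sum]
    rw [Finset.sum_range_succ', Finset.mul_sum, pow_zero, Derivation.map_smul,
      Derivation.map_one_eq_zero, smul_zero, add_zero]
    refine Finset.sum_congr rfl fun k _ => ?_
    rw [Derivation.map_smul, PowerSeries.derivative_pow]
    have : ((k + 1).factorial : ℂ)⁻¹ * (k + 1 : ℂ) = (k.factorial : ℂ)⁻¹ := by
      rw [Nat.factorial_succ]; push_cast
      have : (k + 1 : ℂ) ≠ 0 := by exact_mod_cast k.succ_ne_zero
      have : (k.factorial : ℂ) ≠ 0 := by exact_mod_cast k.factorial_ne_zero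
      field_simp
    rw [← this]
    simp only [Nat.add_sub_cancel, PowerSeries.smul_eq_C_mul, map_mul]
    push_cast
    rw [map_add, map_natCast, map_one]
    ring
  rw [PowerSeries.coeff_derivative, hc (n + 1) (n + 1) le_rfl, ← PowerSeries.coeff_derivative, hd]
  rw [PowerSeries.coeff_mul, PowerSeries.coeff_mul]
  refine Finset.sum_congr rfl fun x hx => ?_
  have := Finset.HasAntidiagonal.mem_antidiagonal.1 hx
  rw [hc n x.2 (by omega)]

/-- The series F = exp(log(1 + X)) solves (1 + X) F' = F with F(0) = 1, which determines its
coefficients recursively. -/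
theorem formalExp_formalLog_one_add_X :
    formalExp (formalLog (1 + PowerSeries.X : PowerSeries ℂ)) = 1 + PowerSeries.X := by
  set L := formalLog (1 + PowerSeries.X : PowerSeries ℂ) with hL
  have hL0 : PowerSeries.coeff 0 L = 0 := coeff_zero_formalLog _
  have hLc : ∀ n, PowerSeries.coeff (n + 1) L = (-1) ^ n / (n + 1 : ℂ) := fun n => by
    rw [hL]
    simp only [formalLog, PowerSeries.coeff_mk, add_sub_cancel_left, PowerSeries.coeff_X_pow]
    rw [Finset.sum_eq_single (n + 1)]
    · simp
    · intro b _ hb; simp [Ne.symm hb]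
    · simp
  have hdL : (1 + PowerSeries.X) * PowerSeries.derivative ℂ L = 1 := by
    ext n
    rw [add_mul, one_mul, map_add, PowerSeries.coeff_derivative]
    cases n with
    | zero => simp [hLc 0]
    | succ n =>
      rw [PowerSeries.coeff_succ_X_mul, PowerSeries.coeff_derivative, hLc, hLc, PowerSeries.coeff_one]
      have h1 : (n + 1 : ℂ) ≠ 0 := by exact_mod_cast n.succ_ne_zero
      have h2 : (n + 1 + 1 : ℂ) ≠ 0 := by exact_mod_cast (n + 1).succ_ne_zero
      push_cast
      field_simp
      simp [pow_succ]
  set F := formalExp L with hF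
  have hF0 : PowerSeries.coeff 0 F = 1 := by simp [hF, formalExp]
  have hode : (1 + PowerSeries.X) * PowerSeries.derivative ℂ F = F := by
    rw [hF, derivative_formalExp L hL0, ← mul_assoc, hdL, one_mul]
  have hrec : ∀ n, PowerSeries.coeff (n + 2) F = 0 := by
    have h1 : PowerSeries.coeff 1 F = 1 := by
      have := congrArg (PowerSeries.coeff 0) hode
      rw [add_mul, one_mul, map_add, PowerSeries.coeff_derivative] at this
      simpa [hF0] using this
    have hs : ∀ n, PowerSeries.coeff (n + 2) F * (n + 2) + PowerSeries.coeff (n + 1) F * (n + 1) =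
        PowerSeries.coeff (n + 1) F := fun n => by
      have := congrArg (PowerSeries.coeff (n + 1)) hode
      rw [add_mul, one_mul, map_add, PowerSeries.coeff_derivative, PowerSeries.coeff_succ_X_mul,
        PowerSeries.coeff_derivative] at this
      push_cast at this; linear_combination this
    intro n
    have hn : (n + 2 : ℂ) ≠ 0 := by exact_mod_cast (n + 1).succ_ne_zero
    induction n with
    | zero =>
      have := hs 0
      simp [h1] at this
      simpa using this
    | succ n ih =>
      have := hs (n + 1)
      have ih := ih (by exact_mod_cast (n + 1).succ_ne_zero)
      rw [show n + 1 + 1 = n + 2 from rfl, ih, zero_mul, add_zero] at this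
      exact (mul_eq_zero.1 this).resolve_right hn
  ext n
  match n with
  | 0 => simp [hF0]
  | 1 =>
    have := congrArg (PowerSeries.coeff 0) hode
    rw [add_mul, one_mul, map_add, PowerSeries.coeff_derivative] at this
    simpa [hF0] using this
  | n + 2 => rw [hrec]; simp [PowerSeries.coeff_X, PowerSeries.coeff_one]

-- Only the commutative algebra generated by f = F - 1 is involved. The scalar identity for 1 + X,
-- truncated modulo X^(n+1), is an identity of polynomials; evaluated at f, its error is a multiple
-- of f^(n+1), which does not reach order n.
open Polynomial in
theorem formalExp_formalLog {F : PowerSeries R} (hF : PowerSeries.coeff 0 F = 1) :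
    formalExp (formalLog F) = F := by
  ext n
  set f := F - 1 with hf
  have hf0 : PowerSeries.coeff 0 f = 0 := by rw [hf, map_sub, hF]; simp
  set l : ℂ[X] := ∑ k ∈ Finset.Icc 1 n, ((-1 : ℂ) ^ (k - 1) / (k : ℂ)) • X ^ k with hl
  set e : ℂ[X] := ∑ k ∈ Finset.range (n + 1), ((k.factorial : ℂ)⁻¹) • l ^ k with he
  -- the polynomial identity
  have hpoly : ∀ m ≤ n, e.coeff m = (1 + X : ℂ[X]).coeff m := by
    intro m hm
    have hL : AgreeTo n (formalLog (1 + PowerSeries.X : PowerSeries ℂ)) (l : PowerSeries ℂ) :=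
      fun m hm => by
        rw [coeff_formalLog (by simp) hm, Polynomial.coeff_coe, hl, Polynomial.finsetSum_coeff]
        refine Finset.sum_congr rfl fun k _ => ?_
        rw [add_sub_cancel_left, PowerSeries.coeff_X_pow, Polynomial.coeff_smul,
          Polynomial.coeff_X_pow]
    have h1 := hL.formalExp m hm
    rw [formalExp_formalLog_one_add_X, coeff_formalExp _ hm] at h1
    · have h2 : PowerSeries.coeff m (1 + PowerSeries.X : PowerSeries ℂ) =
          (1 + X : ℂ[X]).coeff m := by
        rw [← Polynomial.coeff_coe]; simp
      rw [← h2, h1, he, Polynomial.finsetSum_coeff]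
      refine Finset.sum_congr rfl fun k _ => ?_
      rw [Polynomial.coeff_smul, ← Polynomial.coeff_coe, Polynomial.coe_pow]
    · rw [← hL 0 (Nat.zero_le _)]; exact coeff_zero_formalLog _
  have hdvd : X ^ (n + 1) ∣ e - (1 + X) := Polynomial.X_pow_dvd_iff.2 fun d hd => by
    rw [Polynomial.coeff_sub, hpoly d (by omega), sub_self]
  obtain ⟨q, hq⟩ := hdvd
  have hq' : aeval f e = F + f ^ (n + 1) * aeval f q := by
    rw [← sub_add_cancel e (1 + X), hq]
    simp [hf, add_comm]
  have hL : AgreeTo n (formalLog F) (aeval f l) := fun m hm => by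
    rw [coeff_formalLog hF hm, hl]
    simp [← hf]
  rw [hL.formalExp n le_rfl, coeff_formalExp _ le_rfl]
  · have h3 : PowerSeries.coeff n (f ^ (n + 1) * aeval f q) = 0 := by
      rw [PowerSeries.coeff_mul]
      refine Finset.sum_eq_zero fun x hx => ?_
      have := Finset.HasAntidiagonal.mem_antidiagonal.1 hx
      rw [coeff_pow_eq_zero_of_lt hf0 (by omega), zero_mul]
    have h4 : PowerSeries.coeff n (aeval f e) = PowerSeries.coeff n F := by
      rw [hq', map_add, h3, add_zero]
    rw [← h4, he]
    simp
  · rw [← hL 0 (Nat.zero_le _)]; exact coeff_zero_formalLog _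

end Formal

/-! ### Strong integrals -/

section StrongIntegral

variable {E : Type*} [NormedAddCommGroup E] [InnerProductSpace ℂ E]
variable {α β : Type*} [MeasurableSpace α] [MeasurableSpace β]

/-- A family of operators which is strongly measurable on every vector. -/
def SMeas (F : α → E →L[ℂ] E) : Prop := ∀ ψ, StronglyMeasurable fun x => F x ψ

/-- Measurability is only known vector by vector, so a moving vector is approximated by simple
functions, the continuity of each `F x` giving the limit. Products of families depend on this. -/
theorem SMeas.apply {F : α → E →L[ℂ] E} (hF : SMeas F) {y : α → E} (hy : StronglyMeasurable y) :
    StronglyMeasurable fun x => F x (y x) := by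
  have hs : ∀ f : SimpleFunc α E, StronglyMeasurable fun x => F x (f x) := by
    intro f
    induction f using SimpleFunc.induction with
    | const c hs =>
      rename_i s
      have : (fun x => F x ((SimpleFunc.piecewise s hs (SimpleFunc.const α c)
          (SimpleFunc.const α 0)) x)) = s.indicator fun x => F x c := by
        ext x
        by_cases hx : x ∈ s <;> simp [SimpleFunc.piecewise_apply, hx]
      rw [this]
      exact (hF c).indicator hs
    | add hfg hf hg =>
      simp only [SimpleFunc.coe_add, Pi.add_apply, map_add]
      exact hf.add hg
  exact stronglyMeasurable_of_tendsto atTop (fun n => hs (hy.approx n))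
    (tendsto_pi_nhds.2 fun x => ((F x).continuous.tendsto _).comp (hy.tendsto_approx x))

theorem SMeas.mul {F G : α → E →L[ℂ] E} (hF : SMeas F) (hG : SMeas G) :
    SMeas fun x => F x * G x := fun ψ => hF.apply (hG ψ)

theorem SMeas.comp {F : α → E →L[ℂ] E} (hF : SMeas F) {f : β → α} (hf : Measurable f) :
    SMeas fun x => F (f x) := fun ψ => (hF ψ).comp_measurable hf

theorem SMeas.const (T : E →L[ℂ] E) : SMeas fun _ : α => T := fun _ => stronglyMeasurable_const

theorem SMeas.add {F G : α → E →L[ℂ] E} (hF : SMeas F) (hG : SMeas G) :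
    SMeas fun x => F x + G x := fun ψ => (hF ψ).add (hG ψ)

theorem SMeas.neg {F : α → E →L[ℂ] E} (hF : SMeas F) : SMeas fun x => -F x :=
  fun ψ => (hF ψ).neg

theorem SMeas.ite {p : α → Prop} [DecidablePred p] (hp : MeasurableSet {x | p x})
    {F G : α → E →L[ℂ] E} (hF : SMeas F) (hG : SMeas G) :
    SMeas fun x => if p x then F x else G x := fun ψ => by
  have : (fun x => (if p x then F x else G x) ψ) = fun x => if p x then F x ψ else G x ψ := by
    ext x
    split_ifs <;> rfl
  rw [this]
  exact StronglyMeasurable.ite hp (hF ψ) (hG ψ)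

/-- A family of operators which is strongly measurable and dominated in norm by an integrable
function. -/
structure SInt (μ : Measure α) (F : α → E →L[ℂ] E) : Prop where
  meas : SMeas F
  dom : ∃ g : α → ℝ, Integrable g μ ∧ ∀ x, ‖F x‖ ≤ g x

variable {μ : Measure α} {F G : α → E →L[ℂ] E}

theorem SInt.integrable (hF : SInt μ F) (ψ : E) : Integrable (fun x => F x ψ) μ := by
  obtain ⟨g, hg, hb⟩ := hF.dom
  refine (hg.mul_const ‖ψ‖).mono' (hF.meas ψ).aestronglyMeasurable (Eventually.of_forall fun x => ?_)
  exact (F x).le_of_opNorm_le (hb x) ψ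

theorem norm_integral_apply_le {g : α → ℝ} (hg : Integrable g μ) (hb : ∀ x, ‖F x‖ ≤ g x) (ψ : E) :
    ‖∫ x, F x ψ ∂μ‖ ≤ (∫ x, g x ∂μ) * ‖ψ‖ := by
  rw [← integral_mul_const]
  exact norm_integral_le_of_norm_le (hg.mul_const _)
    (Eventually.of_forall fun x => (F x).le_of_opNorm_le (hb x) ψ)

/-- Domination makes the vectorwise integrals a bounded operator, so the default value 0 in
`strongIntegral` is not the one taken. -/
theorem SInt.strongIntegral_apply (hF : SInt μ F) (ψ : E) :
    strongIntegral μ F ψ = ∫ x, F x ψ ∂μ := by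
  have h : ∃ T : E →L[ℂ] E, ∀ ψ, Integrable (fun x => F x ψ) μ ∧ T ψ = ∫ x, F x ψ ∂μ := by
    obtain ⟨g, hg, hb⟩ := hF.dom
    refine ⟨LinearMap.mkContinuous
      { toFun := fun ψ => ∫ x, F x ψ ∂μ
        map_add' := fun φ ψ => by
          simp only [map_add]
          exact integral_add (hF.integrable φ) (hF.integrable ψ)
        map_smul' := fun a ψ => by
          simp only [map_smul, RingHom.id_apply]
          exact integral_smul a _ } (∫ x, g x ∂μ) fun ψ => norm_integral_apply_le hg hb ψ,
      fun ψ => ⟨hF.integrable ψ, rfl⟩⟩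
  rw [strongIntegral, dif_pos h]
  exact (h.choose_spec ψ).2

theorem norm_strongIntegral_le (hF : SMeas F) {g : α → ℝ} (hg : Integrable g μ)
    (hb : ∀ x, ‖F x‖ ≤ g x) : ‖strongIntegral μ F‖ ≤ ∫ x, g x ∂μ := by
  refine ContinuousLinearMap.opNorm_le_bound _
    (integral_nonneg fun x => (norm_nonneg _).trans (hb x)) fun ψ => ?_
  rw [SInt.strongIntegral_apply ⟨hF, g, hg, hb⟩]
  exact norm_integral_apply_le hg hb ψ

theorem SInt.mul_right (hF : SInt μ F) (C : E →L[ℂ] E) : SInt μ fun x => F x * C := by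
  obtain ⟨g, hg, hb⟩ := hF.dom
  exact ⟨hF.meas.mul (SMeas.const C), fun x => g x * ‖C‖, hg.mul_const _, fun x =>
    (norm_mul_le _ _).trans (mul_le_mul_of_nonneg_right (hb x) (norm_nonneg _))⟩

theorem SInt.mul_left (hF : SInt μ F) (C : E →L[ℂ] E) : SInt μ fun x => C * F x := by
  obtain ⟨g, hg, hb⟩ := hF.dom
  exact ⟨(SMeas.const C).mul hF.meas, fun x => ‖C‖ * g x, hg.const_mul _, fun x =>
    (norm_mul_le _ _).trans (mul_le_mul_of_nonneg_left (hb x) (norm_nonneg _))⟩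

theorem SInt.add (hF : SInt μ F) (hG : SInt μ G) : SInt μ fun x => F x + G x := by
  obtain ⟨g, hg, hb⟩ := hF.dom
  obtain ⟨g', hg', hb'⟩ := hG.dom
  exact ⟨hF.meas.add hG.meas, fun x => g x + g' x, hg.add hg', fun x =>
    (norm_add_le _ _).trans (add_le_add (hb x) (hb' x))⟩

theorem strongIntegral_mul_right (hF : SInt μ F) (C : E →L[ℂ] E) :
    strongIntegral μ (fun x => F x * C) = strongIntegral μ F * C := by
  ext ψ
  rw [(hF.mul_right C).strongIntegral_apply, mul_apply_eq_comp,
    hF.strongIntegral_apply]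
  rfl

theorem strongIntegral_mul_left [CompleteSpace E] (hF : SInt μ F) (C : E →L[ℂ] E) :
    strongIntegral μ (fun x => C * F x) = C * strongIntegral μ F := by
  ext ψ
  rw [(hF.mul_left C).strongIntegral_apply, mul_apply_eq_comp,
    hF.strongIntegral_apply, ← ContinuousLinearMap.integral_comp_comm _ (hF.integrable ψ)]
  rfl

theorem strongIntegral_add (hF : SInt μ F) (hG : SInt μ G) :
    strongIntegral μ (fun x => F x + G x) = strongIntegral μ F + strongIntegral μ G := by
  ext ψ
  rw [(hF.add hG).strongIntegral_apply, add_apply,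
    hF.strongIntegral_apply, hG.strongIntegral_apply, ← integral_add (hF.integrable ψ)
      (hG.integrable ψ)]
  rfl

theorem SInt.sum {ι : Type*} {s : Finset ι} {F : ι → α → E →L[ℂ] E}
    (hF : ∀ i ∈ s, SInt μ (F i)) : SInt μ fun x => ∑ i ∈ s, F i x := by
  classical
  induction s using Finset.induction_on with
  | empty =>
    simp only [Finset.sum_empty]
    exact ⟨SMeas.const 0, fun _ => 0, integrable_zero _ _ _, fun _ => by simp⟩
  | insert a s ha ih =>
    simp only [Finset.sum_insert ha]
    exact (hF a (by simp)).add (ih fun i hi => hF i (by simp [hi]))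

theorem strongIntegral_sum {ι : Type*} {s : Finset ι} {F : ι → α → E →L[ℂ] E}
    (hF : ∀ i ∈ s, SInt μ (F i)) :
    strongIntegral μ (fun x => ∑ i ∈ s, F i x) = ∑ i ∈ s, strongIntegral μ (F i) := by
  ext ψ
  rw [(SInt.sum hF).strongIntegral_apply]
  simp only [sum_apply]
  rw [integral_finsetSum _ fun i hi => (hF i hi).integrable ψ]
  exact Finset.sum_congr rfl fun i hi => ((hF i hi).strongIntegral_apply ψ).symm

theorem SInt.congr_norm (hF : SInt μ F) (hG : SMeas G) (h : ∀ x, ‖G x‖ ≤ ‖F x‖) : SInt μ G := by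
  obtain ⟨g, hg, hb⟩ := hF.dom
  exact ⟨hG, g, hg, fun x => (h x).trans (hb x)⟩

theorem SInt.restrict (hF : SInt μ F) (s : Set α) : SInt (μ.restrict s) F := by
  obtain ⟨g, hg, hb⟩ := hF.dom
  exact ⟨hF.meas, g, hg.restrict, hb⟩

theorem strongIntegral_congr_ae (hF : SInt μ F) (hG : SInt μ G) (h : ∀ᵐ x ∂μ, F x = G x) :
    strongIntegral μ F = strongIntegral μ G := by
  ext ψ
  rw [hF.strongIntegral_apply, hG.strongIntegral_apply]
  exact integral_congr_ae (h.mono fun x hx => by simp only [hx])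

end StrongIntegral

/-! ### Chains of kernels -/

section Chain

variable {E : Type*} [NormedAddCommGroup E] [InnerProductSpace ℂ E]

/-- Operator-valued kernels `k s u` on the time axis. -/
abbrev Kernel (E : Type*) [NormedAddCommGroup E] [InnerProductSpace ℂ E] : Type _ :=
  ℝ → ℝ → E →L[ℂ] E

/-- Jointly strongly measurable kernels, dominated by a function of the second variable. -/
structure Dominated (g : ℝ → ℝ) (k : Kernel E) : Prop where
  meas : SMeas fun p : ℝ × ℝ => k p.1 p.2
  bound : ∀ s u, ‖k s u‖ ≤ g u

/-- The iterated integral `∫ k₁(s, u₁) k₂(u₁, u₂) ⋯ kₙ(uₙ₋₁, uₙ)` of a chain of kernels. -/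
def chainInt : List (Kernel E) → ℝ → E →L[ℂ] E
  | [], _ => 1
  | k :: l, s => strongIntegral volume fun u => k s u * chainInt l u

/-- The integrand `k₁(s, t₁) k₂(t₁, t₂) ⋯ kₙ(tₙ₋₁, tₙ)` of `chainInt`. -/
def chainProd : {n : ℕ} → (Fin n → Kernel E) → ℝ → (Fin n → ℝ) → E →L[ℂ] E
  | 0, _, _, _ => 1
  | _ + 1, κ, s, t => κ 0 s (t 0) * chainProd (Fin.tail κ) (t 0) (Fin.tail t)

variable {g : ℝ → ℝ}

theorem norm_one_le_one : ‖(1 : E →L[ℂ] E)‖ ≤ 1 := ContinuousLinearMap.norm_id_le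

/-- Both properties go through one induction, because the outer integral exists only if the tail is
measurable and bounded. Domination in the second variable alone makes the bound uniform in the
starting time. -/
theorem sMeas_chainInt_and_norm_le (hg : Integrable g) (l : List (Kernel E))
    (hl : ∀ k ∈ l, Dominated g k) :
    SMeas (chainInt l) ∧ ∀ s, ‖chainInt l s‖ ≤ (∫ u, g u) ^ l.length := by
  induction l with
  | nil => exact ⟨SMeas.const 1, fun s => by simpa [chainInt] using norm_one_le_one⟩
  | cons k l ih =>
    obtain ⟨ih1, ih2⟩ := ih fun k hk => hl k (by simp [hk])
    have hk := hl k (by simp)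
    have hm : SMeas fun p : ℝ × ℝ => k p.1 p.2 * chainInt l p.2 :=
      hk.meas.mul (ih1.comp measurable_snd)
    have hb : ∀ s u, ‖k s u * chainInt l u‖ ≤ g u * (∫ u, g u) ^ l.length := fun s u =>
      (norm_mul_le _ _).trans (mul_le_mul (hk.bound s u) (ih2 u) (norm_nonneg _)
        ((norm_nonneg _).trans (hk.bound s u)))
    have hms : ∀ s, SMeas fun u => k s u * chainInt l u := fun s =>
      hm.comp measurable_prodMk_left
    refine ⟨fun ψ => ?_, fun s => ?_⟩
    · have : (fun s => chainInt (k :: l) s ψ) = fun s => ∫ u, (k s u * chainInt l u) ψ := by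
        ext s
        exact SInt.strongIntegral_apply ⟨hms s, _, hg.mul_const _, hb s⟩ ψ
      rw [this]
      exact (hm ψ).integral_prod_right
    · refine (norm_strongIntegral_le (hms s) (hg.mul_const _) (hb s)).trans ?_
      rw [integral_mul_const, List.length_cons, pow_succ']

theorem sInt_chainInt (hg : Integrable g) {k : Kernel E} (hk : Dominated g k)
    {l : List (Kernel E)} (hl : ∀ k ∈ l, Dominated g k) (s : ℝ) :
    SInt volume fun u => k s u * chainInt l u := by
  obtain ⟨ih1, ih2⟩ := sMeas_chainInt_and_norm_le hg l hl
  exact ⟨(hk.meas.comp measurable_prodMk_left).mul ih1,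
    fun u => g u * (∫ u, g u) ^ l.length, hg.mul_const _, fun u =>
      (norm_mul_le _ _).trans (mul_le_mul (hk.bound s u) (ih2 u) (norm_nonneg _)
        ((norm_nonneg _).trans (hk.bound s u)))⟩

/-- If the tail of a chain does not depend on the time at which it starts, it factors out. -/
theorem chainInt_append (hg : Integrable g) {l l' : List (Kernel E)}
    (hl : ∀ k ∈ l, Dominated g k) {C : E →L[ℂ] E} (hC : ∀ u, chainInt l' u = C) (s : ℝ) :
    chainInt (l ++ l') s = chainInt l s * C := by
  induction l generalizing s with
  | nil => simp [chainInt, hC]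
  | cons k l ih =>
    have hl' : ∀ k ∈ l, Dominated g k := fun k hk => hl k (by simp [hk])
    simp only [List.cons_append, chainInt]
    rw [← strongIntegral_mul_right (sInt_chainInt hg (hl k (by simp)) hl' s)]
    simp only [ih hl', mul_assoc]

theorem sMeas_chainProd {n : ℕ} {κ : Fin n → Kernel E} (hκ : ∀ i, Dominated g (κ i)) :
    SMeas fun p : ℝ × (Fin n → ℝ) => chainProd κ p.1 p.2 := by
  induction n with
  | zero => exact SMeas.const 1
  | succ n ih =>
    have h0 : Measurable fun p : ℝ × (Fin (n + 1) → ℝ) => p.2 0 :=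
      (measurable_pi_apply 0).comp measurable_snd
    have h1 : Measurable fun p : ℝ × (Fin (n + 1) → ℝ) => Fin.tail p.2 :=
      measurable_pi_lambda _ fun i => (measurable_pi_apply i.succ).comp measurable_snd
    exact ((hκ 0).meas.comp (measurable_fst.prodMk h0)).mul
      ((ih (κ := Fin.tail κ) fun i => hκ i.succ).comp (h0.prodMk h1))

theorem norm_chainProd_le {n : ℕ} {κ : Fin n → Kernel E} (hκ : ∀ i, Dominated g (κ i)) (s : ℝ)
    (t : Fin n → ℝ) : ‖chainProd κ s t‖ ≤ ∏ i, g (t i) := by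
  induction n generalizing s with
  | zero => simpa [chainProd] using norm_one_le_one
  | succ n ih =>
    rw [Fin.prod_univ_succ, chainProd]
    exact (norm_mul_le _ _).trans (mul_le_mul ((hκ 0).bound _ _)
      (ih (κ := Fin.tail κ) (fun i => hκ i.succ) _ _) (norm_nonneg _)
        ((norm_nonneg _).trans ((hκ 0).bound s _)))

theorem integrable_prod_apply (hg : Integrable g) (n : ℕ) :
    Integrable fun t : Fin n → ℝ => ∏ i, g (t i) :=
  Integrable.fintype_prod (f := fun _ : Fin n => g) fun _ => hg

theorem sInt_chainProd (hg : Integrable g) {n : ℕ} {κ : Fin n → Kernel E}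
    (hκ : ∀ i, Dominated g (κ i)) (s : ℝ) : SInt volume (chainProd κ s) :=
  ⟨(sMeas_chainProd hκ).comp measurable_prodMk_left, _, integrable_prod_apply hg n,
    norm_chainProd_le hκ s⟩

/-- Fubini: the iterated integral of a chain is an integral over `ℝⁿ`. -/
theorem strongIntegral_chainProd [CompleteSpace E] (hg : Integrable g) {n : ℕ}
    {κ : Fin n → Kernel E} (hκ : ∀ i, Dominated g (κ i)) (s : ℝ) :
    strongIntegral volume (chainProd κ s) = chainInt (List.ofFn κ) s := by
  ext ψ
  rw [(sInt_chainProd hg hκ s).strongIntegral_apply]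
  induction n generalizing s with
  | zero =>
    simp [chainProd, chainInt, integral_const, volume_pi, measureReal_def]
  | succ n ih =>
    have hκ' : ∀ i, Dominated g (Fin.tail κ i) := fun i => hκ i.succ
    have hl : ∀ k ∈ List.ofFn (Fin.tail κ), Dominated g k := by
      intro k hk
      obtain ⟨i, rfl⟩ := (List.mem_ofFn' _ _).1 hk
      exact hκ' i
    have hmp := (volume_preserving_piFinSuccAbove (fun _ : Fin (n + 1) => ℝ) 0).symm
    rw [List.ofFn_succ, chainInt, show (fun i => κ i.succ) = Fin.tail κ from rfl,
      (sInt_chainInt hg (hκ 0) hl s).strongIntegral_apply ψ, ← hmp.integral_comp']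
    have hint : Integrable (fun p : ℝ × (Fin n → ℝ) => chainProd κ s
        ((MeasurableEquiv.piFinSuccAbove (fun _ : Fin (n + 1) => ℝ) 0).symm p) ψ)
        (volume.prod volume) :=
      (hmp.integrable_comp_emb (MeasurableEquiv.measurableEmbedding _)).2
        ((sInt_chainProd hg hκ s).integrable ψ)
    have hform : ∀ p : ℝ × (Fin n → ℝ), chainProd κ s
        ((MeasurableEquiv.piFinSuccAbove (fun _ : Fin (n + 1) => ℝ) 0).symm p) ψ =
          κ 0 s p.1 (chainProd (Fin.tail κ) p.1 p.2 ψ) := fun p => by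
      simp [chainProd, MeasurableEquiv.piFinSuccAbove, Fin.insertNthEquiv]
    rw [Measure.volume_eq_prod, integral_prod _ hint]
    refine integral_congr_ae (Eventually.of_forall fun u => ?_)
    simp only [hform]
    rw [ContinuousLinearMap.integral_comp_comm _
      ((sInt_chainProd hg hκ' u).integrable ψ), ih hκ' u]
    rfl

end Chain

/-! ### Diagonal operators -/

section Diagonal

variable {E : Type*} [NormedAddCommGroup E] [InnerProductSpace ℂ E] {ι : Type*}

@[simp]
theorem repr_diagOp (Φ : HilbertBasis ι ℂ E) (c : ι → ℂ) (hc : ∀ i, ‖c i‖ ≤ 1) (ψ : E) (i : ι) :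
    Φ.repr (diagOp Φ c hc ψ) i = c i * Φ.repr ψ i := by
  simp [diagOp]

theorem vec_ext_repr (Φ : HilbertBasis ι ℂ E) {φ ψ : E} (h : ∀ i, Φ.repr φ i = Φ.repr ψ i) :
    φ = ψ := Φ.repr.injective (by ext i; exact h i)

theorem op_ext_repr (Φ : HilbertBasis ι ℂ E) {S T : E →L[ℂ] E}
    (h : ∀ ψ i, Φ.repr (S ψ) i = Φ.repr (T ψ) i) : S = T := by
  ext ψ; exact vec_ext_repr Φ (h ψ)

theorem norm_le_of_repr_le (Φ : HilbertBasis ι ℂ E) {T : E →L[ℂ] E} {M : ℝ} (hM : 0 ≤ M)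
    (h : ∀ ψ i, ‖Φ.repr (T ψ) i‖ ≤ M * ‖Φ.repr ψ i‖) : ‖T‖ ≤ M := by
  refine T.opNorm_le_bound hM fun ψ => ?_
  have h1 : ‖Φ.repr (T ψ)‖ ≤ ‖(M : ℂ) • Φ.repr ψ‖ :=
    lp.norm_mono (by norm_num) fun i => by
      rw [lp.coeFn_smul, Pi.smul_apply, norm_smul, Complex.norm_real, Real.norm_of_nonneg hM]
      exact h ψ i
  rw [norm_smul, Complex.norm_real, Real.norm_of_nonneg hM] at h1
  simpa using h1

theorem norm_diagOp_le (Φ : HilbertBasis ι ℂ E) (c : ι → ℂ) (hc : ∀ i, ‖c i‖ ≤ 1) :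
    ‖diagOp Φ c hc‖ ≤ 1 :=
  norm_le_of_repr_le Φ zero_le_one fun ψ i => by
    rw [repr_diagOp, norm_mul]; exact mul_le_mul_of_nonneg_right (hc i) (norm_nonneg _)

end Diagonal

/-! ### The projection, the free evolution and the letters -/

namespace PerturbedSystem

variable {ι E : Type*} [NormedAddCommGroup E] [InnerProductSpace ℂ E]
variable (S : PerturbedSystem ι E)

open Classical in
theorem repr_P (ψ : E) (i : ι) : S.basis.repr (S.P ψ) i =
    if S.energy i = S.E₀ then S.basis.repr ψ i else 0 := by
  rw [P, repr_diagOp]; split_ifs <;> simp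

theorem P_mul_P : S.P * S.P = S.P :=
  op_ext_repr S.basis fun ψ i => by
    rw [mul_apply_eq_comp, repr_P, repr_P]; split_ifs <;> rfl

theorem norm_P_le : ‖S.P‖ ≤ 1 := norm_diagOp_le _ _ _

theorem norm_one_sub_P_le : ‖1 - S.P‖ ≤ 1 :=
  norm_le_of_repr_le S.basis zero_le_one fun ψ i => by
    rw [sub_apply, map_sub, lp.coeFn_sub, Pi.sub_apply, repr_P]
    split_ifs <;> simp

theorem repr_freeEvolution (t : ℝ) (ψ : E) (i : ι) : S.basis.repr (S.freeEvolution t ψ) i =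
    Complex.exp ((t * S.energy i : ℝ) * Complex.I) * S.basis.repr ψ i := by
  rw [freeEvolution, repr_diagOp]

theorem norm_freeEvolution_le (t : ℝ) : ‖S.freeEvolution t‖ ≤ 1 := norm_diagOp_le _ _ _

theorem freeEvolution_mul (s t : ℝ) :
    S.freeEvolution s * S.freeEvolution t = S.freeEvolution (s + t) :=
  op_ext_repr S.basis fun ψ i => by
    rw [mul_apply_eq_comp, repr_freeEvolution, repr_freeEvolution, repr_freeEvolution,
      ← mul_assoc, ← Complex.exp_add]
    congr 2; push_cast; ring

theorem freeEvolution_zero : S.freeEvolution 0 = 1 :=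
  op_ext_repr S.basis fun ψ i => by simp [repr_freeEvolution]

theorem freeEvolution_basis (t : ℝ) (i : ι) : S.freeEvolution t (S.basis i) =
    Complex.exp ((t * S.energy i : ℝ) * Complex.I) • S.basis i :=
  vec_ext_repr S.basis fun j => by
    classical
    rw [repr_freeEvolution, map_smul, lp.coeFn_smul, Pi.smul_apply, smul_eq_mul,
      S.basis.repr_self, lp.single_apply]
    by_cases h : j = i
    · subst h; rfl
    · simp [Pi.single_eq_of_ne h]

/-- On basis vectors the evolution is a scalar exponential; their span is dense, and the contraction
bound makes the approximation uniform in time. -/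
theorem continuous_freeEvolution (ψ : E) : Continuous fun t => S.freeEvolution t ψ := by
  have hspan : ∀ φ ∈ Submodule.span ℂ (Set.range S.basis),
      Continuous fun t => S.freeEvolution t φ := by
    intro φ hφ
    induction hφ using Submodule.span_induction with
    | mem x hx =>
      obtain ⟨i, rfl⟩ := hx
      simp only [freeEvolution_basis]
      fun_prop
    | zero => simpa using continuous_const
    | add x y _ _ hx hy => simp only [map_add]; exact hx.add hy
    | smul a x _ hx => simp only [map_smul]; exact hx.const_smul a
  refine continuous_of_uniform_approx_of_continuous fun u hu => ?_
  obtain ⟨δ, hδ, hu⟩ := Metric.mem_uniformity_dist.1 hu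
  have hd : ψ ∈ closure (Submodule.span ℂ (Set.range S.basis) : Set E) := by
    rw [← Submodule.topologicalClosure_coe, S.basis.dense_span]; trivial
  obtain ⟨φ, hφ, hφd⟩ := Metric.mem_closure_iff.1 hd δ hδ
  refine ⟨_, hspan φ hφ, fun t => hu (lt_of_le_of_lt ?_ hφd)⟩
  rw [dist_eq_norm, dist_eq_norm, ← map_sub]
  exact (S.freeEvolution t).le_of_opNorm_le_of_le (S.norm_freeEvolution_le t) le_rfl |>.trans
    (by rw [one_mul])

theorem continuous_freeEvolution_apply {y : ℝ → E} (hy : Continuous y) :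
    Continuous fun t => S.freeEvolution t (y t) := by
  refine continuous_iff_continuousAt.2 fun t₀ => ?_
  have h1 : Tendsto (fun t => S.freeEvolution t (y t - y t₀)) (𝓝 t₀) (𝓝 0) := by
    refine squeeze_zero_norm (a := fun t => ‖y t - y t₀‖) (fun t => ?_) ?_
    · simpa using (S.freeEvolution t).le_of_opNorm_le (S.norm_freeEvolution_le t) (y t - y t₀)
    · have := ((hy.sub continuous_const).norm.tendsto t₀ : Tendsto (fun t => ‖y t - y t₀‖) _ _)
      simpa using this
  have h2 := h1.add ((S.continuous_freeEvolution (y t₀)).tendsto t₀)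
  rw [zero_add] at h2
  refine h2.congr fun t => ?_
  rw [← map_add, sub_add_cancel]

theorem continuous_Hi_apply (ε : ℝ) {y : ℝ → E} (hy : Continuous y) :
    Continuous fun t => S.Hi ε t (y t) := by
  have h1 : Continuous fun t => S.freeEvolution (-t) (y t) := by
    have := (S.continuous_freeEvolution_apply (hy.comp continuous_neg)).comp continuous_neg
    simpa [Function.comp_def] using this
  have h2 := S.continuous_freeEvolution_apply (S.V.continuous.comp h1)
  simp only [Hi, interaction, smul_apply, mul_apply_eq_comp]
  have h3 : Continuous fun t : ℝ => (Real.exp (-ε * |t|) : ℂ) := by fun_prop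
  exact (h3.smul h2).const_smul _

theorem sMeas_Hi (ε : ℝ) : SMeas (S.Hi ε) := fun _ =>
  (S.continuous_Hi_apply ε continuous_const).stronglyMeasurable

/-- The bound on the letters which makes all iterated integrals converge. -/
def bound (ε t : ℝ) : ℝ := 2 * ‖S.V‖ * Real.exp (-ε * |t|)

theorem bound_nonneg (ε t : ℝ) : 0 ≤ S.bound ε t := by unfold bound; positivity

theorem integrable_bound {ε : ℝ} (hε : 0 < ε) : Integrable (S.bound ε) := by
  refine Integrable.const_mul ?_ _
  rw [← integrableOn_univ, ← Set.Iic_union_Ioi (a := (0 : ℝ))]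
  refine IntegrableOn.union ?_ ?_
  · refine (integrableOn_exp_mul_Iic hε 0).congr_fun (fun x hx => ?_) measurableSet_Iic
    simp only [abs_of_nonpos (Set.mem_Iic.1 hx)]; ring_nf
  · refine (integrableOn_exp_mul_Ioi (neg_neg_of_pos hε) 0).congr_fun (fun x hx => ?_)
      measurableSet_Ioi
    simp only [abs_of_pos (Set.mem_Ioi.1 hx)]

theorem norm_Hi_le_half (ε t : ℝ) : ‖S.Hi ε t‖ ≤ ‖S.V‖ * Real.exp (-ε * |t|) := by
  rw [Hi, interaction, norm_smul, norm_smul, norm_neg, Complex.norm_I, one_mul, Complex.norm_real,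
    Real.norm_of_nonneg (Real.exp_pos _).le, mul_comm ‖S.V‖]
  refine mul_le_mul_of_nonneg_left ?_ (Real.exp_pos _).le
  calc ‖S.freeEvolution t * S.V * S.freeEvolution (-t)‖
      ≤ ‖S.freeEvolution t‖ * ‖S.V‖ * ‖S.freeEvolution (-t)‖ := norm_mul₃_le
    _ ≤ 1 * ‖S.V‖ * 1 := by
        gcongr <;> exact S.norm_freeEvolution_le _
    _ = ‖S.V‖ := by ring

theorem norm_Hi_le (ε t : ℝ) : ‖S.Hi ε t‖ ≤ S.bound ε t := by
  refine (S.norm_Hi_le_half ε t).trans ?_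
  have : 0 ≤ ‖S.V‖ * Real.exp (-ε * |t|) := by positivity
  unfold bound; linarith

theorem norm_letter_le_half (ε : ℝ) (b : Bool) (t : ℝ) :
    ‖S.letter ε b t‖ ≤ ‖S.V‖ * Real.exp (-ε * |t|) := by
  unfold letter
  have h := S.norm_Hi_le_half ε t
  split_ifs
  · rw [norm_neg]
    exact (norm_mul_le _ _).trans ((mul_le_mul S.norm_P_le h (norm_nonneg _) zero_le_one).trans
      (by rw [one_mul]))
  · exact (norm_mul_le _ _).trans ((mul_le_mul S.norm_one_sub_P_le h (norm_nonneg _)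
      zero_le_one).trans (by rw [one_mul]))

theorem norm_letter_le (ε : ℝ) (b : Bool) (t : ℝ) : ‖S.letter ε b t‖ ≤ S.bound ε t := by
  refine (S.norm_letter_le_half ε b t).trans ?_
  have : 0 ≤ ‖S.V‖ * Real.exp (-ε * |t|) := by positivity
  unfold bound; linarith

/-- Each letter alone obeys half of `bound`. The factor two is there for this sum, so that one
function dominates all kernels. -/
theorem norm_letter_add_le (ε t : ℝ) :
    ‖S.letter ε false t + S.letter ε true t‖ ≤ S.bound ε t := by
  refine (norm_add_le _ _).trans ((add_le_add (S.norm_letter_le_half ε _ t)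
    (S.norm_letter_le_half ε _ t)).trans ?_)
  unfold bound; linarith

theorem sMeas_letter (ε : ℝ) (b : Bool) : SMeas (S.letter ε b) := by
  unfold letter
  cases b
  · simpa using (SMeas.const _).mul (S.sMeas_Hi ε)
  · simpa using ((SMeas.const _).mul (S.sMeas_Hi ε)).neg

/-- The relation A = H_i + B turns chains of progressions into a Volterra equation driven by H_i. -/
theorem letter_false_eq (ε t : ℝ) :
    S.letter ε false t = S.Hi ε t + S.letter ε true t := by
  change (1 - S.P) * S.Hi ε t = S.Hi ε t + -(S.P * S.Hi ε t)
  rw [sub_mul, one_mul, sub_eq_add_neg]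

/-! ### The kernels of the Picard series and of the signed permutations -/

/-- The kernel of the Picard series. -/
def picKernel (ε : ℝ) : Kernel E := fun s u => if u ≤ s then S.Hi ε u else 0

/-- The kernel of a letter which is not constrained by its predecessor. -/
def freeKernel (ε : ℝ) : Kernel E := fun _ u =>
  if u ≤ 0 then S.letter ε false u + S.letter ε true u else 0

/-- The kernel of a letter which forms a progression with its predecessor. -/
def progKernel (ε : ℝ) : Kernel E := fun s u =>
  if u ≤ 0 then (if u < s then S.letter ε false u else S.letter ε true u) else 0

theorem dominated_picKernel (ε : ℝ) : Dominated (S.bound ε) (S.picKernel ε) where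
  meas := SMeas.ite (measurableSet_le measurable_snd measurable_fst)
    ((S.sMeas_Hi ε).comp measurable_snd) (SMeas.const 0)
  bound s u := by
    unfold picKernel
    split_ifs
    · exact S.norm_Hi_le ε u
    · simpa using S.bound_nonneg ε u

theorem dominated_freeKernel (ε : ℝ) : Dominated (S.bound ε) (S.freeKernel ε) where
  meas := SMeas.ite (measurableSet_le measurable_snd measurable_const)
    (((S.sMeas_letter ε _).comp measurable_snd).add ((S.sMeas_letter ε _).comp measurable_snd))
    (SMeas.const 0)
  bound s u := by
    unfold freeKernel
    split_ifs
    · exact S.norm_letter_add_le ε u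
    · simpa using S.bound_nonneg ε u

theorem dominated_progKernel (ε : ℝ) : Dominated (S.bound ε) (S.progKernel ε) where
  meas := SMeas.ite (measurableSet_le measurable_snd measurable_const)
    (SMeas.ite (measurableSet_lt measurable_snd measurable_fst)
      ((S.sMeas_letter ε _).comp measurable_snd) ((S.sMeas_letter ε _).comp measurable_snd))
    (SMeas.const 0)
  bound s u := by
    unfold progKernel
    split_ifs
    · exact S.norm_letter_le ε _ u
    · exact S.norm_letter_le ε _ u
    · simpa using S.bound_nonneg ε u

end PerturbedSystem

/-! ### Sums of signed permutations as chains of kernels -/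

section Combinatorics

variable {n : ℕ}

/-- There is a progression in front of every position marked by `f`. -/
def ProgressesOn (f : Fin n → Bool) (s : SignedPerm n) : Prop :=
  ∀ i j : Fin n, (i : ℕ) + 1 = j → f j = true → IsProgression (oneLine s i) (oneLine s j)

instance (f : Fin n → Bool) (s : SignedPerm n) : Decidable (ProgressesOn f s) := by
  unfold ProgressesOn IsProgression; infer_instance

theorem isProgression_oneLine (s : SignedPerm n) (i j : Fin n) :
    IsProgression (oneLine s i) (oneLine s j) ↔
      if s.2 j then s.1 j < s.1 i else s.1 i < s.1 j := by
  have h : ∀ k : Fin n, |oneLine s k| = (s.1 k : ℕ) + 1 := fun k => by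
    unfold oneLine
    split_ifs
    · rw [abs_neg, abs_of_nonneg (by positivity)]
    · rw [abs_of_nonneg (by positivity)]
  unfold IsProgression
  rw [h, h, Fin.lt_def, Fin.lt_def]
  unfold oneLine
  split_ifs <;> omega

/-- Position 0 has no predecessor, hence nothing to mark there. -/
theorem noRegression_iff (s : SignedPerm n) :
    NoRegression s ↔ ProgressesOn (fun j => decide ((j : ℕ) ≠ 0)) s := by
  refine ⟨fun h i j hij _ => h i j hij, fun h i j hij => h i j hij ?_⟩
  simp; omega

theorem measurableSet_simplex (n : ℕ) : MeasurableSet (PerturbedSystem.simplex n) := by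
  have : PerturbedSystem.simplex n =
      (⋂ (i : Fin n) (j : Fin n) (_ : i ≤ j), {t | t j ≤ t i}) ∩ ⋂ i : Fin n, {t | t i ≤ 0} := by
    ext t
    simp only [PerturbedSystem.simplex, Set.mem_inter_iff, Set.mem_iInter, Set.mem_ofPred_eq]
    exact Iff.rfl
  rw [this]
  refine MeasurableSet.inter (MeasurableSet.iInter fun i => MeasurableSet.iInter fun j =>
    MeasurableSet.iInter fun _ => ?_) (MeasurableSet.iInter fun i => ?_)
  · exact measurableSet_le (measurable_pi_apply j) (measurable_pi_apply i)
  · exact measurableSet_le (measurable_pi_apply i) measurable_const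

/-- Coincidences of two times lie in finitely many proper subspaces, which are null. Ties, where the
ordering permutation is ambiguous, can thus be ignored. -/
theorem ae_injective (n : ℕ) : ∀ᵐ t : Fin n → ℝ, Function.Injective t := by
  have h : ∀ i j : Fin n, i ≠ j → ∀ᵐ t : Fin n → ℝ, t i ≠ t j := fun i j hij => by
    have hK := Measure.addHaar_submodule (volume : Measure (Fin n → ℝ))
      (LinearMap.ker (LinearMap.proj (R := ℝ) (φ := fun _ : Fin n => ℝ) i - LinearMap.proj j))
      (fun htop => by
        have : (Pi.single i 1 : Fin n → ℝ) ∈ LinearMap.ker (LinearMap.proj (R := ℝ)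
            (φ := fun _ : Fin n => ℝ) i - LinearMap.proj j) := by rw [htop]; trivial
        simp [Ne.symm hij] at this)
    rw [ae_iff]
    convert hK using 2
    ext t
    simp [sub_eq_zero]
  have h' : ∀ᵐ t : Fin n → ℝ, ∀ i j : Fin n, i ≠ j → t i ≠ t j :=
    ae_all_iff.2 fun i => ae_all_iff.2 fun j => by
      by_cases hij : i = j
      · exact Eventually.of_forall fun t h => absurd hij h
      · exact (h i j hij).mono fun t ht _ => ht
  exact h'.mono fun t ht i j hij => by_contra fun hne => ht i j hne hij

/-- A family of distinct times is ordered by exactly one permutation. -/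
theorem existsUnique_antitone_comp {t : Fin n → ℝ} (ht : Function.Injective t) :
    ∃ σ : Equiv.Perm (Fin n), Antitone (t ∘ σ.symm) ∧
      ∀ τ : Equiv.Perm (Fin n), Antitone (t ∘ τ.symm) → τ = σ := by
  refine ⟨(Tuple.sort fun i => -t i).symm, ?_, fun τ hτ => ?_⟩
  · have := Tuple.monotone_sort fun i => -t i
    intro i j hij
    have h := this hij
    simp only [Function.comp_apply, neg_le_neg_iff] at h
    simpa using h
  · have h1 : Monotone ((fun i => -t i) ∘ τ.symm) := fun i j hij => neg_le_neg (hτ hij)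
    have h2 := Tuple.unique_monotone h1 (Tuple.monotone_sort fun i => -t i)
    have h3 : τ.symm = Tuple.sort fun i => -t i := by
      ext i : 1
      exact ht (neg_injective (congrFun h2 i))
    rw [← h3, Equiv.symm_symm]

end Combinatorics

namespace PerturbedSystem

variable {ι E : Type*} [NormedAddCommGroup E] [InnerProductSpace ℂ E]
variable (S : PerturbedSystem ι E)

/-- The kernel of a letter which forms a progression with its predecessor if `b` is set, and is
unconstrained otherwise. -/
def flagKernel (ε : ℝ) (b : Bool) : Kernel E := if b then S.progKernel ε else S.freeKernel ε

theorem dominated_flagKernel (ε : ℝ) (b : Bool) : Dominated (S.bound ε) (S.flagKernel ε b) := by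
  unfold flagKernel
  split_ifs
  exacts [S.dominated_progKernel ε, S.dominated_freeKernel ε]

/-- A product of sums is expanded over the bars: at a marked position the times force the letter, at
an unmarked one both letters occur. The entry of `Fin.cons s t` at `i.castSucc` is the time
preceding `t i`, with `s` in front of the first. -/
theorem sum_letters_eq_chainProd (ε : ℝ) {n : ℕ} (f : Fin n → Bool) (s : ℝ) (t : Fin n → ℝ)
    (ht : ∀ i, t i ≤ 0) :
    (∑ w : Fin n → Bool, if ∀ i : Fin n, f i = true →
        (w i = false ↔ t i < (Fin.cons s t : Fin (n + 1) → ℝ) i.castSucc) then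
      (List.ofFn fun i => S.letter ε (w i) (t i)).prod else 0) =
      chainProd (fun i => S.flagKernel ε (f i)) s t := by
  induction n generalizing s with
  | zero => simp [chainProd]
  | succ n ih =>
    have hc : (Fin.cons (t 0) (Fin.tail t) : Fin (n + 1) → ℝ) = t := Fin.cons_self_tail t
    have ih : (∑ w : Fin n → Bool, if ∀ i : Fin n, f i.succ = true →
        (w i = false ↔ t i.succ < t i.castSucc) then
      (List.ofFn fun i => S.letter ε (w i) (t i.succ)).prod else 0) =
        chainProd (fun i => S.flagKernel ε (f i.succ)) (t 0) (Fin.tail t) := by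
      rw [← ih (fun i => f i.succ) (t 0) (Fin.tail t) fun i => ht i.succ, hc]
      rfl
    rw [← (Fin.consEquiv fun _ : Fin (n + 1) => Bool).sum_comp, Fintype.sum_prod_type]
    rw [chainProd, show Fin.tail (fun i => S.flagKernel ε (f i)) =
      fun i => S.flagKernel ε (f i.succ) from rfl, ← ih, Finset.mul_sum]
    rw [Fintype.sum_bool, ← Finset.sum_add_distrib]
    refine Finset.sum_congr rfl fun w _ => ?_
    simp only [Fin.forall_fin_succ (n := n), Fin.consEquiv, Equiv.coe_fn_mk, Fin.cons_zero,
      Fin.cons_succ, Fin.castSucc_zero, ← Fin.succ_castSucc, List.ofFn_succ, List.prod_cons]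
    have h0 := ht 0
    by_cases hw : ∀ i : Fin n, f i.succ = true → (w i = false ↔ t i.succ < t i.castSucc)
    · simp only [eq_true hw, and_true, if_true]
      cases hf : f 0 with
      | false => simp [flagKernel, freeKernel, h0, add_mul, add_comm]
      | true =>
        by_cases hs : t 0 < s
        · simp [flagKernel, progKernel, h0, hs]
        · simp [flagKernel, progKernel, h0, hs]
    · simp only [eq_false hw, and_false, if_false, mul_zero, add_zero]

theorem chainProd_flagKernel_eq_zero (ε : ℝ) {n : ℕ} (f : Fin n → Bool) (s : ℝ) (t : Fin n → ℝ)
    (ht : ¬ ∀ i, t i ≤ 0) : chainProd (fun i => S.flagKernel ε (f i)) s t = 0 := by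
  induction n generalizing s with
  | zero => exact absurd (fun i => i.elim0) ht
  | succ n ih =>
    rw [chainProd]
    by_cases h0 : t 0 ≤ 0
    · have : ¬ ∀ i, Fin.tail t i ≤ 0 := fun h => ht (Fin.forall_fin_succ.2 ⟨h0, h⟩)
      have := ih (Fin.tail f) (t 0) (Fin.tail t) this
      rw [show Fin.tail (fun i => S.flagKernel ε (f i)) =
        fun i => S.flagKernel ε (Fin.tail f i) from rfl, this, mul_zero]
    · simp [flagKernel, freeKernel, progKernel, h0, ite_apply]

theorem norm_prod_ofFn_le {n : ℕ} {F : Fin n → ℝ → E →L[ℂ] E} {g : ℝ → ℝ}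
    (hF : ∀ i u, ‖F i u‖ ≤ g u) (t : Fin n → ℝ) :
    ‖(List.ofFn fun i => F i (t i)).prod‖ ≤ ∏ i, g (t i) := by
  induction n with
  | zero => simpa using norm_one_le_one
  | succ n ih =>
    rw [List.ofFn_succ, List.prod_cons, Fin.prod_univ_succ]
    exact (norm_mul_le _ _).trans (mul_le_mul (hF _ _)
      (ih (fun i => hF i.succ) fun i => t i.succ) (norm_nonneg _)
        ((norm_nonneg _).trans (hF 0 _)))

theorem sMeas_prod_ofFn {n : ℕ} {F : Fin n → ℝ → E →L[ℂ] E} (hF : ∀ i, SMeas (F i)) :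
    SMeas fun t : Fin n → ℝ => (List.ofFn fun i => F i (t i)).prod := by
  induction n with
  | zero => simpa using SMeas.const 1
  | succ n ih =>
    simp only [List.ofFn_succ, List.prod_cons]
    exact ((hF 0).comp (measurable_pi_apply 0)).mul ((ih fun i => hF i.succ).comp
      (measurable_pi_lambda (fun t : Fin (n + 1) → ℝ => fun i : Fin n => t i.succ)
        fun i => measurable_pi_apply i.succ))

theorem sInt_prod_ofFn {n : ℕ} {F : Fin n → ℝ → E →L[ℂ] E} {g : ℝ → ℝ} (hg : Integrable g)
    (hF : ∀ i, SMeas (F i)) (hb : ∀ i u, ‖F i u‖ ≤ g u) :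
    SInt volume fun t : Fin n → ℝ => (List.ofFn fun i => F i (t i)).prod :=
  ⟨sMeas_prod_ofFn hF, _, integrable_prod_apply hg n, norm_prod_ofFn_le hb⟩

theorem SInt_ite {α : Type*} [MeasurableSpace α] {μ : Measure α} {F : α → E →L[ℂ] E}
    (hF : SInt μ F) {p : α → Prop} [DecidablePred p] (hp : MeasurableSet {x | p x}) :
    SInt μ fun x => if p x then F x else 0 :=
  hF.congr_norm (hF.meas.ite hp (SMeas.const 0)) fun x => by
    split_ifs
    · exact le_rfl
    · simp

open Classical in
theorem strongIntegral_restrict {α : Type*} [MeasurableSpace α] {μ : Measure α}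
    {F : α → E →L[ℂ] E} (hF : SInt μ F) {s : Set α} (hs : MeasurableSet s) :
    strongIntegral (μ.restrict s) F = strongIntegral μ fun x => if x ∈ s then F x else 0 := by
  ext ψ
  rw [(hF.restrict s).strongIntegral_apply,
    (SInt_ite (p := fun x => x ∈ s) hF hs).strongIntegral_apply,
    ← integral_indicator hs]
  congr 1
  ext x
  by_cases h : x ∈ s <;> simp [h]

open Classical in
/-- The integral of a signed permutation, in the variables in which the letters are ordered. -/
theorem iteratedIntegral_eq {ε : ℝ} (hε : 0 < ε) {n : ℕ} (s : SignedPerm n) :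
    S.iteratedIntegral ε s = strongIntegral volume fun t : Fin n → ℝ =>
      if t ∘ s.1.symm ∈ simplex n then (List.ofFn fun i => S.letter ε (s.2 i) (t i)).prod
      else 0 := by
  have hP := sInt_prod_ofFn (n := n) (F := fun i => S.letter ε (s.2 i)) (S.integrable_bound hε)
    (fun i => S.sMeas_letter ε _) fun i u => S.norm_letter_le ε _ u
  -- Permuting the coordinates preserves Lebesgue measure; afterwards the letter in position i
  -- carries the time `t i`, and the permutation survives only in the domain of integration.
  have hmp := volume_measurePreserving_piCongrLeft (fun _ : Fin n => ℝ) s.1.symm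
  have he : ∀ t : Fin n → ℝ,
      MeasurableEquiv.piCongrLeft (fun _ : Fin n => ℝ) s.1.symm t = t ∘ s.1 := fun t => by
    ext i
    have := MeasurableEquiv.piCongrLeft_apply_apply s.1.symm t (β := fun _ : Fin n => ℝ) (s.1 i)
    simpa using this
  have hmeas : MeasurableSet {t : Fin n → ℝ | t ∘ s.1.symm ∈ simplex n} :=
    (measurable_pi_lambda (fun t : Fin n → ℝ => t ∘ s.1.symm)
      fun i => measurable_pi_apply (s.1.symm i)) (measurableSet_simplex n)
  have hP' : SInt volume fun t : Fin n → ℝ =>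
      (List.ofFn fun i => S.letter ε (s.2 i) (t (s.1 i))).prod := by
    obtain ⟨g, hg, hb⟩ := hP.dom
    refine ⟨hP.meas.comp (measurable_pi_lambda (fun t : Fin n → ℝ => t ∘ s.1)
      fun i => measurable_pi_apply (s.1 i)), fun t => g (t ∘ s.1), ?_, fun t => hb (t ∘ s.1)⟩
    have := (hmp.integrable_comp_emb (MeasurableEquiv.measurableEmbedding _)).2 hg
    simpa only [Function.comp_def, he] using this
  rw [iteratedIntegral, strongIntegral_restrict hP' (measurableSet_simplex n)]
  ext ψ
  rw [(SInt_ite (p := fun t => t ∈ simplex n) hP' (measurableSet_simplex n)).strongIntegral_apply,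
    (SInt_ite hP hmeas).strongIntegral_apply]
  refine Eq.trans ?_ (hmp.integral_comp' _)
  congr 1
  ext t
  have : (t ∘ s.1) ∘ s.1.symm = t := by ext i; simp
  simp only [he, this, Function.comp_apply]

/-- The sum of the signed permutations with prescribed progressions is an iterated integral of a
chain of kernels. -/
theorem sum_iteratedIntegral_eq_chainInt [CompleteSpace E] {ε : ℝ} (hε : 0 < ε) {n : ℕ}
    (f : Fin n → Bool) (hf : ∀ i : Fin n, (i : ℕ) = 0 → f i = false) (s₀ : ℝ) :
    ∑ s : SignedPerm n, (if ProgressesOn f s then S.iteratedIntegral ε s else 0) =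
      chainInt (List.ofFn fun i => S.flagKernel ε (f i)) s₀ := by
  classical
  have hg := S.integrable_bound hε
  have hκ : ∀ i, Dominated (S.bound ε) (S.flagKernel ε (f i)) :=
    fun i => S.dominated_flagKernel ε _
  have hmeas : ∀ σ : Equiv.Perm (Fin n),
      MeasurableSet {t : Fin n → ℝ | t ∘ σ.symm ∈ simplex n} := fun σ =>
    (measurable_pi_lambda (fun t : Fin n → ℝ => t ∘ σ.symm)
      fun i => measurable_pi_apply (σ.symm i)) (measurableSet_simplex n)
  have hI : ∀ s : SignedPerm n, SInt volume fun t : Fin n → ℝ =>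
      if t ∘ s.1.symm ∈ simplex n then (List.ofFn fun i => S.letter ε (s.2 i) (t i)).prod
      else 0 := fun s =>
    SInt_ite (sInt_prod_ofFn (n := n) (F := fun i => S.letter ε (s.2 i)) hg
      (fun i => S.sMeas_letter ε _) fun i u => S.norm_letter_le ε _ u) (hmeas s.1)
  rw [← strongIntegral_chainProd hg hκ, ← Finset.sum_filter]
  simp only [S.iteratedIntegral_eq hε]
  rw [← strongIntegral_sum fun s _ => hI s]
  refine strongIntegral_congr_ae (SInt.sum fun s _ => hI s) (sInt_chainProd hg hκ s₀) ?_
  filter_upwards [ae_injective n] with t ht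
  by_cases h0 : ∀ i, t i ≤ 0
  · rw [← S.sum_letters_eq_chainProd ε f s₀ t h0, Finset.sum_filter, Fintype.sum_prod_type]
    -- At fixed distinct times only this permutation contributes, so the double sum reduces to a sum
    -- over bars.
    obtain ⟨σ, hσ, huniq⟩ := existsUnique_antitone_comp ht
    rw [Finset.sum_eq_single σ]
    · refine Finset.sum_congr rfl fun w _ => ?_
      have hmem : t ∘ σ.symm ∈ simplex n := ⟨hσ, fun i => h0 _⟩
      simp only [hmem, if_true]
      refine if_congr ?_ rfl rfl
      have hanti : StrictAnti (t ∘ σ.symm) :=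
        hσ.strictAnti_of_injective (ht.comp σ.symm.injective)
      -- Times decrease along the simplex: the larger label carries the earlier time.
      have hlt : ∀ i j : Fin n, σ i < σ j ↔ t j < t i := fun i j => by
        simpa using (hanti.lt_iff_gt (a := σ j) (b := σ i)).symm
      have hprog : ∀ i j : Fin n, i ≠ j → (IsProgression (oneLine (σ, w) i) (oneLine (σ, w) j) ↔
          (w j = false ↔ t j < t i)) := fun i j hij => by
        rw [isProgression_oneLine]
        simp only [hlt]
        have hne : t i ≠ t j := fun h => hij (ht h)
        cases w j
        · simp
        · simp only [if_true, Bool.true_eq_false, false_iff, not_lt]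
          exact ⟨le_of_lt, fun h => lt_of_le_of_ne h hne⟩
      constructor
      · intro h j hj
        -- The first position is unmarked, so the auxiliary time `s₀` in front of it is never
        -- compared; this is why the result holds for every `s₀`.
        by_cases h' : (j : ℕ) = 0
        · rw [hf j h'] at hj; cases hj
        · obtain ⟨i, hi⟩ : ∃ i : Fin n, (i : ℕ) + 1 = j :=
            ⟨⟨j - 1, by omega⟩, Nat.sub_add_cancel (by omega)⟩
          have h1 : (Fin.cons s₀ t : Fin (n + 1) → ℝ) j.castSucc = t i := by
            have : j.castSucc = i.succ := by ext; simp [← hi]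
            rw [this, Fin.cons_succ]
          rw [h1, ← hprog i j (by rintro rfl; omega)]
          exact h i j hi hj
      · intro h i j hij hj
        have h1 : (Fin.cons s₀ t : Fin (n + 1) → ℝ) j.castSucc = t i := by
          have : j.castSucc = i.succ := by ext; simp [← hij]
          rw [this, Fin.cons_succ]
        have h2 := h j hj
        rw [h1] at h2
        exact (hprog i j (by rintro rfl; omega)).2 h2
    · intro τ _ hτ
      refine Finset.sum_eq_zero fun w _ => ?_
      have : t ∘ τ.symm ∉ simplex n := fun h => hτ (huniq τ h.1)
      simp [this]
    · simp
  · rw [S.chainProd_flagKernel_eq_zero ε f s₀ t h0]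
    refine Finset.sum_eq_zero fun s _ => if_neg fun h => h0 fun i => ?_
    simpa using h.2 (s.1 i)

theorem chainProd_picKernel (ε : ℝ) {n : ℕ} (s : ℝ) (t : Fin n → ℝ) [Decidable
      (∀ i : Fin n, t i ≤ (Fin.cons s t : Fin (n + 1) → ℝ) i.castSucc)] :
    chainProd (fun _ => S.picKernel ε) s t =
      if ∀ i : Fin n, t i ≤ (Fin.cons s t : Fin (n + 1) → ℝ) i.castSucc then
        (List.ofFn fun i => S.Hi ε (t i)).prod else 0 := by
  classical
  induction n generalizing s with
  | zero => simp [chainProd]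
  | succ n ih =>
    have hc : (Fin.cons (t 0) (Fin.tail t) : Fin (n + 1) → ℝ) = t := Fin.cons_self_tail t
    have ih : chainProd (fun _ : Fin n => S.picKernel ε) (t 0) (Fin.tail t) =
        if ∀ i : Fin n, t i.succ ≤ t i.castSucc then
          (List.ofFn fun i => S.Hi ε (t i.succ)).prod else 0 := by
      rw [ih]
      exact if_congr (by rw [hc]; rfl) rfl rfl
    rw [chainProd, show Fin.tail (fun _ : Fin (n + 1) => S.picKernel ε) =
      fun _ => S.picKernel ε from rfl, ih]
    simp only [Fin.forall_fin_succ (n := n), Fin.cons_zero,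
      Fin.cons_succ, Fin.castSucc_zero, ← Fin.succ_castSucc, List.ofFn_succ, List.prod_cons]
    simp only [picKernel]
    by_cases h1 : t 0 ≤ s
    · by_cases h2 : ∀ i : Fin n, t i.succ ≤ t i.castSucc
      · rw [if_pos h1, if_pos h2, if_pos ⟨h1, h2⟩]
      · rw [if_neg h2, mul_zero, if_neg fun h => h2 h.2]
    · rw [if_neg h1, zero_mul, if_neg fun h => h1 h.1]

theorem mem_simplex_iff {n : ℕ} (t : Fin n → ℝ) : t ∈ simplex n ↔
    ∀ i : Fin n, t i ≤ (Fin.cons 0 t : Fin (n + 1) → ℝ) i.castSucc := by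
  cases n with
  | zero => exact ⟨fun _ i => i.elim0, fun _ => ⟨fun i => i.elim0, fun i => i.elim0⟩⟩
  | succ n =>
    rw [Fin.forall_fin_succ]
    simp only [Fin.cons_zero, Fin.castSucc_zero, ← Fin.succ_castSucc, Fin.cons_succ]
    rw [← Fin.antitone_iff_succ_le]
    exact ⟨fun h => ⟨h.2 0, h.1⟩, fun h => ⟨h.2, fun i => (h.2 (Fin.zero_le i)).trans h.1⟩⟩

theorem picardTerm_eq_chainInt [CompleteSpace E] {ε : ℝ} (hε : 0 < ε) (n : ℕ) :
    S.picardTerm ε n = chainInt (List.replicate n (S.picKernel ε)) 0 := by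
  classical
  rw [← List.ofFn_const, ← strongIntegral_chainProd (S.integrable_bound hε)
    (fun _ => S.dominated_picKernel ε), picardTerm,
    strongIntegral_restrict (sInt_prod_ofFn (F := fun _ => S.Hi ε) (S.integrable_bound hε)
      (fun _ => S.sMeas_Hi ε) fun _ => S.norm_Hi_le ε) (measurableSet_simplex n)]
  congr 1
  ext1 t
  rw [chainProd_picKernel]
  exact if_congr (mem_simplex_iff t) rfl rfl

end PerturbedSystem

/-! ### Inverses in a corner ring -/

section Corner

variable {A : Type*} [Ring A]

/-- From `hc`, (1 - p) c p = 0, so c p = p c p and p u p · p c p = p u c p = p. This is a right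
inverse only; the unit hypothesis on the completed element makes it two-sided. -/
theorem corner_mul_eq {p u c : A} (hp : p * p = p) (hk : p * (u * c) = p)
    (hc : (1 - p) * c = 1 - p) (hu : IsUnit (p * u * p + (1 - p))) :
    p * u * p * (p * c * p) = p ∧ p * c * p * (p * u * p) = p ∧ p * c * p = c * p := by
  have hcp : p * c * p = c * p := by
    have : (1 - p) * c * p = 0 := by rw [hc, sub_mul, one_mul, hp, sub_self]
    rw [sub_mul, sub_mul, one_mul, sub_eq_zero] at this
    exact this.symm
  have h1 : p * u * p * (p * c * p) = p := by
    rw [hcp, mul_assoc (p * u), ← mul_assoc p c p, hcp, ← mul_assoc, mul_assoc p u c, hk, hp]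
  have e1 : (p * u * p + (1 - p)) * (p * c * p + (1 - p)) = 1 := by
    have a1 : p * u * p * (1 - p) = 0 := by rw [mul_sub, mul_one, mul_assoc (p * u) p p, hp, sub_self]
    have a2 : (1 - p) * (p * c * p) = 0 := by
      rw [sub_mul, one_mul, ← mul_assoc, ← mul_assoc, hp, sub_self]
    have a3 : (1 - p) * (1 - p) = 1 - p := by
      rw [mul_sub, mul_one, sub_mul, one_mul, hp, sub_self, sub_zero]
    rw [add_mul, mul_add, mul_add, h1, a1, a2, a3]
    abel
  have e2 : (p * c * p + (1 - p)) * (p * u * p + (1 - p)) = 1 := by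
    obtain ⟨v, hv⟩ := hu
    rw [← hv] at e1 ⊢
    rw [← Units.inv_eq_of_mul_eq_one_right e1, Units.inv_mul]
  have h2 : p * c * p * (p * u * p) = p := by
    have a1 : p * c * p * (1 - p) = 0 := by rw [mul_sub, mul_one, mul_assoc (p * c) p p, hp, sub_self]
    have a2 : (1 - p) * (p * u * p) = 0 := by
      rw [sub_mul, one_mul, ← mul_assoc, ← mul_assoc, hp, sub_self]
    have a3 : (1 - p) * (1 - p) = 1 - p := by
      rw [mul_sub, mul_one, sub_mul, one_mul, hp, sub_self, sub_zero]
    rw [add_mul, mul_add, mul_add, a1, a2, a3, add_zero, zero_add] at e2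
    calc p * c * p * (p * u * p) = p * c * p * (p * u * p) + (1 - p) - (1 - p) := by abel
      _ = p := by rw [e2]; abel
  exact ⟨h1, h2, hcp⟩

theorem gellMannLow_eq {p u c : A} (hp : p * p = p) (hk : p * (u * c) = p)
    (hc : (1 - p) * c = 1 - p) (hu : IsUnit (p * u * p + (1 - p))) :
    gellMannLow p u = u * c * p := by
  obtain ⟨h1, h2, h3⟩ := corner_mul_eq hp hk hc hu
  have : cornerInverse p (p * u * p) = p * c * p :=
    cornerInverse_eq hp (by rw [← mul_assoc, ← mul_assoc, hp]) (by rw [mul_assoc, hp])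
      (by rw [← mul_assoc, ← mul_assoc, hp]) (by rw [mul_assoc, hp]) h1 h2
  rw [gellMannLow, this, ← mul_assoc, ← mul_assoc, mul_assoc u p p, hp, mul_assoc u p c,
    mul_assoc u (p * c) p, h3, ← mul_assoc]

theorem gellMannLow_mul {p u c : A} (hp : p * p = p) (hk : p * (u * c) = p)
    (hc : (1 - p) * c = 1 - p) (hu : IsUnit (p * u * p + (1 - p))) :
    gellMannLow p u * (p * u * p) = u * p := by
  obtain ⟨h1, h2, h3⟩ := corner_mul_eq hp hk hc hu
  rw [gellMannLow_eq hp hk hc hu, mul_assoc u c p, ← h3, mul_assoc, h2]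

theorem isUnit_of_coeff_zero {F : PowerSeries A} (hF : PowerSeries.coeff 0 F = 1) : IsUnit F := by
  have h : PowerSeries.constantCoeff F = ((1 : Aˣ) : A) := by
    rw [← PowerSeries.coeff_zero_eq_constantCoeff_apply, hF]; rfl
  exact ⟨⟨F, _, PowerSeries.mul_invOfUnit F 1 h, PowerSeries.invOfUnit_mul F 1 h⟩, rfl⟩

end Corner

theorem strongIntegral_zero {E : Type*} [NormedAddCommGroup E] [InnerProductSpace ℂ E]
    {α : Type*} [MeasurableSpace α] {μ : Measure α} :
    strongIntegral μ (fun _ : α => (0 : E →L[ℂ] E)) = 0 := by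
  have : SInt μ fun _ : α => (0 : E →L[ℂ] E) :=
    ⟨SMeas.const 0, fun _ => 0, integrable_zero _ _ _, fun _ => by simp⟩
  ext ψ
  rw [this.strongIntegral_apply]
  simp

/-! ### The Volterra equation and the exponential form of U_GL -/

namespace PerturbedSystem

variable {ι E : Type*} [NormedAddCommGroup E] [InnerProductSpace ℂ E]
variable (S : PerturbedSystem ι E)

/-- The `n`-th term of the Picard series at time `s`. -/
def evolutionTerm (ε : ℝ) (n : ℕ) (s : ℝ) : E →L[ℂ] E :=
  chainInt (List.replicate n (S.picKernel ε)) s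

/-- The sum of the words of length `n` which form progressions when they follow a letter at
time `s`. -/
def progTerm (ε : ℝ) (n : ℕ) (s : ℝ) : E →L[ℂ] E :=
  chainInt (List.replicate n (S.progKernel ε)) s

/-- The kernel of a barred letter which is not constrained by its predecessor. -/
def barKernel (ε : ℝ) : Kernel E := fun _ u => if u ≤ 0 then S.letter ε true u else 0

theorem dominated_barKernel (ε : ℝ) : Dominated (S.bound ε) (S.barKernel ε) where
  meas := SMeas.ite (measurableSet_le measurable_snd measurable_const)
    ((S.sMeas_letter ε _).comp measurable_snd) (SMeas.const 0)
  bound s u := by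
    unfold barKernel
    split_ifs
    · exact S.norm_letter_le ε _ u
    · simpa using S.bound_nonneg ε u

/-- The limits at time `-∞` of `progTerm`. -/
def initialTerm (ε : ℝ) : ℕ → E →L[ℂ] E
  | 0 => 1
  | m + 1 => chainInt (S.barKernel ε :: List.replicate m (S.progKernel ε)) 0

variable {ε : ℝ}

theorem dominated_of_mem_replicate {g : ℝ → ℝ} {k : Kernel E} (hk : Dominated g k) (m : ℕ) :
    ∀ k' ∈ List.replicate m k, Dominated g k' := fun k' hk' => by
  rw [List.eq_of_mem_replicate hk']; exact hk

theorem sInt_picKernel_mul (hε : 0 < ε) (m : ℕ) (s : ℝ) :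
    SInt volume fun u => S.picKernel ε s u * S.evolutionTerm ε m u :=
  sInt_chainInt (S.integrable_bound hε) (S.dominated_picKernel ε)
    (dominated_of_mem_replicate (S.dominated_picKernel ε) m) s

theorem sInt_mul_progTerm (hε : 0 < ε) {k : Kernel E} (hk : Dominated (S.bound ε) k) (m : ℕ)
    (s : ℝ) : SInt volume fun u => k s u * S.progTerm ε m u :=
  sInt_chainInt (S.integrable_bound hε) hk
    (dominated_of_mem_replicate (S.dominated_progKernel ε) m) s

theorem evolutionTerm_succ (m : ℕ) (s : ℝ) : S.evolutionTerm ε (m + 1) s =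
    strongIntegral volume fun u => S.picKernel ε s u * S.evolutionTerm ε m u := rfl

theorem progTerm_succ (m : ℕ) (s : ℝ) : S.progTerm ε (m + 1) s =
    strongIntegral volume fun u => S.progKernel ε s u * S.progTerm ε m u := rfl

theorem initialTerm_succ (m : ℕ) : S.initialTerm ε (m + 1) =
    strongIntegral volume fun u => S.barKernel ε 0 u * S.progTerm ε m u := rfl

theorem ae_ne (s : ℝ) : ∀ᵐ u : ℝ, u ≠ s := by
  rw [ae_iff]
  simp

/-- Writing A = H_i + B for u < s splits the kernel into B on all u ≤ 0 and H_i on u ≤ s; the two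
sides differ only at the null point u = s. -/
theorem progTerm_succ_eq (hε : 0 < ε) (m : ℕ) {s : ℝ} (hs : s ≤ 0) :
    S.progTerm ε (m + 1) s = S.initialTerm ε (m + 1) +
      strongIntegral volume fun u => S.picKernel ε s u * S.progTerm ε m u := by
  have h1 := S.sInt_mul_progTerm hε (S.dominated_barKernel ε) m 0
  have h2 := S.sInt_mul_progTerm hε (S.dominated_picKernel ε) m s
  rw [progTerm_succ, initialTerm_succ, ← strongIntegral_add h1 h2]
  refine strongIntegral_congr_ae (S.sInt_mul_progTerm hε (S.dominated_progKernel ε) m s)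
    (h1.add h2) ?_
  filter_upwards [ae_ne s] with u hu
  rw [← add_mul]
  congr 1
  simp only [progKernel, barKernel, picKernel]
  by_cases h : u < s
  · rw [if_pos (by linarith), if_pos h, if_pos (by linarith), if_pos h.le, letter_false_eq,
      add_comm]
  · have h' : ¬ u ≤ s := fun h'' => h (lt_of_le_of_ne h'' hu)
    rw [if_neg h, if_neg h', add_zero]

/-- The solution of a linear Volterra equation is the Picard series applied to its data at -∞. These
data are constants multiplied on the right, so they leave the integrals. -/
theorem progTerm_eq_sum [CompleteSpace E] (hε : 0 < ε) (m : ℕ) {s : ℝ} (hs : s ≤ 0) :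
    S.progTerm ε m s = ∑ x ∈ Finset.HasAntidiagonal.antidiagonal m,
      S.evolutionTerm ε x.1 s * S.initialTerm ε x.2 := by
  induction m generalizing s with
  | zero => simp [progTerm, evolutionTerm, initialTerm, chainInt]
  | succ m ih =>
    rw [S.progTerm_succ_eq hε m hs, Finset.Nat.sum_antidiagonal_succ]
    have h0 : S.evolutionTerm ε 0 s = 1 := rfl
    have h1 : (fun u => S.picKernel ε s u * S.progTerm ε m u) = fun u =>
        ∑ x ∈ Finset.HasAntidiagonal.antidiagonal m,
          S.picKernel ε s u * S.evolutionTerm ε x.1 u * S.initialTerm ε x.2 := by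
      ext1 u
      by_cases hu : u ≤ s
      · rw [ih (hu.trans hs), Finset.mul_sum]
        simp only [mul_assoc]
      · simp [picKernel, hu]
    rw [h0, one_mul, h1, strongIntegral_sum fun x _ =>
      (S.sInt_picKernel_mul hε x.1 s).mul_right _]
    congr 1
    refine Finset.sum_congr rfl fun x _ => ?_
    rw [strongIntegral_mul_right (S.sInt_picKernel_mul hε x.1 s), ← evolutionTerm_succ]

theorem P_mul_letter_true (t : ℝ) : S.P * S.letter ε true t = S.letter ε true t := by
  change S.P * (-(S.P * S.Hi ε t)) = -(S.P * S.Hi ε t)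
  rw [mul_neg, ← mul_assoc, P_mul_P]

theorem P_mul_letter_false (t : ℝ) : S.P * S.letter ε false t = 0 := by
  change S.P * ((1 - S.P) * S.Hi ε t) = 0
  rw [← mul_assoc, mul_sub, mul_one, P_mul_P, sub_self, zero_mul]

theorem P_mul_initialTerm [CompleteSpace E] (hε : 0 < ε) (m : ℕ) :
    S.P * S.initialTerm ε (m + 1) = S.initialTerm ε (m + 1) := by
  rw [initialTerm_succ, ← strongIntegral_mul_left
    (S.sInt_mul_progTerm hε (S.dominated_barKernel ε) m 0)]
  congr 1
  ext1 u
  rw [← mul_assoc]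
  congr 1
  unfold barKernel
  split_ifs
  · exact S.P_mul_letter_true u
  · exact mul_zero _

/-- After time 0, almost every u ≤ 0 is earlier, so the leading letter is A and is killed by P. -/
theorem P_mul_progTerm_zero [CompleteSpace E] (hε : 0 < ε) (m : ℕ) :
    S.P * S.progTerm ε (m + 1) 0 = 0 := by
  have h := S.sInt_mul_progTerm hε (S.dominated_progKernel ε) m 0
  rw [progTerm_succ, ← strongIntegral_mul_left h,
    ← strongIntegral_zero (μ := (volume : Measure ℝ)) (E := E)]
  refine strongIntegral_congr_ae (h.mul_left _)
    ⟨SMeas.const 0, fun _ => 0, integrable_zero _ _ _, fun _ => by simp⟩ ?_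
  filter_upwards [ae_ne 0] with u hu
  rw [← mul_assoc]
  unfold progKernel
  by_cases h1 : u < 0
  · rw [if_pos h1.le, if_pos h1, P_mul_letter_false, zero_mul]
  · rw [if_neg fun h2 => h1 (lt_of_le_of_ne h2 hu), mul_zero, zero_mul]

theorem coeff_Pic [CompleteSpace E] (hε : 0 < ε) (n : ℕ) : PowerSeries.coeff n (S.Pic ε) =
    chainInt (List.ofFn fun i : Fin n => S.flagKernel ε (decide ((i : ℕ) ≠ 0))) 0 := by
  rw [← S.sum_iteratedIntegral_eq_chainInt hε _ (fun i hi => by simp [hi]) 0, Pic,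
    PowerSeries.coeff_mk, Finset.sum_filter]
  exact Finset.sum_congr rfl fun s _ => if_congr (noRegression_iff s) rfl rfl

theorem coeff_zero_Pic [CompleteSpace E] (hε : 0 < ε) : PowerSeries.coeff 0 (S.Pic ε) = 1 := by
  rw [S.coeff_Pic hε]; rfl

/-- The leading letter is A + B. Its A part is a letter forced to progress after time 0, its B part
is the one in `initialTerm`. -/
theorem coeff_succ_Pic [CompleteSpace E] (hε : 0 < ε) (m : ℕ) :
    PowerSeries.coeff (m + 1) (S.Pic ε) = S.initialTerm ε (m + 1) + S.progTerm ε (m + 1) 0 := by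
  have h1 := S.sInt_mul_progTerm hε (S.dominated_barKernel ε) m 0
  have h2 := S.sInt_mul_progTerm hε (S.dominated_progKernel ε) m 0
  have hl : (List.ofFn fun i : Fin (m + 1) => S.flagKernel ε (decide ((i : ℕ) ≠ 0))) =
      S.freeKernel ε :: List.replicate m (S.progKernel ε) := by
    rw [List.ofFn_succ, ← List.ofFn_const]
    simp [flagKernel]
  rw [S.coeff_Pic hε, hl, initialTerm_succ, progTerm_succ, ← strongIntegral_add h1 h2]
  refine strongIntegral_congr_ae (S.sInt_mul_progTerm hε (S.dominated_freeKernel ε) m 0)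
    (h1.add h2) ?_
  filter_upwards [ae_ne 0] with u hu
  change S.freeKernel ε 0 u * S.progTerm ε m u = _
  rw [← add_mul]
  congr 1
  simp only [progKernel, barKernel, freeKernel]
  by_cases h : u < 0
  · rw [if_pos h.le, if_pos h.le, if_pos h.le, if_pos h, add_comm]
  · have h' : ¬ u ≤ 0 := fun h'' => h (lt_of_le_of_ne h'' hu)
    rw [if_neg h', if_neg h', if_neg h', add_zero]

/-- The generating series of `initialTerm`. -/
def initialSeries (ε : ℝ) : PowerSeries (E →L[ℂ] E) := PowerSeries.mk (S.initialTerm ε)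

theorem formalP_mul_self : S.formalP * S.formalP = S.formalP := by
  rw [formalP, ← map_mul, P_mul_P]

theorem coeff_formalP_mul (F : PowerSeries (E →L[ℂ] E)) (n : ℕ) :
    PowerSeries.coeff n (S.formalP * F) = S.P * PowerSeries.coeff n F :=
  PowerSeries.coeff_C_mul _ _ _

theorem coeff_mul_formalP (F : PowerSeries (E →L[ℂ] E)) (n : ℕ) :
    PowerSeries.coeff n (F * S.formalP) = PowerSeries.coeff n F * S.P :=
  PowerSeries.coeff_mul_C _ _ _

theorem coeff_corner (n : ℕ) : PowerSeries.coeff n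
    (S.formalP * S.formalEvolution ε * S.formalP + (1 - S.formalP)) =
      S.P * PowerSeries.coeff n (S.formalEvolution ε) * S.P + if n = 0 then 1 - S.P else 0 := by
  rw [map_add, map_sub, coeff_mul_formalP, coeff_formalP_mul, PowerSeries.coeff_one, formalP,
    PowerSeries.coeff_C]
  split_ifs <;> simp

variable [CompleteSpace E]

theorem formalEvolution_eq (hε : 0 < ε) :
    S.formalEvolution ε = PowerSeries.mk fun n => S.evolutionTerm ε n 0 := by
  ext1 n
  rw [formalEvolution, PowerSeries.coeff_mk, PowerSeries.coeff_mk, S.picardTerm_eq_chainInt hε]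
  rfl

theorem coeff_evolution_mul_initial (hε : 0 < ε) (n : ℕ) :
    PowerSeries.coeff n (S.formalEvolution ε * S.initialSeries ε) = S.progTerm ε n 0 := by
  rw [PowerSeries.coeff_mul, S.progTerm_eq_sum hε n le_rfl, S.formalEvolution_eq hε]
  simp [initialSeries]

theorem formalP_mul_evolution_mul_initial (hε : 0 < ε) :
    S.formalP * (S.formalEvolution ε * S.initialSeries ε) = S.formalP := by
  ext1 n
  rw [coeff_formalP_mul, S.coeff_evolution_mul_initial hε, formalP]
  cases n with
  | zero => rw [PowerSeries.coeff_C, if_pos rfl]; exact mul_one _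
  | succ n =>
    rw [S.P_mul_progTerm_zero hε, PowerSeries.coeff_C, if_neg n.succ_ne_zero]

theorem one_sub_formalP_mul_initial (hε : 0 < ε) :
    (1 - S.formalP) * S.initialSeries ε = 1 - S.formalP := by
  ext1 n
  rw [sub_mul, one_mul, map_sub, coeff_formalP_mul, initialSeries, PowerSeries.coeff_mk, map_sub,
    formalP, PowerSeries.coeff_C, PowerSeries.coeff_one]
  cases n with
  | zero => simp [initialTerm]
  | succ n => simp [S.P_mul_initialTerm hε]

theorem Pic_eq (hε : 0 < ε) : S.Pic ε =
    S.formalEvolution ε * S.initialSeries ε + S.initialSeries ε - 1 := by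
  ext1 n
  rw [map_sub, map_add, S.coeff_evolution_mul_initial hε, initialSeries, PowerSeries.coeff_mk,
    PowerSeries.coeff_one]
  cases n with
  | zero =>
    rw [S.coeff_zero_Pic hε]; simp [initialTerm, progTerm, chainInt]
  | succ n =>
    rw [S.coeff_succ_Pic hε, if_neg n.succ_ne_zero, sub_zero, add_comm]

theorem coeff_zero_formalEvolution (hε : 0 < ε) :
    PowerSeries.coeff 0 (S.formalEvolution ε) = 1 := by
  rw [S.formalEvolution_eq hε, PowerSeries.coeff_mk]; rfl

theorem coeff_zero_corner (hε : 0 < ε) : PowerSeries.coeff 0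
    (S.formalP * S.formalEvolution ε * S.formalP + (1 - S.formalP)) = 1 := by
  rw [coeff_corner, S.coeff_zero_formalEvolution hε, if_pos rfl, mul_one, P_mul_P]
  abel

theorem isUnit_corner (hε : 0 < ε) :
    IsUnit (S.formalP * S.formalEvolution ε * S.formalP + (1 - S.formalP)) :=
  isUnit_of_coeff_zero (S.coeff_zero_corner hε)

theorem formalUGL_eq (hε : 0 < ε) : S.formalUGL ε =
    S.formalEvolution ε * S.initialSeries ε * S.formalP :=
  gellMannLow_eq S.formalP_mul_self (S.formalP_mul_evolution_mul_initial hε)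
    (S.one_sub_formalP_mul_initial hε) (S.isUnit_corner hε)

/-- The projection 1 - P kills C - 1, so (1 - P) Pic P = (1 - P) U C P, which is U C P - P by P U C
= P. -/
theorem formalUGL_eq_magnusForm (hε : 0 < ε) :
    S.formalUGL ε = S.magnusForm (S.Omega ε) := by
  have hp := S.formalP_mul_self
  have h1 := S.formalP_mul_evolution_mul_initial hε
  rw [magnusForm, Omega, formalExp_formalLog (S.coeff_zero_Pic hε), S.formalUGL_eq hε,
    S.Pic_eq hε, mul_sub, mul_add, S.one_sub_formalP_mul_initial hε, mul_one, add_sub_cancel_right,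
    sub_mul, one_mul, h1, sub_mul, hp]
  abel

end PerturbedSystem

/-! ### The exponent up to third order -/

section Log

variable {R : Type*} [Ring R] [Algebra ℂ R]

theorem coeff_one_formalLog {F : PowerSeries R} :
    PowerSeries.coeff 1 (formalLog F) = PowerSeries.coeff 1 F := by
  simp [formalLog, PowerSeries.coeff_one]

theorem coeff_two_formalLog {F : PowerSeries R} (hF : PowerSeries.coeff 0 F = 1) :
    PowerSeries.coeff 2 (formalLog F) = PowerSeries.coeff 2 F -
      (1 / 2 : ℂ) • (PowerSeries.coeff 1 F * PowerSeries.coeff 1 F) := by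
  have h0 : PowerSeries.coeff 0 (F - 1) = 0 := by rw [map_sub, hF]; simp
  have h1 : PowerSeries.coeff 1 (F - 1) = PowerSeries.coeff 1 F := by
    simp [PowerSeries.coeff_one]
  have h2 : PowerSeries.coeff 2 (F - 1) = PowerSeries.coeff 2 F := by
    simp [PowerSeries.coeff_one]
  simp only [formalLog, PowerSeries.coeff_mk]
  rw [show Finset.Icc 1 2 = {1, 2} from rfl, Finset.sum_pair (by norm_num), pow_one, h2, sq,
    PowerSeries.coeff_mul, Finset.Nat.sum_antidiagonal_eq_sum_range_succ_mk]
  simp only [Finset.sum_range_succ, Finset.sum_range_zero, h0, h1, zero_mul, zero_add,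
    Nat.sub_self, mul_zero, add_zero, Nat.add_one_sub_one]
  norm_num
  rw [sub_eq_add_neg]

theorem coeff_three_formalLog {F : PowerSeries R} (hF : PowerSeries.coeff 0 F = 1) :
    PowerSeries.coeff 3 (formalLog F) = PowerSeries.coeff 3 F -
      (1 / 2 : ℂ) • (PowerSeries.coeff 1 F * PowerSeries.coeff 2 F +
        PowerSeries.coeff 2 F * PowerSeries.coeff 1 F) +
      (1 / 3 : ℂ) • (PowerSeries.coeff 1 F * (PowerSeries.coeff 1 F * PowerSeries.coeff 1 F)) := by
  have h0 : PowerSeries.coeff 0 (F - 1) = 0 := by rw [map_sub, hF]; simp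
  have h1 : PowerSeries.coeff 1 (F - 1) = PowerSeries.coeff 1 F := by
    simp [PowerSeries.coeff_one]
  have h2 : PowerSeries.coeff 2 (F - 1) = PowerSeries.coeff 2 F := by
    simp [PowerSeries.coeff_one]
  have h3 : PowerSeries.coeff 3 (F - 1) = PowerSeries.coeff 3 F := by
    simp [PowerSeries.coeff_one]
  simp only [formalLog, PowerSeries.coeff_mk]
  rw [show Finset.Icc 1 3 = {1, 2, 3} from rfl, Finset.sum_insert (by decide),
    Finset.sum_pair (by norm_num), pow_one, h3, sq, pow_three]
  simp only [PowerSeries.coeff_mul, Finset.Nat.sum_antidiagonal_eq_sum_range_succ_mk,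
    Finset.sum_range_succ, Finset.sum_range_zero, Nat.reduceSub, h0, h1, h2, zero_mul, zero_add,
    mul_zero, add_zero]
  norm_num
  abel

end Log

namespace PerturbedSystem

variable {ι E : Type*} [NormedAddCommGroup E] [InnerProductSpace ℂ E]
variable (S : PerturbedSystem ι E)
variable {ε : ℝ}

/-- A sum over words as a sum over signed permutations. -/
theorem sum_H_eq {n : ℕ} (L : List (Fin n → ℤ)) : (L.map (S.H ε)).sum =
    ∑ s : SignedPerm n, (L.count (oneLine s) : ℂ) • S.iteratedIntegral ε s := by
  induction L with
  | nil => simp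
  | cons w L ih =>
    rw [List.map_cons, List.sum_cons, ih, H, ← Finset.sum_add_distrib]
    refine Finset.sum_congr rfl fun s _ => ?_
    rw [List.count_cons]
    by_cases h : oneLine s = w
    · simp [h, add_smul, add_comm]
    · simp [h, Ne.symm h]

/-- The sum of the signed permutations with progressions in front of the marked positions. -/
def flagSum (ε : ℝ) {n : ℕ} (f : Fin n → Bool) : E →L[ℂ] E :=
  ∑ s : SignedPerm n, if ProgressesOn f s then S.iteratedIntegral ε s else 0

theorem coeff_one_Omega : PowerSeries.coeff 1 (S.Omega ε) = S.H ε ![1] + S.H ε ![-1] := by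
  have hL : S.H ε ![1] + S.H ε ![-1] = (([![1], ![-1]] : List (Fin 1 → ℤ)).map (S.H ε)).sum := by
    simp
  rw [hL, sum_H_eq, Omega, coeff_one_formalLog, Pic, PowerSeries.coeff_mk, Finset.sum_filter]
  have hd : ∀ s : SignedPerm 1, NoRegression s ∧
      ([![1], ![-1]] : List (Fin 1 → ℤ)).count (oneLine s) = 1 := by decide
  refine Finset.sum_congr rfl fun s _ => ?_
  rw [if_pos (hd s).1, (hd s).2, Nat.cast_one, one_smul]

variable [CompleteSpace E]

/-- The second word starts with an unmarked letter, so its chain does not depend on the time before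
it and factors out; the product is the chain of the concatenation, unconstrained at the junction. -/
theorem flagSum_mul (hε : 0 < ε) {m n k : ℕ} {f : Fin m → Bool} {f' : Fin n → Bool}
    {f'' : Fin k → Bool} (hf : ∀ i : Fin m, (i : ℕ) = 0 → f i = false)
    (hf' : ∀ i : Fin n, (i : ℕ) = 0 → f' i = false)
    (hf'' : ∀ i : Fin k, (i : ℕ) = 0 → f'' i = false)
    (h : List.ofFn f ++ List.ofFn f' = List.ofFn f'') :
    S.flagSum ε f * S.flagSum ε f' = S.flagSum ε f'' := by
  have hl : ∀ {n : ℕ} (f : Fin n → Bool), (List.ofFn fun i => S.flagKernel ε (f i)) =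
      (List.ofFn f).map (S.flagKernel ε) := fun f => by rw [List.map_ofFn]; rfl
  rw [flagSum, flagSum, flagSum, S.sum_iteratedIntegral_eq_chainInt hε f hf 0,
    S.sum_iteratedIntegral_eq_chainInt hε f'' hf'' 0, hl f'', ← h, List.map_append, ← hl, ← hl,
    ← chainInt_append (S.integrable_bound hε) ?_
      fun u => (S.sum_iteratedIntegral_eq_chainInt hε f' hf' u).symm]
  intro k hk
  obtain ⟨i, rfl⟩ := (List.mem_ofFn' _ _).1 hk
  exact S.dominated_flagKernel ε _

theorem coeff_Pic_eq_flagSum (hε : 0 < ε) (n : ℕ) : PowerSeries.coeff n (S.Pic ε) =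
    S.flagSum ε fun i : Fin n => decide ((i : ℕ) ≠ 0) := by
  rw [S.coeff_Pic hε, flagSum, S.sum_iteratedIntegral_eq_chainInt hε _ (fun i hi => by simp [hi]) 0]

theorem coeff_two_Omega (hε : 0 < ε) : PowerSeries.coeff 2 (S.Omega ε) = (1 / 2 : ℂ) •
    (S.H ε ![1, 2] + S.H ε ![-1, 2] + S.H ε ![2, -1] + S.H ε ![-2, -1]
      - S.H ε ![1, -2] - S.H ε ![-1, -2] - S.H ε ![2, 1] - S.H ε ![-2, 1]) := by
  set L₁ : List (Fin 2 → ℤ) := [![1, 2], ![-1, 2], ![2, -1], ![-2, -1]] with hL₁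
  set L₂ : List (Fin 2 → ℤ) := [![1, -2], ![-1, -2], ![2, 1], ![-2, 1]] with hL₂
  have hL : S.H ε ![1, 2] + S.H ε ![-1, 2] + S.H ε ![2, -1] + S.H ε ![-2, -1]
      - S.H ε ![1, -2] - S.H ε ![-1, -2] - S.H ε ![2, 1] - S.H ε ![-2, 1] =
      (L₁.map (S.H ε)).sum - (L₂.map (S.H ε)).sum := by
    simp only [hL₁, hL₂, List.map_cons, List.map_nil, List.sum_cons, List.sum_nil]
    abel
  have h11 : PowerSeries.coeff 1 (S.Pic ε) * PowerSeries.coeff 1 (S.Pic ε) =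
      S.flagSum ε ![false, false] := by
    rw [S.coeff_Pic_eq_flagSum hε]
    exact S.flagSum_mul hε (by decide) (by decide) (by decide) (by decide)
  have h2 : PowerSeries.coeff 2 (S.Pic ε) = S.flagSum ε ![false, true] := by
    rw [S.coeff_Pic_eq_flagSum hε]
    congr 1
    decide
  rw [hL, sum_H_eq, sum_H_eq, Omega, coeff_two_formalLog (S.coeff_zero_Pic hε), h11, h2, flagSum,
    flagSum, ← Finset.sum_sub_distrib, Finset.smul_sum, Finset.smul_sum, ← Finset.sum_sub_distrib]
  -- A progression receives the weight 1 - 1/2, a regression -1/2.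
  have hd : ∀ s : SignedPerm 2, ProgressesOn ![false, false] s ∧
      ((ProgressesOn ![false, true] s ∧ L₁.count (oneLine s) = 1 ∧ L₂.count (oneLine s) = 0) ∨
      (¬ ProgressesOn ![false, true] s ∧ L₁.count (oneLine s) = 0 ∧
        L₂.count (oneLine s) = 1)) := by
    decide
  refine Finset.sum_congr rfl fun s _ => ?_
  obtain ⟨h0, ⟨h, c1, c2⟩ | ⟨h, c1, c2⟩⟩ := hd s
  · rw [if_pos h0, if_pos h, c1, c2]
    push_cast
    module
  · rw [if_pos h0, if_neg h, c1, c2]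
    push_cast
    module

theorem coeff_three_Omega (hε : 0 < ε) : PowerSeries.coeff 3 (S.Omega ε) =
        (1 / 3 : ℂ) •
          (S.H ε ![1, 2, 3] + S.H ε ![-1, 2, 3] + S.H ε ![1, 3, -2] + S.H ε ![-1, 3, -2]
          + S.H ε ![2, -1, 3] + S.H ε ![-2, -1, 3] + S.H ε ![2, 3, -1] + S.H ε ![-2, 3, -1]
          + S.H ε ![3, -2, -1] + S.H ε ![-3, -2, -1] + S.H ε ![3, -1, 2] + S.H ε ![-3, -1, 2]
          + S.H ε ![3, 2, 1] + S.H ε ![-3, 2, 1] + S.H ε ![2, -3, 1] + S.H ε ![-2, -3, 1]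
          + S.H ε ![1, -2, -3] + S.H ε ![-1, -2, -3] + S.H ε ![1, -3, 2] + S.H ε ![-1, -3, 2]
          + S.H ε ![2, 1, -3] + S.H ε ![-2, 1, -3] + S.H ε ![3, 1, -2] + S.H ε ![-3, 1, -2])
        - (1 / 6 : ℂ) •
          (S.H ε ![1, 3, 2] + S.H ε ![-1, 3, 2] + S.H ε ![2, 3, 1] + S.H ε ![-2, 3, 1]
          + S.H ε ![2, 1, 3] + S.H ε ![-2, 1, 3] + S.H ε ![3, 1, 2] + S.H ε ![-3, 1, 2]
          + S.H ε ![1, -3, -2] + S.H ε ![-1, -3, -2] + S.H ε ![1, -2, 3] + S.H ε ![-1, -2, 3]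
          + S.H ε ![2, -1, -3] + S.H ε ![-2, -1, -3] + S.H ε ![3, -1, -2] + S.H ε ![-3, -1, -2]
          + S.H ε ![2, -3, -1] + S.H ε ![-2, -3, -1] + S.H ε ![3, -2, 1] + S.H ε ![-3, -2, 1]
          + S.H ε ![1, 2, -3] + S.H ε ![-1, 2, -3] + S.H ε ![3, 2, -1] + S.H ε ![-3, 2, -1]) := by
  set L₁ : List (Fin 3 → ℤ) := [![1, 2, 3], ![-1, 2, 3], ![1, 3, -2], ![-1, 3, -2], ![2, -1, 3],
    ![-2, -1, 3], ![2, 3, -1], ![-2, 3, -1], ![3, -2, -1], ![-3, -2, -1], ![3, -1, 2], ![-3, -1, 2],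
    ![3, 2, 1], ![-3, 2, 1], ![2, -3, 1], ![-2, -3, 1], ![1, -2, -3], ![-1, -2, -3], ![1, -3, 2],
    ![-1, -3, 2], ![2, 1, -3], ![-2, 1, -3], ![3, 1, -2], ![-3, 1, -2]] with hL₁
  set L₂ : List (Fin 3 → ℤ) := [![1, 3, 2], ![-1, 3, 2], ![2, 3, 1], ![-2, 3, 1], ![2, 1, 3],
    ![-2, 1, 3], ![3, 1, 2], ![-3, 1, 2], ![1, -3, -2], ![-1, -3, -2], ![1, -2, 3], ![-1, -2, 3],
    ![2, -1, -3], ![-2, -1, -3], ![3, -1, -2], ![-3, -1, -2], ![2, -3, -1], ![-2, -3, -1],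
    ![3, -2, 1], ![-3, -2, 1], ![1, 2, -3], ![-1, 2, -3], ![3, 2, -1], ![-3, 2, -1]] with hL₂
  have h111 : PowerSeries.coeff 1 (S.Pic ε) * (PowerSeries.coeff 1 (S.Pic ε) *
      PowerSeries.coeff 1 (S.Pic ε)) = S.flagSum ε ![false, false, false] := by
    rw [S.coeff_Pic_eq_flagSum hε, S.flagSum_mul hε (f'' := ![false, false]) (by decide)
      (by decide) (by decide) (by decide)]
    exact S.flagSum_mul hε (by decide) (by decide) (by decide) (by decide)
  have h12 : PowerSeries.coeff 1 (S.Pic ε) * PowerSeries.coeff 2 (S.Pic ε) =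
      S.flagSum ε ![false, false, true] := by
    rw [S.coeff_Pic_eq_flagSum hε, S.coeff_Pic_eq_flagSum hε]
    exact S.flagSum_mul hε (by decide) (by decide) (by decide) (by decide)
  have h21 : PowerSeries.coeff 2 (S.Pic ε) * PowerSeries.coeff 1 (S.Pic ε) =
      S.flagSum ε ![false, true, false] := by
    rw [S.coeff_Pic_eq_flagSum hε, S.coeff_Pic_eq_flagSum hε]
    exact S.flagSum_mul hε (by decide) (by decide) (by decide) (by decide)
  have h3 : PowerSeries.coeff 3 (S.Pic ε) = S.flagSum ε ![false, true, true] := by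
    rw [S.coeff_Pic_eq_flagSum hε]
    congr 1
    decide
  -- The weights are 1 - 1/2 - 1/2 + 1/3 = 1/3 for two progressions, -1/2 + 1/3 = -1/6 for exactly
  -- one, and 1/3 for none. The counts also show that the two lists exhaust the signed permutations
  -- without repetition.
  have hd : ∀ s : SignedPerm 3, ProgressesOn ![false, false, false] s ∧
      ((ProgressesOn ![false, true, true] s ∧ ProgressesOn ![false, false, true] s ∧
        ProgressesOn ![false, true, false] s ∧
          L₁.count (oneLine s) = 1 ∧ L₂.count (oneLine s) = 0) ∨
      (¬ ProgressesOn ![false, true, true] s ∧ ProgressesOn ![false, false, true] s ∧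
        ¬ ProgressesOn ![false, true, false] s ∧
          L₁.count (oneLine s) = 0 ∧ L₂.count (oneLine s) = 1) ∨
      (¬ ProgressesOn ![false, true, true] s ∧ ¬ ProgressesOn ![false, false, true] s ∧
        ProgressesOn ![false, true, false] s ∧
          L₁.count (oneLine s) = 0 ∧ L₂.count (oneLine s) = 1) ∨
      (¬ ProgressesOn ![false, true, true] s ∧ ¬ ProgressesOn ![false, false, true] s ∧
        ¬ ProgressesOn ![false, true, false] s ∧
          L₁.count (oneLine s) = 1 ∧ L₂.count (oneLine s) = 0)) := by
    decide
  trans (1 / 3 : ℂ) • (L₁.map (S.H ε)).sum - (1 / 6 : ℂ) • (L₂.map (S.H ε)).sum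
  · rw [sum_H_eq, sum_H_eq, Omega, coeff_three_formalLog (S.coeff_zero_Pic hε), h111, h12, h21, h3,
      flagSum, flagSum, flagSum, flagSum, ← Finset.sum_add_distrib, Finset.smul_sum,
      Finset.smul_sum, Finset.smul_sum, Finset.smul_sum, ← Finset.sum_sub_distrib,
      ← Finset.sum_sub_distrib, ← Finset.sum_add_distrib]
    refine Finset.sum_congr rfl fun s _ => ?_
    obtain ⟨h0, ⟨p1, p2, p3, c1, c2⟩ | ⟨p1, p2, p3, c1, c2⟩ | ⟨p1, p2, p3, c1, c2⟩ |
      ⟨p1, p2, p3, c1, c2⟩⟩ := hd s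
    all_goals
      simp only [h0, p1, p2, p3, c1, c2, if_true, if_false]
      push_cast
      module
  · simp only [hL₁, hL₂, List.map_cons, List.map_nil, List.sum_cons, List.sum_nil, add_zero,
      add_assoc]

end PerturbedSystem

/-! ### The number derivation on formal power series -/

section Number

variable {R : Type*} [Ring R] [Algebra ℂ R]

/-- The derivation `X d/dX`. -/
def numDeriv (F : PowerSeries R) : PowerSeries R :=
  PowerSeries.mk fun n => (n : ℂ) • PowerSeries.coeff n F

theorem numDeriv_mul (F G : PowerSeries R) :
    numDeriv (F * G) = numDeriv F * G + F * numDeriv G := by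
  ext1 n
  simp only [numDeriv, PowerSeries.coeff_mk, map_add, PowerSeries.coeff_mul]
  rw [Finset.smul_sum, ← Finset.sum_add_distrib]
  refine Finset.sum_congr rfl fun x hx => ?_
  rw [← Finset.HasAntidiagonal.mem_antidiagonal.1 hx, smul_mul_assoc, mul_smul_comm, ← add_smul]
  push_cast
  rfl

theorem numDeriv_C (a : R) : numDeriv (PowerSeries.C a) = 0 := by
  ext1 n
  rw [numDeriv, PowerSeries.coeff_mk, PowerSeries.coeff_C]
  split_ifs with h
  · simp [h]
  · simp

/-- The operator `ε X d/dX + δ`. -/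
def shiftedDeriv (ε δ : ℂ) (F : PowerSeries R) : PowerSeries R := ε • numDeriv F + δ • F

theorem coeff_shiftedDeriv (ε δ : ℂ) (F : PowerSeries R) (n : ℕ) :
    PowerSeries.coeff n (shiftedDeriv ε δ F) = (n * ε + δ) • PowerSeries.coeff n F := by
  simp only [shiftedDeriv, numDeriv, map_add, PowerSeries.coeff_smul, PowerSeries.coeff_mk]
  module

theorem shiftedDeriv_C_mul (ε δ : ℂ) (a : R) (F : PowerSeries R) :
    shiftedDeriv ε δ (PowerSeries.C a * F) = PowerSeries.C a * shiftedDeriv ε δ F := by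
  ext1 n
  rw [coeff_shiftedDeriv, PowerSeries.coeff_C_mul, PowerSeries.coeff_C_mul, coeff_shiftedDeriv,
    mul_smul_comm]

/-- A Leibniz rule in which the first factor carries the whole shift, as needed when P U P has shift
0 and U P has shift δ. -/
theorem shiftedDeriv_mul (ε δ : ℂ) (F G : PowerSeries R) :
    shiftedDeriv ε δ (F * G) = shiftedDeriv ε δ F * G + F * shiftedDeriv ε 0 G := by
  simp only [shiftedDeriv, numDeriv_mul, add_mul, zero_smul, smul_add, add_zero,
    smul_mul_assoc, mul_smul_comm]
  abel

/-- If `u p = G s` where `s = p u p` is invertible with inverse `t` in the corner of `p`, the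
linear equation satisfied by `u p` becomes a Riccati equation for `G`. -/
theorem riccati {ε δ : ℂ} {q v G u s t : PowerSeries R} {a : R}
    (h1 : q * shiftedDeriv ε δ (u * PowerSeries.C a) =
      (-Complex.I) • (PowerSeries.X * (q * (v * (u * PowerSeries.C a)))))
    (h0 : shiftedDeriv ε 0 s =
      (-Complex.I) • (PowerSeries.X * (PowerSeries.C a * (v * (u * PowerSeries.C a)))))
    (hG : G * s = u * PowerSeries.C a) (hst : s * t = PowerSeries.C a)
    (hGp : G * PowerSeries.C a = G) :
    q * shiftedDeriv ε δ G = (-Complex.I) • (PowerSeries.X * (q * (v * G - G * v * G))) := by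
  have e1 : q * shiftedDeriv ε δ G * s =
      (-Complex.I) • (PowerSeries.X * (q * (v * G - G * v * G))) * s := by
    have e2 := congrArg (q * ·) (shiftedDeriv_mul ε δ G s)
    simp only [mul_add] at e2
    rw [hG, h1, h0] at e2
    rw [mul_assoc, ← sub_eq_iff_eq_add.2 e2, ← hG]
    rw [mul_smul_comm, mul_smul_comm, smul_mul_assoc, ← smul_sub]
    congr 1
    rw [← mul_assoc G PowerSeries.X, (PowerSeries.commute_X G).eq, mul_assoc PowerSeries.X G,
      ← mul_assoc G (PowerSeries.C a), hGp, ← mul_assoc q PowerSeries.X,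
      (PowerSeries.commute_X q).eq, mul_assoc PowerSeries.X q, ← mul_sub, ← mul_sub,
      mul_assoc PowerSeries.X, mul_assoc q, sub_mul]
    simp only [mul_assoc]
  -- As in a quotient rule, the common factor s is cancelled with t; the projection that remains is
  -- absorbed by G.
  have e3 := congrArg (· * t) e1
  simp only [mul_assoc _ s t, hst] at e3
  have e4 : shiftedDeriv ε δ G * PowerSeries.C a = shiftedDeriv ε δ G := by
    conv_rhs => rw [← hGp, shiftedDeriv_mul]
    simp [shiftedDeriv, numDeriv_C]
  rw [mul_assoc, e4] at e3
  rw [e3, smul_mul_assoc]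
  simp only [mul_assoc, sub_mul, mul_sub, hGp]

end Number

theorem strongIntegral_comp_add {E : Type*} [NormedAddCommGroup E] [InnerProductSpace ℂ E]
    {F : ℝ → E →L[ℂ] E} (hF : SInt volume F) (s : ℝ) :
    strongIntegral volume (fun v => F (v + s)) = strongIntegral volume F := by
  have h : SInt volume fun v => F (v + s) := by
    obtain ⟨g, hg, hb⟩ := hF.dom
    exact ⟨hF.meas.comp (measurable_add_const s), fun v => g (v + s), hg.comp_add_right s,
      fun v => hb (v + s)⟩
  ext ψ
  rw [h.strongIntegral_apply, hF.strongIntegral_apply]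
  exact integral_add_right_eq_self (fun v => F v ψ) s

namespace PerturbedSystem

variable {ι E : Type*} [NormedAddCommGroup E] [InnerProductSpace ℂ E]
variable (S : PerturbedSystem ι E)
variable {ε : ℝ}

/-! ### Homogeneity in time -/

theorem Hi_of_nonpos {v : ℝ} (hv : v ≤ 0) : S.Hi ε v =
    (-Complex.I * Complex.exp (ε * v)) • (S.freeEvolution v * S.V * S.freeEvolution (-v)) := by
  rw [Hi, interaction, smul_smul, abs_of_nonpos hv, neg_mul_neg]
  push_cast
  rfl

theorem freeEvolution_neg_mul_self (v : ℝ) : S.freeEvolution (-v) * S.freeEvolution v = 1 := by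
  rw [freeEvolution_mul, neg_add_cancel, freeEvolution_zero]

theorem freeEvolution_mul_P (v : ℝ) :
    S.freeEvolution v * S.P = Complex.exp (v * S.E₀ * Complex.I) • S.P :=
  op_ext_repr S.basis fun ψ i => by
    rw [mul_apply_eq_comp, repr_freeEvolution, smul_apply, map_smul, lp.coeFn_smul, Pi.smul_apply,
      smul_eq_mul, repr_P]
    split_ifs with h
    · rw [h]; push_cast; rfl
    · simp

theorem P_mul_freeEvolution (v : ℝ) :
    S.P * S.freeEvolution v = Complex.exp (v * S.E₀ * Complex.I) • S.P :=
  op_ext_repr S.basis fun ψ i => by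
    rw [mul_apply_eq_comp, repr_P, repr_freeEvolution, smul_apply, map_smul, lp.coeFn_smul,
      Pi.smul_apply, smul_eq_mul, repr_P]
    split_ifs with h
    · rw [h]; push_cast; rfl
    · simp

open Classical in
/-- The projection onto a vector of the basis. -/
def coordProj (i : ι) : E →L[ℂ] E :=
  diagOp S.basis (fun j => if j = i then 1 else 0) fun _ => by split_ifs <;> simp

open Classical in
theorem repr_coordProj (i j : ι) (ψ : E) : S.basis.repr (S.coordProj i ψ) j =
    if j = i then S.basis.repr ψ j else 0 := by
  rw [coordProj, repr_diagOp]; split_ifs <;> simp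

theorem coordProj_mul_freeEvolution (i : ι) (v : ℝ) :
    S.coordProj i * S.freeEvolution v =
      Complex.exp (v * S.energy i * Complex.I) • S.coordProj i :=
  op_ext_repr S.basis fun ψ j => by
    rw [mul_apply_eq_comp, repr_coordProj, repr_freeEvolution, smul_apply, map_smul,
      lp.coeFn_smul, Pi.smul_apply, smul_eq_mul, repr_coordProj]
    split_ifs with h
    · rw [h]; push_cast; rfl
    · simp

variable [CompleteSpace E]

/-- At nonpositive times, H_i(v + s) is H_i(v) conjugated by the free evolution and multiplied by
exp(εs). Translating the integration variable therefore extracts one factor exp(εs) per letter, and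
the inner conjugations cancel. -/
theorem evolutionTerm_homogeneous (hε : 0 < ε) (n : ℕ) {s : ℝ} (hs : s ≤ 0) :
    S.evolutionTerm ε n s = Complex.exp (n * ε * s) •
      (S.freeEvolution s * S.evolutionTerm ε n 0 * S.freeEvolution (-s)) := by
  induction n generalizing s with
  | zero =>
    change (1 : E →L[ℂ] E) = Complex.exp ((0 : ℕ) * ε * s) •
      (S.freeEvolution s * 1 * S.freeEvolution (-s))
    rw [mul_one, freeEvolution_mul, add_neg_cancel, freeEvolution_zero]
    simp
  | succ n ih =>
    have hI := S.sInt_picKernel_mul hε n s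
    have hI0 := S.sInt_picKernel_mul hε n 0
    have hpt : (fun v => S.picKernel ε s (v + s) * S.evolutionTerm ε n (v + s)) = fun v =>
        (Complex.exp ((n + 1 : ℕ) * ε * s) • S.freeEvolution s) *
          (S.picKernel ε 0 v * S.evolutionTerm ε n v) * S.freeEvolution (-s) := by
      ext1 v
      unfold picKernel
      by_cases hv : v ≤ 0
      · rw [if_pos (by linarith), if_pos hv, ih (by linarith : v + s ≤ 0), ih hv,
          S.Hi_of_nonpos hv, S.Hi_of_nonpos (by linarith : v + s ≤ 0)]
        simp only [smul_mul_assoc, mul_smul_comm, smul_smul]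
        have e1 : Complex.exp (n * ε * (v + s : ℝ)) *
            (-Complex.I * Complex.exp (ε * (v + s : ℝ))) =
            Complex.exp (n * ε * v) * (-Complex.I * Complex.exp (ε * v)) *
              Complex.exp ((n + 1 : ℕ) * ε * s) := by
          have : Complex.exp (ε * (v + s : ℝ)) * Complex.exp (n * ε * (v + s : ℝ)) =
            Complex.exp ((n + 1 : ℕ) * ε * s) *
              (Complex.exp (ε * v) * Complex.exp (n * ε * v)) := by
            rw [← Complex.exp_add, ← Complex.exp_add, ← Complex.exp_add]
            congr 1; push_cast; ring
          linear_combination (-Complex.I) * this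
        rw [e1]
        congr 1
        have e2 : S.freeEvolution (-(v + s)) * S.freeEvolution (v + s) = 1 :=
          S.freeEvolution_neg_mul_self _
        have e3 := S.freeEvolution_neg_mul_self v
        calc S.freeEvolution (v + s) * S.V * S.freeEvolution (-(v + s)) *
              (S.freeEvolution (v + s) * S.evolutionTerm ε n 0 * S.freeEvolution (-(v + s)))
            = S.freeEvolution (v + s) * S.V * (S.freeEvolution (-(v + s)) *
              S.freeEvolution (v + s)) * S.evolutionTerm ε n 0 * S.freeEvolution (-(v + s)) := by
              simp only [mul_assoc]
          _ = S.freeEvolution (s + v) * S.V * S.evolutionTerm ε n 0 *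
                S.freeEvolution (-v + -s) := by
              rw [e2, mul_one, add_comm v s, neg_add, add_comm (-s)]
          _ = S.freeEvolution s * S.freeEvolution v * S.V * (S.freeEvolution (-v) *
              S.freeEvolution v) * S.evolutionTerm ε n 0 *
                (S.freeEvolution (-v) * S.freeEvolution (-s)) := by
              rw [e3, mul_one, freeEvolution_mul, freeEvolution_mul]
          _ = _ := by simp only [mul_assoc]
      · rw [if_neg (by linarith), if_neg hv, zero_mul, zero_mul, mul_zero, zero_mul]
    rw [evolutionTerm_succ, ← strongIntegral_comp_add hI s, hpt,
      strongIntegral_mul_right (hI0.mul_left _), strongIntegral_mul_left hI0,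
      ← evolutionTerm_succ, smul_mul_assoc, smul_mul_assoc]

theorem strongIntegral_exp_smul {a : ℂ} (ha : 0 < a.re) (T : E →L[ℂ] E) :
    strongIntegral volume (fun v : ℝ => if v ≤ 0 then Complex.exp (a * v) • T else 0) =
      a⁻¹ • T := by
  have hint := (integrable_indicator_iff measurableSet_Iic).2
    (integrableOn_exp_mul_complex_Iic ha 0)
  have hfun : ∀ v : ℝ, (if v ≤ 0 then Complex.exp (a * v) • T else 0) =
      ((Set.Iic (0 : ℝ)).indicator (fun v : ℝ => Complex.exp (a * v)) v) • T := fun v => by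
    by_cases hv : v ≤ 0
    · rw [if_pos hv, Set.indicator_of_mem (Set.mem_Iic.2 hv)]
    · rw [if_neg hv, Set.indicator_of_notMem (by simpa using hv), zero_smul]
  simp only [hfun]
  have hS : SInt volume fun v : ℝ =>
      ((Set.Iic (0 : ℝ)).indicator (fun v : ℝ => Complex.exp (a * v)) v) • T :=
    ⟨fun ψ => ((by fun_prop : Continuous fun v : ℝ =>
      Complex.exp (a * v)).stronglyMeasurable.indicator measurableSet_Iic).smul_const (T ψ),
      _, hint.norm.mul_const ‖T‖, fun v => (norm_smul _ _).le⟩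
  ext ψ
  rw [hS.strongIntegral_apply]
  simp only [smul_apply]
  rw [integral_smul_const, integral_indicator measurableSet_Iic, integral_exp_mul_complex_Iic ha]
  simp

/-- The eigenoperator equation for the Picard series. -/
theorem eigen_mul_evolutionTerm_succ (hε : 0 < ε) {Q : E →L[ℂ] E} {θ : ℝ}
    (hQ : ∀ v, Q * S.freeEvolution v = Complex.exp (v * θ * Complex.I) • Q) (n : ℕ) :
    ((n + 1 : ℕ) * ε + Complex.I * (θ - S.E₀ : ℝ) : ℂ) • (Q * S.evolutionTerm ε (n + 1) 0 * S.P) =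
      (-Complex.I) • (Q * S.V * S.evolutionTerm ε n 0 * S.P) := by
  set a : ℂ := (n + 1 : ℕ) * ε + Complex.I * (θ - S.E₀ : ℝ) with ha
  have hare : 0 < a.re := by
    rw [ha]
    simp only [Complex.add_re, Complex.mul_re, Complex.I_re, Complex.I_im, Complex.ofReal_re,
      Complex.ofReal_im, Complex.natCast_re, Complex.natCast_im]
    have : 0 < ((n + 1 : ℕ) : ℝ) * ε := by positivity
    simpa using this
  have hI0 := S.sInt_picKernel_mul hε n 0
  -- Between the eigenoperators Q and P all dependence on v collapses to the scalar exp(a v), whose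
  -- integral over v ≤ 0 is 1/a.
  have hpt : (fun v => Q * (S.picKernel ε 0 v * S.evolutionTerm ε n v) * S.P) = fun v : ℝ =>
      if v ≤ 0 then Complex.exp (a * v) •
        ((-Complex.I) • (Q * S.V * S.evolutionTerm ε n 0 * S.P)) else 0 := by
    ext1 v
    unfold picKernel
    by_cases hv : v ≤ 0
    · rw [if_pos hv, if_pos hv, S.evolutionTerm_homogeneous hε n hv, S.Hi_of_nonpos hv]
      simp only [smul_mul_assoc, mul_smul_comm, smul_smul]
      have e : Q * (S.freeEvolution v * S.V * S.freeEvolution (-v) *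
          (S.freeEvolution v * S.evolutionTerm ε n 0 * S.freeEvolution (-v))) * S.P =
          (Q * S.freeEvolution v) * S.V * (S.freeEvolution (-v) * S.freeEvolution v) *
            S.evolutionTerm ε n 0 * (S.freeEvolution (-v) * S.P) := by
        simp only [mul_assoc]
      rw [e, S.freeEvolution_neg_mul_self, mul_one, hQ, S.freeEvolution_mul_P]
      simp only [smul_mul_assoc, mul_smul_comm, smul_smul]
      congr 1
      have : Complex.exp (a * v) = Complex.exp (ε * v) * Complex.exp (n * ε * v) *
          (Complex.exp ((-v : ℝ) * S.E₀ * Complex.I) * Complex.exp (v * θ * Complex.I)) := by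
        rw [← Complex.exp_add, ← Complex.exp_add, ← Complex.exp_add, ha]
        congr 1; push_cast; ring
      rw [this]; ring
    · rw [if_neg hv, if_neg hv, zero_mul, mul_zero, zero_mul]
  have hane : a ≠ 0 := fun h => by rw [h] at hare; simp at hare
  rw [evolutionTerm_succ, ← strongIntegral_mul_left hI0,
    ← strongIntegral_mul_right (hI0.mul_left Q), hpt, strongIntegral_exp_smul hare,
    smul_inv_smul₀ hane]

/-! ### The Riccati recursion for U_GL -/

theorem formalUGL_mul_formalP (hε : 0 < ε) : S.formalUGL ε * S.formalP = S.formalUGL ε := by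
  rw [S.formalUGL_eq hε, mul_assoc, S.formalP_mul_self]

theorem formalP_mul_formalUGL (hε : 0 < ε) : S.formalP * S.formalUGL ε = S.formalP := by
  rw [S.formalUGL_eq hε, ← mul_assoc, S.formalP_mul_evolution_mul_initial hε, S.formalP_mul_self]

/-- The factor nε is the action of ε X d/dX on order n. Order 0 has no source, which is where `hQP`
is needed. -/
theorem shiftedDeriv_evolution (hε : 0 < ε) {Q : E →L[ℂ] E} {θ : ℝ}
    (hQ : ∀ v, Q * S.freeEvolution v = Complex.exp (v * θ * Complex.I) • Q)
    (hQP : (θ - S.E₀ : ℂ) • (Q * S.P) = 0) :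
    shiftedDeriv (ε : ℂ) (Complex.I * (θ - S.E₀ : ℝ))
      (PowerSeries.C Q * (S.formalEvolution ε * S.formalP)) = (-Complex.I) •
        (PowerSeries.X * (PowerSeries.C Q *
          (PowerSeries.C S.V * (S.formalEvolution ε * S.formalP)))) := by
  ext1 n
  rw [coeff_shiftedDeriv, PowerSeries.coeff_C_mul, coeff_mul_formalP, PowerSeries.coeff_smul,
    S.formalEvolution_eq hε, PowerSeries.coeff_mk]
  cases n with
  | zero =>
    rw [PowerSeries.coeff_zero_X_mul, smul_zero, Nat.cast_zero, zero_mul, zero_add,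
      show S.evolutionTerm ε 0 0 = 1 from rfl, one_mul, mul_smul]
    push_cast
    rw [hQP, smul_zero]
  | succ n =>
    rw [PowerSeries.coeff_succ_X_mul, PowerSeries.coeff_C_mul, PowerSeries.coeff_C_mul,
      coeff_mul_formalP, PowerSeries.coeff_mk]
    have := S.eigen_mul_evolutionTerm_succ hε hQ n
    simpa only [mul_assoc] using this

/-- The source term of the recursion for `U_GL`. -/
def source (ε : ℝ) (n : ℕ) : E →L[ℂ] E :=
  PowerSeries.coeff n (PowerSeries.C S.V * S.formalUGL ε -
    S.formalUGL ε * PowerSeries.C S.V * S.formalUGL ε)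

/-- The coordinates of the recursion for `U_GL`. -/
theorem repr_coeff_succ_formalUGL (hε : 0 < ε) (n : ℕ) (ψ : E) (i : ι) :
    ((n + 1 : ℕ) * ε + Complex.I * (S.energy i - S.E₀ : ℝ) : ℂ) *
      S.basis.repr (PowerSeries.coeff (n + 1) (S.formalUGL ε) ψ) i =
        -Complex.I * S.basis.repr (S.source ε n ψ) i := by
  classical
  have hp := S.formalP_mul_self
  have hk := S.formalP_mul_evolution_mul_initial hε
  have hc := S.one_sub_formalP_mul_initial hε
  have hu := S.isUnit_corner hε
  -- Q = P, with shift 0, governs the denominator P U P; Q = `coordProj i` governs the i-th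
  -- coordinate of the numerator U P.
  have h0 := S.shiftedDeriv_evolution hε S.P_mul_freeEvolution (by simp)
  have h1 := S.shiftedDeriv_evolution hε (S.coordProj_mul_freeEvolution i) (by
    refine op_ext_repr S.basis fun ψ j => ?_
    rw [smul_apply, map_smul, lp.coeFn_smul, Pi.smul_apply, smul_eq_mul, mul_apply_eq_comp,
      repr_coordProj, repr_P]
    split_ifs with h h'
    · subst h; rw [h']; simp
    · simp
    · simp)
  rw [sub_self, Complex.ofReal_zero, mul_zero, ← mul_assoc] at h0
  rw [shiftedDeriv_C_mul] at h1
  have key : PowerSeries.C (S.coordProj i) * shiftedDeriv (ε : ℂ)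
      (Complex.I * (S.energy i - S.E₀ : ℝ)) (S.formalUGL ε) = (-Complex.I) • (PowerSeries.X *
        (PowerSeries.C (S.coordProj i) * (PowerSeries.C S.V * S.formalUGL ε -
          S.formalUGL ε * PowerSeries.C S.V * S.formalUGL ε))) :=
    riccati (t := S.formalP * S.initialSeries ε * S.formalP) h1 h0
      (gellMannLow_mul hp hk hc hu) (corner_mul_eq hp hk hc hu).1 (S.formalUGL_mul_formalP hε)
  have key := congrArg (PowerSeries.coeff (n + 1)) key
  rw [PowerSeries.coeff_C_mul, coeff_shiftedDeriv, PowerSeries.coeff_smul,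
    PowerSeries.coeff_succ_X_mul, PowerSeries.coeff_C_mul, ← source] at key
  have key := congrArg (fun T : E →L[ℂ] E => S.basis.repr (T ψ) i) key
  simp only [mul_apply_eq_comp, smul_apply, map_smul, lp.coeFn_smul, Pi.smul_apply, smul_eq_mul,
    repr_coordProj, if_true] at key
  exact key

end PerturbedSystem

namespace PerturbedSystem

variable {ι E : Type*} [NormedAddCommGroup E] [InnerProductSpace ℂ E]
variable (S : PerturbedSystem ι E)
variable {ε : ℝ}

/-! ### The adiabatic limit -/

/-- The imaginary part is the energy difference, so the gap bounds all excited denominators from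
below, uniformly in x and i. -/
theorem le_norm_denominator {δ : ℝ} {i : ι} (h1 : S.E₀ + δ ≤ S.energy i) (x : ℝ) :
    δ ≤ ‖(x : ℂ) + Complex.I * (S.energy i - S.E₀ : ℝ)‖ := by
  refine le_trans ?_ (Complex.abs_im_le_norm _)
  simp only [Complex.add_im, Complex.mul_im, Complex.I_re, Complex.I_im, Complex.ofReal_re,
    Complex.ofReal_im]
  refine le_trans (by linarith) (le_trans (le_abs_self (S.energy i - S.E₀)) (le_of_eq ?_))
  congr 1; ring

open Classical in
/-- `-i (n ε + i (H₀ - E₀))⁻¹ (1 - P)`, multiplied by the gap `δ`. -/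
def scaledResolvent {δ : ℝ} (hδ : 0 < δ) (hgap : ∀ i, S.energy i = S.E₀ ∨ S.E₀ + δ ≤ S.energy i)
    (n : ℕ) (ε : ℝ) : E →L[ℂ] E :=
  diagOp S.basis (fun i => if S.energy i = S.E₀ then 0 else
    -Complex.I * δ * ((n : ℂ) * ε + Complex.I * (S.energy i - S.E₀ : ℝ))⁻¹) fun i => by
    split_ifs with h
    · simp
    · have h2 := S.le_norm_denominator ((hgap i).resolve_left h) (n * ε)
      push_cast at h2 ⊢
      rw [norm_mul, norm_mul, norm_neg, Complex.norm_I, one_mul, Complex.norm_real,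
        Real.norm_of_nonneg hδ.le, norm_inv]
      exact (div_le_one (hδ.trans_le h2)).2 h2

/-- By the resolvent identity the coefficients move by at most n|ε|/δ, uniformly over the basis,
which gives convergence in norm. -/
theorem tendsto_scaledResolvent {δ : ℝ} (hδ : 0 < δ)
    (hgap : ∀ i, S.energy i = S.E₀ ∨ S.E₀ + δ ≤ S.energy i) (n : ℕ) :
    Tendsto (S.scaledResolvent hδ hgap n) (𝓝[>] 0) (𝓝 (S.scaledResolvent hδ hgap n 0)) := by
  have hb : ∀ ε : ℝ, ‖S.scaledResolvent hδ hgap n ε - S.scaledResolvent hδ hgap n 0‖ ≤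
      n * |ε| / δ := fun ε => by
    refine norm_le_of_repr_le S.basis (by positivity) fun ψ i => ?_
    rw [sub_apply, map_sub, lp.coeFn_sub, Pi.sub_apply, scaledResolvent, scaledResolvent,
      repr_diagOp, repr_diagOp, ← sub_mul, norm_mul]
    refine mul_le_mul_of_nonneg_right ?_ (norm_nonneg _)
    split_ifs with h
    · rw [sub_zero, norm_zero]; positivity
    · have h1 := (hgap i).resolve_left h
      have h2 := S.le_norm_denominator h1 (n * ε)
      have h3 := S.le_norm_denominator h1 (n * 0)
      push_cast at h2 h3 ⊢
      set z : ℂ := n * ε + Complex.I * (S.energy i - S.E₀)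
      set w : ℂ := n * 0 + Complex.I * (S.energy i - S.E₀) with hw
      have hz0 : z ≠ 0 := norm_pos_iff.1 (hδ.trans_le h2)
      have hw0 : w ≠ 0 := norm_pos_iff.1 (hδ.trans_le h3)
      have e : -Complex.I * δ * z⁻¹ - -Complex.I * δ * w⁻¹ =
          Complex.I * δ * (n * ε) * (z⁻¹ * w⁻¹) := by
        have : (n * ε : ℂ) = z - w := by simp only [z, w]; ring
        rw [this]
        field_simp
        ring
      rw [e, norm_mul, norm_mul, norm_mul, norm_mul, norm_mul, Complex.norm_I, one_mul,
        Complex.norm_real, Complex.norm_real, Real.norm_of_nonneg hδ.le, Complex.norm_natCast,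
        Real.norm_eq_abs, norm_inv, norm_inv]
      calc δ * (n * |ε|) * (‖z‖⁻¹ * ‖w‖⁻¹) ≤ δ * (n * |ε|) * (δ⁻¹ * δ⁻¹) := by gcongr
        _ = n * |ε| / δ := by field_simp
  rw [tendsto_iff_norm_sub_tendsto_zero]
  refine squeeze_zero (fun _ => norm_nonneg _) hb ?_
  have : Tendsto (fun ε : ℝ => n * |ε| / δ) (𝓝 0) (𝓝 (n * |0| / δ)) :=
    (by fun_prop : Continuous fun ε : ℝ => n * |ε| / δ).tendsto 0
  rw [abs_zero, mul_zero, zero_div] at this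
  exact this.mono_left nhdsWithin_le_nhds

theorem source_eq (ε : ℝ) (n : ℕ) : S.source ε n = S.V * PowerSeries.coeff n (S.formalUGL ε) -
    ∑ x ∈ Finset.HasAntidiagonal.antidiagonal n,
      PowerSeries.coeff x.1 (S.formalUGL ε) * S.V * PowerSeries.coeff x.2 (S.formalUGL ε) := by
  rw [source, map_sub, PowerSeries.coeff_C_mul, PowerSeries.coeff_mul]
  simp only [PowerSeries.coeff_mul_C]

theorem coeff_zero_PH_mul (F : PowerSeries (E →L[ℂ] E)) :
    PowerSeries.coeff 0 (S.PH * F) = ((S.E₀ : ℂ) • S.P) * PowerSeries.coeff 0 F := by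
  rw [PH, add_mul, map_add, PowerSeries.coeff_C_mul, mul_assoc, PowerSeries.coeff_zero_X_mul,
    add_zero]

theorem coeff_succ_PH_mul (F : PowerSeries (E →L[ℂ] E)) (n : ℕ) :
    PowerSeries.coeff (n + 1) (S.PH * F) = ((S.E₀ : ℂ) • S.P) * PowerSeries.coeff (n + 1) F +
      S.P * S.V * PowerSeries.coeff n F := by
  rw [PH, add_mul, map_add, PowerSeries.coeff_C_mul, mul_assoc, PowerSeries.coeff_succ_X_mul,
    PowerSeries.coeff_C_mul]

theorem P_mul_coeff_magnusForm (F : PowerSeries (E →L[ℂ] E)) (n : ℕ) :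
    S.P * PowerSeries.coeff n (S.magnusForm F) = PowerSeries.coeff n S.formalP := by
  rw [← coeff_formalP_mul, magnusForm, mul_add, S.formalP_mul_self, ← mul_assoc, ← mul_assoc,
    mul_sub, mul_one, S.formalP_mul_self, sub_self, zero_mul, zero_mul, add_zero]

/-- `P H (P + (1 - P) exp(F) P)` in order `n ≤ N + 1` only involves the orders `≤ N` of `F`. -/
theorem coeff_PH_mul_magnusForm_congr {F G : PowerSeries (E →L[ℂ] E)} {N : ℕ} (h : AgreeTo N F G)
    {n : ℕ} (hn : n ≤ N + 1) : PowerSeries.coeff n (S.PH * S.magnusForm F) =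
      PowerSeries.coeff n (S.PH * S.magnusForm G) := by
  -- The E₀P term sees only P times the form, which is P whatever the exponent; the PV term carries
  -- a factor X, hence the extra order.
  cases n with
  | zero => rw [coeff_zero_PH_mul, coeff_zero_PH_mul, smul_mul_assoc, smul_mul_assoc,
      P_mul_coeff_magnusForm, P_mul_coeff_magnusForm]
  | succ n =>
    rw [coeff_succ_PH_mul, coeff_succ_PH_mul, smul_mul_assoc, smul_mul_assoc,
      P_mul_coeff_magnusForm, P_mul_coeff_magnusForm]
    have hr : ∀ A : PowerSeries (E →L[ℂ] E), AgreeTo N A A := fun _ _ _ => rfl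
    have : AgreeTo N (S.magnusForm F) (S.magnusForm G) := fun m hm => by
      rw [magnusForm, magnusForm, map_add, map_add,
        (((hr (1 - S.formalP)).mul h.formalExp).mul (hr S.formalP)) m hm]
    rw [this n (by omega)]

variable [CompleteSpace E]

theorem coeff_zero_formalUGL (hε : 0 < ε) : PowerSeries.coeff 0 (S.formalUGL ε) = S.P := by
  rw [S.formalUGL_eq hε, coeff_mul_formalP, S.coeff_evolution_mul_initial hε]
  exact one_mul _

theorem P_mul_coeff_succ_formalUGL (hε : 0 < ε) (n : ℕ) :
    S.P * PowerSeries.coeff (n + 1) (S.formalUGL ε) = 0 := by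
  rw [← coeff_formalP_mul, S.formalP_mul_formalUGL hε, formalP, PowerSeries.coeff_C,
    if_neg n.succ_ne_zero]

theorem repr_coeff_succ_of_energy_eq (hε : 0 < ε) (n : ℕ) (ψ : E) {i : ι}
    (hi : S.energy i = S.E₀) :
    S.basis.repr (PowerSeries.coeff (n + 1) (S.formalUGL ε) ψ) i = 0 := by
  have h := congrArg (fun T : E →L[ℂ] E => S.basis.repr (T ψ) i)
    (S.P_mul_coeff_succ_formalUGL hε n)
  simp only [mul_apply_eq_comp, repr_P, if_pos hi] at h
  rw [h]
  simp

/-- The recursion is divided by its denominators on excited coordinates; on ground coordinates both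
sides vanish, so the small denominator (n + 1)ε is never inverted. -/
theorem coeff_succ_formalUGL_eq {δ : ℝ} (hδ : 0 < δ)
    (hgap : ∀ i, S.energy i = S.E₀ ∨ S.E₀ + δ ≤ S.energy i) (hε : 0 < ε) (n : ℕ) :
    PowerSeries.coeff (n + 1) (S.formalUGL ε) =
      (δ⁻¹ : ℂ) • (S.scaledResolvent hδ hgap (n + 1) ε * S.source ε n) := by
  refine op_ext_repr S.basis fun ψ i => ?_
  rw [smul_apply, map_smul, lp.coeFn_smul, Pi.smul_apply, smul_eq_mul, mul_apply_eq_comp,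
    scaledResolvent, repr_diagOp]
  have hδ' : (δ : ℂ) ≠ 0 := by exact_mod_cast hδ.ne'
  split_ifs with h
  · rw [S.repr_coeff_succ_of_energy_eq hε n ψ h, zero_mul, mul_zero]
  · have h1 := (hgap i).resolve_left h
    have h2 := S.le_norm_denominator h1 ((n + 1 : ℕ) * ε)
    have h3 := S.repr_coeff_succ_formalUGL hε n ψ i
    push_cast at h2 h3 ⊢
    have hz0 := norm_pos_iff.1 (hδ.trans_le h2)
    rw [← mul_assoc]
    field_simp
    linear_combination h3

/-- The source of the coefficient of order n + 1 is a polynomial in coefficients of orders at most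
n, so strong induction applies. -/
theorem exists_tendsto_coeff_formalUGL (hgap : S.HasGap) (n : ℕ) :
    ∃ L : E →L[ℂ] E, Tendsto (fun ε => PowerSeries.coeff n (S.formalUGL ε)) (𝓝[>] 0) (𝓝 L) := by
  obtain ⟨δ, hδ, hgap⟩ := hgap
  induction n using Nat.strong_induction_on with
  | _ n ih =>
    cases n with
    | zero =>
      refine ⟨S.P, tendsto_const_nhds.congr' ?_⟩
      filter_upwards [self_mem_nhdsWithin] with ε hε
      exact (S.coeff_zero_formalUGL hε).symm
    | succ n =>
      choose! L hL using ih
      have hs : Tendsto (fun ε => S.source ε n) (𝓝[>] 0) (𝓝 (S.V * L n -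
          ∑ x ∈ Finset.HasAntidiagonal.antidiagonal n, L x.1 * S.V * L x.2)) := by
        simp only [source_eq]
        refine (tendsto_const_nhds.mul (hL n n.lt_succ_self)).sub (tendsto_finsetSum _ fun x hx => ?_)
        have := Finset.HasAntidiagonal.mem_antidiagonal.1 hx
        exact ((hL x.1 (by omega)).mul tendsto_const_nhds).mul (hL x.2 (by omega))
      refine ⟨_, (((S.tendsto_scaledResolvent hδ hgap (n + 1)).mul hs).const_smul
        (δ⁻¹ : ℂ)).congr' ?_⟩
      filter_upwards [self_mem_nhdsWithin] with ε hε
      exact (S.coeff_succ_formalUGL_eq hδ hgap hε n).symm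

theorem coeff_formalUGL_mem_domain (hε : 0 < ε) (n : ℕ) (ψ : E) :
    PowerSeries.coeff n (S.formalUGL ε) ψ ∈ S.H₀.domain := by
  suffices h : ∃ φ : E, ∀ i, (S.energy i : ℂ) *
      S.basis.repr (PowerSeries.coeff n (S.formalUGL ε) ψ) i = S.basis.repr φ i by
    obtain ⟨φ, hφ⟩ := h
    change Memℓp (fun i => (S.energy i : ℂ) *
      S.basis.repr (PowerSeries.coeff n (S.formalUGL ε) ψ) i) 2
    rw [funext hφ]
    exact lp.memℓp _
  cases n with
  | zero =>
    refine ⟨(S.E₀ : ℂ) • S.P ψ, fun i => ?_⟩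
    rw [S.coeff_zero_formalUGL hε, map_smul, lp.coeFn_smul, Pi.smul_apply, smul_eq_mul, repr_P]
    split_ifs with h
    · rw [h]
    · simp
  | succ n =>
    -- This is H₀ applied to the coefficient, as read off the recursion when it is solved for the
    -- term containing `energy i`.
    refine ⟨(Complex.I * ((n + 1 : ℕ) * ε) + S.E₀ : ℂ) •
      PowerSeries.coeff (n + 1) (S.formalUGL ε) ψ - S.source ε n ψ, fun i => ?_⟩
    have h := S.repr_coeff_succ_formalUGL hε n ψ i
    rw [map_sub, map_smul, lp.coeFn_sub, Pi.sub_apply, lp.coeFn_smul, Pi.smul_apply, smul_eq_mul]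
    push_cast at h ⊢
    set g := S.basis.repr (PowerSeries.coeff (n + 1) (S.formalUGL ε) ψ) i
    linear_combination (-Complex.I) * h + ((S.energy i - S.E₀) * g +
      S.basis.repr (S.source ε n ψ) i) * Complex.I_mul_I

theorem exists_tendsto_coeff_PH_mul (hgap : S.HasGap) (n : ℕ) :
    ∃ L : E →L[ℂ] E, Tendsto (fun ε => PowerSeries.coeff n (S.PH * S.formalUGL ε))
      (𝓝[>] 0) (𝓝 L) := by
  choose L hL using S.exists_tendsto_coeff_formalUGL hgap
  cases n with
  | zero =>
    simp only [coeff_zero_PH_mul]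
    exact ⟨_, tendsto_const_nhds.mul (hL 0)⟩
  | succ n =>
    simp only [coeff_succ_PH_mul]
    exact ⟨_, (tendsto_const_nhds.mul (hL (n + 1))).add (tendsto_const_nhds.mul (hL n))⟩

end PerturbedSystem

/-! ### Evaluation of formal power series -/

/-- In the recursion for the inverse the bounds add up to M^(n+1) (1 + 2 + ⋯ + 2^n), which is below
(2M)^(n+1). -/
theorem norm_coeff_inverse_le {R : Type*} [NormedRing R] {F G : PowerSeries R} {M : ℝ} (hM : 0 ≤ M) (h1 : ‖(1 : R)‖ ≤ 1)
    (hF0 : PowerSeries.coeff 0 F = 1) (hF : ∀ n, ‖PowerSeries.coeff (n + 1) F‖ ≤ M ^ (n + 1))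
    (hFG : F * G = 1) (n : ℕ) : ‖PowerSeries.coeff n G‖ ≤ (2 * M) ^ n := by
  induction n using Nat.strong_induction_on with
  | _ n ih =>
    have hc := congrArg (PowerSeries.coeff n) hFG
    rw [PowerSeries.coeff_mul, PowerSeries.coeff_one] at hc
    cases n with
    | zero =>
      have : PowerSeries.coeff 0 G = 1 := by
        rwa [Finset.Nat.antidiagonal_zero, Finset.sum_singleton, hF0, one_mul, if_pos rfl] at hc
      rw [this, pow_zero]; exact h1
    | succ n =>
      rw [Finset.Nat.sum_antidiagonal_succ, hF0, one_mul, if_neg n.succ_ne_zero] at hc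
      rw [eq_neg_of_add_eq_zero_left hc, norm_neg]
      calc ‖∑ x ∈ Finset.HasAntidiagonal.antidiagonal n,
            PowerSeries.coeff (x.1 + 1) F * PowerSeries.coeff x.2 G‖
          ≤ ∑ x ∈ Finset.HasAntidiagonal.antidiagonal n, M ^ (x.1 + 1) * (2 * M) ^ x.2 := by
            refine norm_sum_le_of_le _ fun x hx => (norm_mul_le _ _).trans ?_
            have := Finset.HasAntidiagonal.mem_antidiagonal.1 hx
            exact mul_le_mul (hF _) (ih _ (by omega)) (norm_nonneg _) (by positivity)
        _ = ∑ x ∈ Finset.HasAntidiagonal.antidiagonal n, M ^ (n + 1) * 2 ^ x.2 := by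
            refine Finset.sum_congr rfl fun x hx => ?_
            rw [← Finset.HasAntidiagonal.mem_antidiagonal.1 hx]; ring
        _ = M ^ (n + 1) * (2 ^ (n + 1) - 1) := by
            rw [← Finset.mul_sum, Finset.Nat.sum_antidiagonal_swap.symm,
              Finset.Nat.sum_antidiagonal_eq_sum_range_succ_mk]
            simp only [Prod.snd_swap]
            rw [geom_sum_eq (by norm_num)]
            norm_num
        _ ≤ (2 * M) ^ (n + 1) := by
            rw [mul_pow]
            have : 0 ≤ M ^ (n + 1) := by positivity
            nlinarith

section Evaluation

variable {R : Type*} [NormedRing R] [NormedAlgebra ℂ R]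

/-- The power series `F` converges absolutely at `lam`, with sum `a`. -/
structure EvalsTo (lam : ℂ) (F : PowerSeries R) (a : R) : Prop where
  summable : Summable fun n => ‖lam ^ n • PowerSeries.coeff n F‖
  hasSum : HasSum (fun n => lam ^ n • PowerSeries.coeff n F) a

variable {lam : ℂ} {F G : PowerSeries R} {a b : R}

theorem EvalsTo.C (lam : ℂ) (a : R) : EvalsTo lam (PowerSeries.C a) a := by
  have h : ∀ n, n ≠ 0 → lam ^ n • PowerSeries.coeff n (PowerSeries.C a) = 0 := fun n hn => by
    rw [PowerSeries.coeff_C, if_neg hn, smul_zero]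
  have h0 : lam ^ 0 • PowerSeries.coeff 0 (PowerSeries.C a) = a := by simp
  refine ⟨summable_of_ne_finset_zero (s := {0}) fun n hn => ?_, ?_⟩
  · rw [h n (by simpa using hn), norm_zero]
  · have := hasSum_single (f := fun n => lam ^ n • PowerSeries.coeff n (PowerSeries.C a)) 0 h
    simpa only [h0] using this

theorem EvalsTo.add (hF : EvalsTo lam F a) (hG : EvalsTo lam G b) :
    EvalsTo lam (F + G) (a + b) := by
  have h : ∀ n, lam ^ n • PowerSeries.coeff n (F + G) =
      lam ^ n • PowerSeries.coeff n F + lam ^ n • PowerSeries.coeff n G := fun n => by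
    rw [map_add, smul_add]
  refine ⟨?_, ?_⟩
  · exact Summable.of_nonneg_of_le (fun _ => norm_nonneg _)
      (fun n => by rw [h]; exact norm_add_le _ _) (hF.summable.add hG.summable)
  · simpa only [h] using hF.hasSum.add hG.hasSum

theorem EvalsTo.mul [CompleteSpace R] (hF : EvalsTo lam F a) (hG : EvalsTo lam G b) :
    EvalsTo lam (F * G) (a * b) := by
  have h : ∀ n, lam ^ n • PowerSeries.coeff n (F * G) =
      ∑ x ∈ Finset.HasAntidiagonal.antidiagonal n,
        (lam ^ x.1 • PowerSeries.coeff x.1 F) * (lam ^ x.2 • PowerSeries.coeff x.2 G) := fun n => by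
    rw [PowerSeries.coeff_mul, Finset.smul_sum]
    refine Finset.sum_congr rfl fun x hx => ?_
    rw [smul_mul_smul_comm, ← pow_add, Finset.HasAntidiagonal.mem_antidiagonal.1 hx]
  have hs := summable_norm_sum_mul_antidiagonal_of_summable_norm hF.summable hG.summable
  refine ⟨by simpa only [h] using hs, ?_⟩
  have ht := tsum_mul_tsum_eq_tsum_sum_antidiagonal_of_summable_norm hF.summable hG.summable
  rw [hF.hasSum.tsum_eq, hG.hasSum.tsum_eq] at ht
  rw [ht]
  simp only [h]
  exact hs.of_norm.hasSum

theorem EvalsTo.of_norm_le [CompleteSpace R] {M : ℝ} (hM : 0 ≤ M)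
    (hF : ∀ n, ‖PowerSeries.coeff n F‖ ≤ M ^ n) (hl : ‖lam‖ * M < 1) :
    ∃ a, EvalsTo lam F a := by
  have hs : Summable fun n => ‖lam ^ n • PowerSeries.coeff n F‖ := by
    refine Summable.of_nonneg_of_le (fun _ => norm_nonneg _) (fun n => ?_)
      (summable_geometric_of_lt_one (by positivity) hl)
    rw [norm_smul, norm_pow, mul_pow]
    exact mul_le_mul_of_nonneg_left (hF n) (by positivity)
  exact ⟨_, hs, hs.of_norm.hasSum⟩

end Evaluation

namespace PerturbedSystem

variable {ι E : Type*} [NormedAddCommGroup E] [InnerProductSpace ℂ E]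
variable (S : PerturbedSystem ι E)
variable {ε : ℝ}

/-! ### The evolution operator -/

theorem norm_evolutionTerm_le (hε : 0 < ε) (n : ℕ) (t : ℝ) :
    ‖S.evolutionTerm ε n t‖ ≤ (∫ u, S.bound ε u) ^ n := by
  have := (sMeas_chainInt_and_norm_le (S.integrable_bound hε) _
    (dominated_of_mem_replicate (S.dominated_picKernel ε) n)).2 t
  rwa [List.length_replicate] at this

theorem integrable_Hi_mul_evolutionTerm (hε : 0 < ε) (n : ℕ) (ψ : E) :
    Integrable fun u => S.Hi ε u (S.evolutionTerm ε n u ψ) := by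
  have h := (sMeas_chainInt_and_norm_le (S.integrable_bound hε) _
    (dominated_of_mem_replicate (S.dominated_picKernel ε) n)).1
  have hS : SInt volume fun u => S.Hi ε u * S.evolutionTerm ε n u :=
    ⟨(S.sMeas_Hi ε).mul h, _, (S.integrable_bound hε).mul_const _, fun u =>
      (norm_mul_le _ _).trans (mul_le_mul (S.norm_Hi_le ε u) (S.norm_evolutionTerm_le hε n u)
        (norm_nonneg _) (S.bound_nonneg ε u))⟩
  exact hS.integrable ψ

theorem evolutionTerm_succ_apply (hε : 0 < ε) (n : ℕ) (t : ℝ) (ψ : E) :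
    S.evolutionTerm ε (n + 1) t ψ =
      ∫ u in Set.Iic t, S.Hi ε u (S.evolutionTerm ε n u ψ) := by
  rw [evolutionTerm_succ, (S.sInt_picKernel_mul hε n t).strongIntegral_apply,
    ← integral_indicator measurableSet_Iic]
  congr 1
  ext u
  by_cases h : u ≤ t
  · rw [Set.indicator_of_mem (Set.mem_Iic.2 h), picKernel, if_pos h]; rfl
  · rw [Set.indicator_of_notMem (by simpa using h), picKernel, if_neg h, zero_mul]; rfl

theorem tendsto_evolutionTerm_succ (hε : 0 < ε) (n : ℕ) (ψ : E) :
    Tendsto (fun t => S.evolutionTerm ε (n + 1) t ψ) atBot (𝓝 0) := by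
  simp only [S.evolutionTerm_succ_apply hε]
  have hi := S.integrable_Hi_mul_evolutionTerm hε n ψ
  have h := intervalIntegral_tendsto_integral_Iic 0 hi.integrableOn tendsto_id
  have h2 := (tendsto_const_nhds (x := ∫ u in Set.Iic (0 : ℝ),
    S.Hi ε u (S.evolutionTerm ε n u ψ))).sub h
  rw [sub_self] at h2
  refine h2.congr fun t => ?_
  rw [id, ← intervalIntegral.integral_Iic_sub_Iic hi.integrableOn hi.integrableOn]
  abel

theorem norm_smul_evolutionTerm_le (hε : 0 < ε) (lam : ℂ) (n : ℕ) (t : ℝ) (ψ : E) :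
    ‖lam ^ n • S.evolutionTerm ε n t ψ‖ ≤ (‖lam‖ * ∫ u, S.bound ε u) ^ n * ‖ψ‖ := by
  rw [norm_smul, norm_pow, mul_pow, mul_assoc]
  exact mul_le_mul_of_nonneg_left
    ((S.evolutionTerm ε n t).le_of_opNorm_le (S.norm_evolutionTerm_le hε n t) ψ) (by positivity)

variable [CompleteSpace E]

theorem hasDerivAt_setIntegral_Iic {h : ℝ → E} (hc : Continuous h) (hi : Integrable h) (t : ℝ) :
    HasDerivAt (fun t => ∫ u in Set.Iic t, h u) (h t) t := by
  have h1 : (fun t => ∫ u in Set.Iic t, h u) =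
      fun t => (∫ u in Set.Iic 0, h u) + ∫ u in (0 : ℝ)..t, h u := by
    ext t
    rw [← intervalIntegral.integral_Iic_sub_Iic hi.integrableOn hi.integrableOn]
    abel
  rw [h1]
  exact (hc.integral_hasStrictDerivAt 0 t).hasDerivAt.const_add _

theorem continuous_evolutionTerm (hε : 0 < ε) (n : ℕ) (ψ : E) :
    Continuous fun t => S.evolutionTerm ε n t ψ := by
  induction n with
  | zero => exact continuous_const
  | succ n ih =>
    simp only [S.evolutionTerm_succ_apply hε]
    exact continuous_iff_continuousAt.2 fun t => (hasDerivAt_setIntegral_Iic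
      (S.continuous_Hi_apply ε ih) (S.integrable_Hi_mul_evolutionTerm hε n ψ) t).continuousAt

theorem hasDerivAt_evolutionTerm_succ (hε : 0 < ε) (n : ℕ) (ψ : E) (t : ℝ) :
    HasDerivAt (fun t => S.evolutionTerm ε (n + 1) t ψ)
      (S.Hi ε t (S.evolutionTerm ε n t ψ)) t := by
  simp only [S.evolutionTerm_succ_apply hε]
  exact hasDerivAt_setIntegral_Iic (S.continuous_Hi_apply ε (S.continuous_evolutionTerm hε n ψ))
    (S.integrable_Hi_mul_evolutionTerm hε n ψ) t

/-- The sum of the Picard series. -/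
def evolution (ε : ℝ) (lam : ℂ) (t : ℝ) : E →L[ℂ] E := ∑' n, lam ^ n • S.evolutionTerm ε n t

theorem evalsTo_evolution (hε : 0 < ε) {lam : ℂ} (hl : ‖lam‖ * (∫ u, S.bound ε u) < 1) (t : ℝ) :
    EvalsTo lam (PowerSeries.mk fun n => S.evolutionTerm ε n t) (S.evolution ε lam t) := by
  obtain ⟨a, ha⟩ := EvalsTo.of_norm_le (F := PowerSeries.mk fun n => S.evolutionTerm ε n t)
    (integral_nonneg (S.bound_nonneg ε))
    (fun n => by rw [PowerSeries.coeff_mk]; exact S.norm_evolutionTerm_le hε n t) hl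
  have : a = S.evolution ε lam t := by
    rw [← ha.hasSum.tsum_eq, evolution]
    simp only [PowerSeries.coeff_mk]
  exact this ▸ ha

theorem hasSum_evolution_apply (hε : 0 < ε) {lam : ℂ} (hl : ‖lam‖ * (∫ u, S.bound ε u) < 1)
    (t : ℝ) (ψ : E) :
    HasSum (fun n => lam ^ n • S.evolutionTerm ε n t ψ) (S.evolution ε lam t ψ) := by
  have := (S.evalsTo_evolution hε hl t).hasSum.mapL (ContinuousLinearMap.apply ℂ E ψ)
  simpa using this

/-- The series is differentiated term by term, the derivative of each order being H_i applied to the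
previous one. At -∞, dominated convergence leaves only order 0. -/
theorem isEvolution_evolution (hε : 0 < ε) {lam : ℂ} (hl : ‖lam‖ * (∫ u, S.bound ε u) < 1) :
    S.IsEvolution ε lam (S.evolution ε lam) := by
  set q := ‖lam‖ * ∫ u, S.bound ε u with hq
  have hq0 : 0 ≤ q := mul_nonneg (norm_nonneg _) (integral_nonneg (S.bound_nonneg ε))
  have hU : ∀ ψ : E, (fun t => S.evolution ε lam t ψ) =
      fun t => ∑' n, lam ^ n • S.evolutionTerm ε n t ψ := fun ψ => by
    ext t; exact (S.hasSum_evolution_apply hε hl t ψ).tsum_eq.symm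
  refine ⟨fun ψ t => ?_, fun ψ => ?_⟩
  · rw [hU]
    set g' : ℕ → ℝ → E := fun n t => match n with
      | 0 => 0
      | n + 1 => lam ^ (n + 1) • S.Hi ε t (S.evolutionTerm ε n t ψ) with hg'
    -- A majorant independent of time: the damping exponential in the bound for H_i is replaced by
    -- 1.
    set u : ℕ → ℝ := fun n => match n with
      | 0 => 0
      | n + 1 => ‖lam‖ * (2 * ‖S.V‖) * (q ^ n * ‖ψ‖) with hu
    have hsu : Summable u := by
      refine (summable_nat_add_iff 1).1 ?_
      exact ((summable_geometric_of_lt_one hq0 hl).mul_right _).mul_left _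
    have hH : ∀ t, ‖S.Hi ε t‖ ≤ 2 * ‖S.V‖ := fun t => by
      refine (S.norm_Hi_le ε t).trans ?_
      unfold bound
      refine mul_le_of_le_one_right (by positivity) (Real.exp_le_one_iff.2 ?_)
      have := mul_nonneg hε.le (abs_nonneg t)
      linarith
    have hb : ∀ n t, ‖g' n t‖ ≤ u n := by
      rintro (_ | n) t
      · simp [hg', hu]
      · simp only [hg', hu]
        rw [pow_succ', mul_smul, ← map_smul, norm_smul, mul_assoc]
        refine mul_le_mul_of_nonneg_left ?_ (norm_nonneg _)
        exact (S.Hi ε t).le_of_opNorm_le_of_le (hH t) (S.norm_smul_evolutionTerm_le hε lam n t ψ)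
    have hd : ∀ n t, HasDerivAt (fun t => lam ^ n • S.evolutionTerm ε n t ψ) (g' n t) t := by
      rintro (_ | n) t
      · exact hasDerivAt_const t (lam ^ 0 • (1 : E →L[ℂ] E) ψ)
      · exact (S.hasDerivAt_evolutionTerm_succ hε n ψ t).const_smul _
    have h := hasDerivAt_tsum hsu hd hb (S.hasSum_evolution_apply hε hl 0 ψ).summable t
    have hval : ∑' n, g' n t = (-Complex.I * lam) • S.interaction ε t (S.evolution ε lam t ψ) := by
      have h1 : HasSum (fun n => g' (n + 1) t)
          ((-Complex.I * lam) • S.interaction ε t (S.evolution ε lam t ψ)) := by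
        have h2 := ((S.hasSum_evolution_apply hε hl t ψ).mapL (S.Hi ε t)).const_smul lam
        have h3 : lam • S.Hi ε t (S.evolution ε lam t ψ) =
            (-Complex.I * lam) • S.interaction ε t (S.evolution ε lam t ψ) := by
          rw [Hi, smul_apply, smul_smul, mul_comm]
        have h4 : (fun n => lam • S.Hi ε t (lam ^ n • S.evolutionTerm ε n t ψ)) =
            fun n => g' (n + 1) t := by
          ext1 n
          simp only [hg']
          rw [map_smul, smul_smul, ← pow_succ']
        rw [h3, h4] at h2
        exact h2
      rw [(hsu.of_norm_bounded fun n => hb n t).tsum_eq_zero_add, h1.tsum_eq]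
      simp [hg']
    rw [hval] at h
    exact h
  · rw [hU]
    have h := tendsto_tsum_of_dominated_convergence (𝓕 := atBot)
      (f := fun t n => lam ^ n • S.evolutionTerm ε n t ψ) (g := fun n => if n = 0 then ψ else 0)
      (bound := fun n => q ^ n * ‖ψ‖) ((summable_geometric_of_lt_one hq0 hl).mul_right _)
      (fun n => ?_) (Eventually.of_forall fun t n => S.norm_smul_evolutionTerm_le hε lam n t ψ)
    · rw [tsum_ite_eq] at h
      exact h
    · cases n with
      | zero => simp [evolutionTerm, chainInt]
      | succ n => simpa using (S.tendsto_evolutionTerm_succ hε n ψ).const_smul (lam ^ (n + 1))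

/-- Integration from -∞ halves any bound on a half line, since |λ| times the integral of `bound` is
at most 1/2; iteration gives 0. -/
theorem eq_zero_of_interaction_eq (hε : 0 < ε) {lam : ℂ}
    (hl : ‖lam‖ * (∫ u, S.bound ε u) ≤ 1 / 2) {y : ℝ → E}
    (hy : ∀ t, HasDerivAt y ((-Complex.I * lam) • S.interaction ε t (y t)) t)
    (hlim : Tendsto y atBot (𝓝 0)) (t : ℝ) : y t = 0 := by
  have hyc : Continuous y := continuous_iff_continuousAt.2 fun t => (hy t).continuousAt
  have hder : ∀ t, HasDerivAt y (lam • S.Hi ε t (y t)) t := fun t => by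
    have : lam • S.Hi ε t (y t) = (-Complex.I * lam) • S.interaction ε t (y t) := by
      rw [Hi, smul_apply, smul_smul, mul_comm]
    rw [this]; exact hy t
  have hdc : Continuous fun t => lam • S.Hi ε t (y t) :=
    (S.continuous_Hi_apply ε hyc).const_smul lam
  have hg := S.integrable_bound hε
  -- a bound on a half line improves by a factor two
  have hstep : ∀ m : ℝ, 0 ≤ m → (∀ s ≤ t, ‖y s‖ ≤ m) → ∀ s ≤ t, ‖y s‖ ≤ m / 2 := by
    intro m hm hb s hs
    have hle : ∀ a ≤ s, ‖y s - y a‖ ≤ m / 2 := by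
      intro a ha
      rw [← intervalIntegral.integral_eq_sub_of_hasDerivAt (fun x _ => hder x)
        (hdc.intervalIntegrable _ _)]
      have hint : Integrable fun u => ‖lam‖ * (S.bound ε u * m) := (hg.mul_const m).const_mul _
      refine (intervalIntegral.norm_integral_le_of_norm_le ha (g := fun u =>
        ‖lam‖ * (S.bound ε u * m)) (Eventually.of_forall fun u hu => ?_)
        hint.intervalIntegrable).trans ?_
      · rw [norm_smul]
        exact mul_le_mul_of_nonneg_left ((S.Hi ε u).le_of_opNorm_le_of_le (S.norm_Hi_le ε u)
          (hb u (hu.2.trans hs))) (norm_nonneg _)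
      · rw [intervalIntegral.integral_of_le ha]
        refine (setIntegral_le_integral hint (Eventually.of_forall fun u =>
          mul_nonneg (norm_nonneg _) (mul_nonneg (S.bound_nonneg ε u) hm))).trans ?_
        rw [integral_const_mul, integral_mul_const, ← mul_assoc]
        nlinarith
    have h1 : Tendsto (fun a => ‖y s - y a‖) atBot (𝓝 ‖y s - 0‖) :=
      (tendsto_const_nhds.sub hlim).norm
    rw [sub_zero] at h1
    exact le_of_tendsto h1 ((eventually_le_atBot s).mono hle)
  -- A first finite bound comes from the limit at -∞ and compactness of the remaining interval.
  obtain ⟨m, hm, hb⟩ : ∃ m : ℝ, 0 ≤ m ∧ ∀ s ≤ t, ‖y s‖ ≤ m := by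
    have h1 : ∀ᶠ a in atBot, ‖y a‖ ≤ 1 := by
      have := hlim.norm
      rw [norm_zero] at this
      exact this.eventually_le_const one_pos
    obtain ⟨s₀, hs₀⟩ := eventually_atBot.1 h1
    obtain ⟨C, hC⟩ := isCompact_Icc.exists_bound_of_continuousOn (s := Set.Icc s₀ t)
      hyc.continuousOn
    refine ⟨max 1 C, le_max_of_le_left zero_le_one, fun s hs => ?_⟩
    rcases le_total s s₀ with h | h
    · exact (hs₀ s h).trans (le_max_left _ _)
    · exact (hC s ⟨h, hs⟩).trans (le_max_right _ _)
  have hiter : ∀ k : ℕ, ∀ s ≤ t, ‖y s‖ ≤ m * (1 / 2) ^ k := by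
    intro k
    induction k with
    | zero => simpa using hb
    | succ k ih =>
      have := hstep _ (by positivity) ih
      intro s hs
      exact (this s hs).trans (le_of_eq (by ring))
  have h0 : Tendsto (fun k : ℕ => m * (1 / 2 : ℝ) ^ k) atTop (𝓝 0) := by
    have := (tendsto_pow_atTop_nhds_zero_of_lt_one (r := (1 / 2 : ℝ)) (by norm_num)
      (by norm_num)).const_mul m
    rwa [mul_zero] at this
  exact norm_le_zero_iff.1 (ge_of_tendsto' h0 fun k => hiter k t le_rfl)

theorem IsEvolution.unique (hε : 0 < ε) {lam : ℂ} (hl : ‖lam‖ * (∫ u, S.bound ε u) ≤ 1 / 2)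
    {U U' : ℝ → E →L[ℂ] E} (hU : S.IsEvolution ε lam U) (hU' : S.IsEvolution ε lam U') :
    U' = U := by
  ext t ψ
  refine sub_eq_zero.1 (S.eq_zero_of_interaction_eq hε hl (y := fun s => U' s ψ - U s ψ)
    (fun s => ?_) ?_ t)
  · rw [map_sub, smul_sub]
    exact (hU'.1 ψ s).sub (hU.1 ψ s)
  · have := (hU'.2 ψ).sub (hU.2 ψ)
    rwa [sub_self] at this

/-- Convergence of the Gell-Mann and Low series. -/
theorem isUnit_and_evalsTo_formalUGL (hε : 0 < ε) {lam : ℂ}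
    (hl : ‖lam‖ * (2 * ∫ u, S.bound ε u) < 1) :
    IsUnit (S.P * S.evolution ε lam 0 * S.P + (1 - S.P)) ∧
      EvalsTo lam (S.formalUGL ε) (gellMannLow S.P (S.evolution ε lam 0)) := by
  set M := ∫ u, S.bound ε u with hM
  have hM0 : 0 ≤ M := integral_nonneg (S.bound_nonneg ε)
  have hl' : ‖lam‖ * M < 1 := by
    have := mul_nonneg (norm_nonneg lam) hM0
    linarith
  have hP := EvalsTo.C lam S.P
  have h1 : EvalsTo lam (1 - S.formalP) (1 - S.P) := by
    have := EvalsTo.C lam (1 - S.P)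
    rwa [map_sub, map_one] at this
  have hU : EvalsTo lam (S.formalEvolution ε) (S.evolution ε lam 0) := by
    rw [S.formalEvolution_eq hε]; exact S.evalsTo_evolution hε hl' 0
  have hW := ((hP.mul hU).mul hP).add h1
  obtain ⟨w, hw⟩ := S.isUnit_corner hε
  obtain ⟨b, hb⟩ : ∃ b, EvalsTo lam (↑w⁻¹ : PowerSeries (E →L[ℂ] E)) b := by
    refine EvalsTo.of_norm_le (by positivity) (norm_coeff_inverse_le hM0 norm_one_le_one
      (S.coeff_zero_corner hε) (fun n => ?_) (by rw [← hw, Units.mul_inv])) hl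
    rw [coeff_corner, if_neg n.succ_ne_zero, add_zero, S.formalEvolution_eq hε,
      PowerSeries.coeff_mk]
    calc ‖S.P * S.evolutionTerm ε (n + 1) 0 * S.P‖
        ≤ ‖S.P‖ * ‖S.evolutionTerm ε (n + 1) 0‖ * ‖S.P‖ := norm_mul₃_le
      _ ≤ 1 * M ^ (n + 1) * 1 := by
          gcongr
          exacts [S.norm_P_le, S.norm_evolutionTerm_le hε _ _, S.norm_P_le]
      _ = M ^ (n + 1) := by ring
  have hone : EvalsTo lam (1 : PowerSeries (E →L[ℂ] E)) 1 := by
    have := EvalsTo.C lam (1 : E →L[ℂ] E)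
    rwa [map_one] at this
  -- Evaluation at λ is multiplicative, so the sum of the inverse series is the inverse of the sum.
  have e1 := (hW.mul hb).hasSum
  have e2 := (hb.mul hW).hasSum
  have hw' : S.formalP * S.formalEvolution ε * S.formalP + (1 - S.formalP) = w := hw.symm
  rw [← formalP, hw', Units.mul_inv] at e1
  rw [← formalP, hw', Units.inv_mul] at e2
  have e1 := e1.unique hone.hasSum
  have e2 := e2.unique hone.hasSum
  set a : (E →L[ℂ] E)ˣ := ⟨_, b, e1, e2⟩ with ha
  refine ⟨⟨a, rfl⟩, ?_⟩
  have hi : Ring.inverse (S.P * S.evolution ε lam 0 * S.P + (1 - S.P)) = b := Ring.inverse_unit a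
  have hi' : Ring.inverse (S.formalP * S.formalEvolution ε * S.formalP + (1 - S.formalP)) =
      ↑w⁻¹ := by rw [hw', Ring.inverse_unit]
  rw [formalUGL, gellMannLow, gellMannLow, cornerInverse, cornerInverse, hi, hi']
  exact (hU.mul hP).mul (hb.mul hP)

end PerturbedSystem

end Hyperoctahedral

end

/-! ### Assembly of the four statements -/

theorem mainTheorem5 {ι E : Type*} [NormedAddCommGroup E] [InnerProductSpace ℂ E]
    [CompleteSpace E] (S : Hyperoctahedral.PerturbedSystem ι E) (hgap : S.HasGap) :
    -- The formal `U_GL(ε)` is the expansion of the Gell-Mann and Low operator of the solution of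
    -- the Schrödinger equation, and it takes values in the domain of the Hamiltonian.
    (∀ ε : ℝ, 0 < ε → ∃ r : ℝ, 0 < r ∧ ∀ lam : ℂ, ‖lam‖ < r →
      ∃ U : ℝ → E →L[ℂ] E, S.IsEvolution ε lam U ∧
        (∀ U' : ℝ → E →L[ℂ] E, S.IsEvolution ε lam U' → U' = U) ∧
        IsUnit (S.P * U 0 * S.P + (1 - S.P)) ∧
        HasSum (fun n : ℕ => lam ^ n • PowerSeries.coeff n (S.formalUGL ε))
          (Hyperoctahedral.gellMannLow S.P (U 0))) ∧
    (∀ ε : ℝ, 0 < ε → ∀ (n : ℕ) (ψ : E),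
      PowerSeries.coeff n (S.formalUGL ε) ψ ∈ S.H₀.domain) ∧
    -- The exponential form of `U_GL(ε)`.
    (∀ ε : ℝ, 0 < ε → S.formalUGL ε = S.magnusForm (S.Omega ε)) ∧
    -- The exponent up to third order.
    (∀ ε : ℝ, 0 < ε →
      PowerSeries.coeff 0 (S.Omega ε) = 0 ∧
      PowerSeries.coeff 1 (S.Omega ε) = S.H ε ![1] + S.H ε ![-1] ∧
      PowerSeries.coeff 2 (S.Omega ε) = (1 / 2 : ℂ) •
        (S.H ε ![1, 2] + S.H ε ![-1, 2] + S.H ε ![2, -1] + S.H ε ![-2, -1]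
          - S.H ε ![1, -2] - S.H ε ![-1, -2] - S.H ε ![2, 1] - S.H ε ![-2, 1]) ∧
      PowerSeries.coeff 3 (S.Omega ε) =
        (1 / 3 : ℂ) •
          (S.H ε ![1, 2, 3] + S.H ε ![-1, 2, 3] + S.H ε ![1, 3, -2] + S.H ε ![-1, 3, -2]
          + S.H ε ![2, -1, 3] + S.H ε ![-2, -1, 3] + S.H ε ![2, 3, -1] + S.H ε ![-2, 3, -1]
          + S.H ε ![3, -2, -1] + S.H ε ![-3, -2, -1] + S.H ε ![3, -1, 2] + S.H ε ![-3, -1, 2]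
          + S.H ε ![3, 2, 1] + S.H ε ![-3, 2, 1] + S.H ε ![2, -3, 1] + S.H ε ![-2, -3, 1]
          + S.H ε ![1, -2, -3] + S.H ε ![-1, -2, -3] + S.H ε ![1, -3, 2] + S.H ε ![-1, -3, 2]
          + S.H ε ![2, 1, -3] + S.H ε ![-2, 1, -3] + S.H ε ![3, 1, -2] + S.H ε ![-3, 1, -2])
        - (1 / 6 : ℂ) •
          (S.H ε ![1, 3, 2] + S.H ε ![-1, 3, 2] + S.H ε ![2, 3, 1] + S.H ε ![-2, 3, 1]
          + S.H ε ![2, 1, 3] + S.H ε ![-2, 1, 3] + S.H ε ![3, 1, 2] + S.H ε ![-3, 1, 2]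
          + S.H ε ![1, -3, -2] + S.H ε ![-1, -3, -2] + S.H ε ![1, -2, 3] + S.H ε ![-1, -2, 3]
          + S.H ε ![2, -1, -3] + S.H ε ![-2, -1, -3] + S.H ε ![3, -1, -2] + S.H ε ![-3, -1, -2]
          + S.H ε ![2, -3, -1] + S.H ε ![-2, -3, -1] + S.H ε ![3, -2, 1] + S.H ε ![-3, -2, 1]
          + S.H ε ![1, 2, -3] + S.H ε ![-1, 2, -3] + S.H ε ![3, 2, -1] + S.H ε ![-3, 2, -1])) ∧
    -- The effective Hamiltonian and its two expansions; limits are taken order by order.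
    ∃ Heff : PowerSeries (E →L[ℂ] E),
      (∀ n : ℕ, Tendsto (fun ε : ℝ => PowerSeries.coeff n (S.PH * S.formalUGL ε))
        (𝓝[>] 0) (𝓝 (PowerSeries.coeff n Heff))) ∧
      (∀ n : ℕ, Tendsto (fun ε : ℝ => PowerSeries.coeff n (S.PH * S.magnusForm (S.Omega ε)))
        (𝓝[>] 0) (𝓝 (PowerSeries.coeff n Heff))) ∧
      (∀ n : ℕ, n ≤ 4 →
        Tendsto (fun ε : ℝ => PowerSeries.coeff n (S.PH * S.magnusForm (S.Omega₃ ε)))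
          (𝓝[>] 0) (𝓝 (PowerSeries.coeff n Heff))) := by
  refine ⟨fun ε hε => ?_, fun ε hε n ψ => S.coeff_formalUGL_mem_domain hε n ψ,
    fun ε hε => S.formalUGL_eq_magnusForm hε,
    fun ε hε => ⟨Hyperoctahedral.coeff_zero_formalLog _, S.coeff_one_Omega, S.coeff_two_Omega hε,
      S.coeff_three_Omega hε⟩, ?_⟩
  · set M := ∫ u, S.bound ε u with hM
    have hM0 : 0 ≤ M := integral_nonneg (S.bound_nonneg ε)
    -- This radius gives |λ| M ≤ 1/4, enough both for the inverse series (2|λ|M < 1) and for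
    -- uniqueness (|λ|M ≤ 1/2); M + 1 avoids division by zero.
    refine ⟨1 / (4 * (M + 1)), by positivity, fun lam hlam => ?_⟩
    have hl : ‖lam‖ * M ≤ 1 / 4 := by
      rw [lt_div_iff₀ (by positivity)] at hlam
      have := norm_nonneg lam
      nlinarith
    have hev := S.isEvolution_evolution hε (lam := lam) (by rw [← hM]; linarith)
    obtain ⟨h1, h2⟩ := S.isUnit_and_evalsTo_formalUGL hε (lam := lam) (by rw [← hM]; linarith)
    exact ⟨S.evolution ε lam, hev, fun U' hU' =>
      Hyperoctahedral.PerturbedSystem.IsEvolution.unique S hε (by rw [← hM]; linarith) hev hU',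
      h1, h2.hasSum⟩
  · choose L hL using S.exists_tendsto_coeff_PH_mul hgap
    have hL' : ∀ n, Tendsto (fun ε : ℝ => PowerSeries.coeff n (S.PH * S.magnusForm (S.Omega ε)))
        (𝓝[>] 0) (𝓝 (L n)) := fun n => by
      refine (hL n).congr' ?_
      filter_upwards [self_mem_nhdsWithin] with ε hε
      rw [S.formalUGL_eq_magnusForm hε]
    refine ⟨PowerSeries.mk L, fun n => ?_, fun n => ?_, fun n hn => ?_⟩
    · rw [PowerSeries.coeff_mk]; exact hL n
    · rw [PowerSeries.coeff_mk]; exact hL' n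
    · rw [PowerSeries.coeff_mk]
      -- Agreement of the exponents up to order 3 suffices for order 4 because P H gains one order.
      refine (hL' n).congr fun ε => S.coeff_PH_mul_magnusForm_congr (N := 3) (fun m hm => ?_) hn
      rw [Hyperoctahedral.PerturbedSystem.Omega₃, PowerSeries.coeff_mk, if_pos hm]
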